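/- **Setting.** Let $(N,g_N,Z)$ be a Sasakian three-manifold: $g_N$ is a smooth Riemannian metric and $Z$ a smooth unit Killing field such that $I(X)=\nabla_XZ$ satisfies $(\nabla_XI)(Y)=g_N(Z,Y)X-g_N(X,Y)Z$. Let $\eta=g_N(Z,\cdot)$, and let $M^4=N\times\mathbb R$ with $W=\partial/\partial t$ and the complex structure $J$ given by $J=I$ on $\ker\eta\subset TN$, $JZ=W$, $JW=-Z$ (a Sasaki-type complex surface). A tensor field on $M$ is invariant if its Lie derivatives along $Z$ and $W$ vanish. For a function $f$, $d^cf=-df\circ J$; for a metric $g$, $\omega(X,Y)=g(X,JY)$ and $d^c\omega=-d\omega(J\cdot,J\cdot,J\cdot)$. A Hermitian connection form is a pair $\mu=(\mu^Z,\mu^W)$ of smooth invariant one-forms on $M$ with $\mu^Z(Z)=\mu^W(W)=1$, $\mu^Z(W)=\mu^W(Z)=0$, $\mu^Z\circ J=-\mu^W$, $\mu^W\circ J=\mu^Z$; its curvature is $F_\mu=(F^Z_\mu,F^W_\mu)=(d\mu^Z,d\mu^W)$. An invariant transverse metric is an invariant symmetric $J$-invariant two-tensor $g^T$ on $M$ that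 vanishes on $\operatorname{span}\{Z,W\}$ and is positive definite transversally to it. Its scalar curvature $R^T$ and Laplacian $\Delta_{g^T}$ are those of the transverse Levi-Civita connection; for a $g^T$-orthonormal transverse frame $e_1,e_2$, and $F=F_\mu^Z$ or $F^W_\mu$, $\operatorname{tr}_{\omega^T}F=\tfrac12\sum_iF(e_i,Je_i)$ and $|F|^2=\sum_{i,j}F(e_i,e_j)^2$, and $|F_\mu|^2=|F^Z_\mu|^2+|F^W_\mu|^2$. For invariant functions $f_1,f_2$ let $$\mu_f=\left(\mu^Z+d^cf_1+df_2,\ \mu^W+d^cf_2-df_1\right),$$ and for a positive function $\psi$ let $g(g^T,\mu,\psi)=g^T+\psi\,(\mu^Z\otimes\mu^Z+\mu^W\otimes\mu^W)$. **Proposition.** Let $\mu$ be a Hermitian connection form on $M$, and let $(g^T_t,f_{1,t},f_{2,t})$, with $t$ in an interval $\mathcal T\subset\mathbb R$ having more than one point, be a smooth one-parameter family of invariant transverse metrics and invariant functions on $M$ satisfying $$\frac{\partial g^T}{\partial t}=-\tfrac12\left(R^T-|F_{\mu_f}|^2\right)g^T,\qquad \frac{\partial f_1}{\partial t}=\tfrac12\operatorname{tr}_{\omega^T}F^Z_{\mu_f},\qquad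 \frac{\partial f_2}{\partial t}=\tfrac12\operatorname{tr}_{\omega^T}F^W_{\mu_f}.$$ Then $\operatorname{tr}_{\omega^T}F^Z_{\mu_f}=\Delta_{g^T}f_1+\operatorname{tr}_{\omega^T}F^Z_\mu$ and $\operatorname{tr}_{\omega^T}F^W_{\mu_f}=\Delta_{g^T}f_2+\operatorname{tr}_{\omega^T}F^W_\mu$ (so that the last two equations are heat equations for $f_1,f_2$), and the metrics $g_t=g(g^T_t,\mu_{f_t},1)$ are a solution to pluriclosed flow on $(M,J)$: they form a smooth family of $J$-Hermitian Riemannian metrics with $dd^c\omega_t=0$ and $$\frac{\partial\omega}{\partial t}=-\rho_B^{1,1},$$ where $\rho_B^{1,1}$ is the $(1,1)$ part of $\rho_B(X,Y)=\tfrac12\sum_{i=1}^4g(\Omega^B(X,Y)e_i,Je_i)$, the $e_i$ form a $g$-orthonormal basis, and $\Omega^B$ is the curvature of the Bismut connection $\nabla^B=\nabla+\tfrac12g^{-1}d^c\omega$. -/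

import Mathlib

open Set Bundle
open scoped Manifold ContDiff

noncomputable section

namespace PluriclosedReduction

/-! ## Tensor calculus in a coordinate domain

Tensor fields on (an open subset of) a normed space `E` are written as functions of the base point
and of constant vectors. -/

section Coordinates

variable {E : Type*} [NormedAddCommGroup E] [NormedSpace ℝ E]

/-- Exterior derivative of a `k`-form, without normalising factor:
`dβ(v₀, …, vₖ) = ∑ᵢ (-1)ⁱ vᵢ β(v₀, …, v̂ᵢ, …, vₖ)` for constant vector fields `vᵢ`. -/
def dForm {k : ℕ} (β : E → (Fin k → E) → ℝ) (x : E) (v : Fin (k + 1) → E) : ℝ :=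
  ∑ i : Fin (k + 1), (-1 : ℝ) ^ (i : ℕ) * fderiv ℝ (fun y => β y (fun j => v (i.succAbove j))) x (v i)

/-- Exterior derivative of a `1`-form, as a function of two vectors. -/
def dOne (α : E → E → ℝ) (x u v : E) : ℝ :=
  dForm (fun y (w : Fin 1 → E) => α y (w 0)) x ![u, v]

/-- Lie derivative `L_V α` of a `1`-form. -/
def lieOne (V : E → E) (α : E → E → ℝ) (x u : E) : ℝ :=
  fderiv ℝ (fun y => α y u) x (V x) + α x (fderiv ℝ V x u)

/-- Lie derivative `L_V B` of a covariant `2`-tensor. -/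
def lieTwo (V : E → E) (B : E → E → E → ℝ) (x u v : E) : ℝ :=
  fderiv ℝ (fun y => B y u v) x (V x) + B x (fderiv ℝ V x u) v + B x u (fderiv ℝ V x v)

/-- A vector representing the functional `ℓ` through `B`, i.e. `B (raise B ℓ) w = ℓ w` for all `w`.
It is unique if `B` is nondegenerate, and unique modulo the kernel of `B` in general. -/
def raise (B : E → E → ℝ) (ℓ : E → ℝ) : E :=
  Classical.epsilon fun v => ∀ w, B v w = ℓ w

/-- Koszul formula: `g(∇_u v, w)` for constant vector fields `u, v, w`. -/
def koszul (g : E → E → E → ℝ) (x u v w : E) : ℝ :=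
  (1 / 2) * (fderiv ℝ (fun y => g y v w) x u + fderiv ℝ (fun y => g y u w) x v
    - fderiv ℝ (fun y => g y u v) x w)

/-- Christoffel symbol `Γ(u, v) = ∇_u v` (constant `u, v`) of the Levi-Civita connection of `g`. -/
def christoffel (g : E → E → E → ℝ) (x u v : E) : E :=
  raise (g x) (koszul g x u v)

/-- The curvature `R(u, v)w = ∇_u ∇_v w - ∇_v ∇_u w` (constant `u, v, w`) of the connection with
connection coefficients `Γ(u, v) = ∇_u v`. -/
def curvature (Γ : E → E → E → E) (x u v w : E) : E :=
  fderiv ℝ (fun y => Γ y v w) x u - fderiv ℝ (fun y => Γ y u w) x v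
    + Γ x u (Γ x v w) - Γ x v (Γ x u w)

/-- The form `ω(u, v) = g(u, Jv)`. -/
def kahlerForm (g : E → E → E → ℝ) (J : E → E → E) (x u v : E) : ℝ := g x u (J x v)

/-- `d^c ω = i(∂̄ - ∂) ω = -dω(J·, J·, J·)` for the Kähler form `ω` of `(g, J)`. -/
def dcKahler (g : E → E → E → ℝ) (J : E → E → E) (x : E) (v : Fin 3 → E) : ℝ :=
  -dForm (fun y (w : Fin 2 → E) => kahlerForm g J y (w 0) (w 1)) x (fun i => J x (v i))

/-- Connection coefficients of the Bismut connection `∇^B = ∇ + ½ g⁻¹ d^c ω`. -/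
def bismut (g : E → E → E → ℝ) (J : E → E → E) (x u v : E) : E :=
  raise (g x) fun w => koszul g x u v w + (1 / 2) * dcKahler g J x ![u, v, w]

/-- `e` is orthonormal for the symmetric form `B`. -/
def IsOrthonormal {n : ℕ} (B : E → E → ℝ) (e : Fin n → E) : Prop :=
  ∀ i j, B (e i) (e j) = if i = j then 1 else 0

open Classical in
/-- The value of the expression `S` on some `B`-orthonormal `n`-tuple (used only for traces, which
do not depend on the tuple). For a positive semidefinite form `B` of rank `n` there is such a tuple,
and it is unique modulo the kernel of `B` up to an orthogonal transformation. -/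
def onFrame (n : ℕ) (B : E → E → ℝ) (S : (Fin n → E) → ℝ) : ℝ :=
  if h : ∃ e : Fin n → E, IsOrthonormal B e then S h.choose else 0

/-- Bismut-Ricci form `ρ_B(u, v) = ½ ∑ᵢ g(Ω^B(u, v) eᵢ, J eᵢ)`, the sum over an orthonormal basis. -/
def bismutRicci (g : E → E → E → ℝ) (J : E → E → E) (x u v : E) : ℝ :=
  onFrame (Module.finrank ℝ E) (g x) fun e =>
    (1 / 2) * ∑ i, g x (curvature (bismut g J) x u v (e i)) (J x (e i))

/-- The `(1,1)` part of the Bismut-Ricci form. -/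
def bismutRicci11 (g : E → E → E → ℝ) (J : E → E → E) (x u v : E) : ℝ :=
  (1 / 2) * (bismutRicci g J x u v + bismutRicci g J x (J x u) (J x v))

/-! ### Transverse quantities

Here `gT` is a positive semidefinite form whose kernel `𝒱` is spanned by vector fields that leave
`gT` invariant. The Koszul formula then defines the transverse Levi-Civita connection on `TM / 𝒱`:
`koszul gT x u v` vanishes on `𝒱`, so that `christoffel gT x u v` represents `∇^T_u v` modulo `𝒱`. -/

/-- Transverse curvature `gT(R^T(u, v)w, z)`; as `∇^T` is metric,
`gT(∇^T_u ∇^T_v w, z) = u (gT(∇^T_v w, z)) - gT(∇^T_v w, ∇^T_u z)`. -/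
def transverseRiem (gT : E → E → E → ℝ) (x u v w z : E) : ℝ :=
  (fderiv ℝ (fun y => koszul gT y v w z) x u
      - gT x (christoffel gT x v w) (christoffel gT x u z))
    - (fderiv ℝ (fun y => koszul gT y u w z) x v
      - gT x (christoffel gT x u w) (christoffel gT x v z))

/-- Scalar curvature `R^T` of a transverse metric of rank two. -/
def transverseScal (gT : E → E → E → ℝ) (x : E) : ℝ :=
  onFrame 2 (gT x) fun e => ∑ i, ∑ j, transverseRiem gT x (e i) (e j) (e j) (e i)

/-- Transverse Laplacian `∑ᵢ (∇^T df)(eᵢ, eᵢ)` of a function that is constant along `𝒱`. -/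
def transverseLaplacian (gT : E → E → E → ℝ) (f : E → ℝ) (x : E) : ℝ :=
  onFrame 2 (gT x) fun e => ∑ i, (fderiv ℝ (fun y => fderiv ℝ f y (e i)) x (e i)
    - fderiv ℝ f x (christoffel gT x (e i) (e i)))

/-- The trace of the two-form `F = dα` with respect to `ω^T`, that is
`½ ∑ᵢ F(eᵢ, J eᵢ)`; it equals `F(e, Je)` for every transverse unit vector `e`. -/
def traceCurv (gT : E → E → E → ℝ) (J : E → E → E) (α : E → E → ℝ) (x : E) : ℝ :=
  onFrame 2 (gT x) fun e => (1 / 2) * ∑ i, dOne α x (e i) (J x (e i))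

/-- The squared tensor norm `∑ᵢⱼ F(eᵢ, eⱼ)²` of the two-form `F = dα`. -/
def normSqCurv (gT : E → E → E → ℝ) (α : E → E → ℝ) (x : E) : ℝ :=
  onFrame 2 (gT x) fun e => ∑ i, ∑ j, dOne α x (e i) (e j) ^ 2

end Coordinates

/-! ## Tensor fields on a manifold -/

section Manifold

variable {E : Type*} [NormedAddCommGroup E] [NormedSpace ℝ E] {H : Type*} [TopologicalSpace H]
  (I : ModelWithCorners ℝ E H) {M : Type*} [TopologicalSpace M] [ChartedSpace H M]

/-- Vector fields. -/
abbrev VField (M : Type*) [TopologicalSpace M] [ChartedSpace H M] : Type _ :=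
  ∀ p : M, TangentSpace I p

/-- One-forms. -/
abbrev OneForm (M : Type*) [TopologicalSpace M] [ChartedSpace H M] : Type _ :=
  ∀ p : M, TangentSpace I p →L[ℝ] ℝ

/-- Covariant two-tensors. -/
abbrev TwoTensor (M : Type*) [TopologicalSpace M] [ChartedSpace H M] : Type _ :=
  ∀ p : M, TangentSpace I p →L[ℝ] TangentSpace I p →L[ℝ] ℝ

/-- Fields of endomorphisms of the tangent bundle. -/
abbrev EndField (M : Type*) [TopologicalSpace M] [ChartedSpace H M] : Type _ :=
  ∀ p : M, TangentSpace I p →L[ℝ] TangentSpace I p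

/-- The coordinates of a tangent vector at `p` in the chart around `c`. -/
def toCoord (c p : M) (X : TangentSpace I p) : E :=
  mfderiv I 𝓘(ℝ, E) (extChartAt I c) p X

/-- The tangent vector with coordinates `u` at the point with coordinates `y`,
in the chart around `c`. -/
def ofCoord (c : M) (y u : E) : TangentSpace I ((extChartAt I c).symm y) :=
  mfderivWithin 𝓘(ℝ, E) I (extChartAt I c).symm (range I) y u

variable {I}

/-- Coordinate expression of a vector field in the chart around `c`. -/
def vecRep (c : M) (V : VField I M) (y : E) : E :=
  toCoord I c _ (V ((extChartAt I c).symm y))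

/-- Coordinate expression of a one-form in the chart around `c`. -/
def oneRep (c : M) (α : OneForm I M) (y u : E) : ℝ :=
  α ((extChartAt I c).symm y) (ofCoord I c y u)

/-- Coordinate expression of a covariant two-tensor in the chart around `c`. -/
def twoRep (c : M) (B : TwoTensor I M) (y u v : E) : ℝ :=
  B ((extChartAt I c).symm y) (ofCoord I c y u) (ofCoord I c y v)

/-- Coordinate expression of a endomorphism field in the chart around `c`. -/
def endRep (c : M) (A : EndField I M) (y u : E) : E :=
  toCoord I c _ (A ((extChartAt I c).symm y) (ofCoord I c y u))

/-- `L_V α = 0`, for a one-form. -/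
def InvariantOne (V : VField I M) (α : OneForm I M) : Prop :=
  ∀ (p : M) (u : E), lieOne (vecRep p V) (oneRep p α) (extChartAt I p p) u = 0

/-- `L_V B = 0`, for a covariant two-tensor. -/
def InvariantTwo (V : VField I M) (B : TwoTensor I M) : Prop :=
  ∀ (p : M) (u v : E), lieTwo (vecRep p V) (twoRep p B) (extChartAt I p p) u v = 0

/-- The differential of a function. -/
def dFun (f : M → ℝ) : OneForm I M := fun p => mfderiv I 𝓘(ℝ, ℝ) f p

/-- `d^c f = i(∂̄ - ∂) f = -df ∘ J`. -/
def dcFun (J : EndField I M) (f : M → ℝ) : OneForm I M := fun p => -(dFun f p ∘L J p)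

/-- Smoothness of a one-form. -/
def SmoothOne [IsManifold I ∞ M] (α : OneForm I M) : Prop :=
  ContMDiff I (I.prod 𝓘(ℝ, E →L[ℝ] ℝ)) ∞ fun p : M => TotalSpace.mk' (E →L[ℝ] ℝ)
    (E := fun p : M => TangentSpace I p →L[ℝ] ℝ) p (α p)

/-- Joint smoothness on `𝒯 × M` of a family of functions. -/
def SmoothFunFamily (𝒯 : Set ℝ) (f : ℝ → M → ℝ) : Prop :=
  ContMDiffOn (I.prod 𝓘(ℝ, ℝ)) 𝓘(ℝ, ℝ) ∞ (fun q : M × ℝ => f q.2 q.1) (univ ×ˢ 𝒯)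

/-- Joint smoothness on `𝒯 × M` of a family of covariant two-tensors. -/
def SmoothTwoFamily [IsManifold I ∞ M] (𝒯 : Set ℝ) (B : ℝ → TwoTensor I M) : Prop :=
  ContMDiffOn (I.prod 𝓘(ℝ, ℝ)) (I.prod 𝓘(ℝ, E →L[ℝ] E →L[ℝ] ℝ)) ∞
    (fun q : M × ℝ => TotalSpace.mk' (E →L[ℝ] E →L[ℝ] ℝ)
      (E := fun p : M => TangentSpace I p →L[ℝ] TangentSpace I p →L[ℝ] ℝ) q.1 (B q.2 q.1))
    (univ ×ˢ 𝒯)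

/-- `g` is pluriclosed: `d d^c ω = 2 i ∂∂̄ ω = 0`. -/
def IsPluriclosed (J : EndField I M) (g : TwoTensor I M) : Prop :=
  ∀ (p : M) (v : Fin 4 → E),
    dForm (dcKahler (twoRep p g) (endRep p J)) (extChartAt I p p) v = 0

/-- `ρ_B^{1,1}` on a Hermitian manifold. -/
def rhoB11 (J : EndField I M) (g : TwoTensor I M) (p : M) (X Y : TangentSpace I p) : ℝ :=
  bismutRicci11 (twoRep p g) (endRep p J) (extChartAt I p p) (toCoord I p p X) (toCoord I p p Y)

/-- `(g_t)`, `t ∈ 𝒯`, is a solution to pluriclosed flow `∂ω/∂t = -ρ_B^{1,1}` on `(M, J)`: a smooth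
family of pluriclosed Hermitian metrics whose Kähler forms evolve as stated. -/
structure IsPluriclosedFlow [IsManifold I ∞ M] (J : EndField I M) (𝒯 : Set ℝ)
    (g : ℝ → TwoTensor I M) : Prop where
  smooth : SmoothTwoFamily 𝒯 g
  symm : ∀ t ∈ 𝒯, ∀ (p : M) (X Y : TangentSpace I p), g t p X Y = g t p Y X
  pos : ∀ t ∈ 𝒯, ∀ (p : M) (X : TangentSpace I p), X ≠ 0 → 0 < g t p X X
  hermitian : ∀ t ∈ 𝒯, ∀ (p : M) (X Y : TangentSpace I p), g t p (J p X) (J p Y) = g t p X Y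
  pluriclosed : ∀ t ∈ 𝒯, IsPluriclosed J (g t)
  evolution : ∀ t ∈ 𝒯, ∀ (p : M) (X Y : TangentSpace I p),
    HasDerivWithinAt (fun s => g s p X (J p Y)) (-rhoB11 J (g t) p X Y) 𝒯 t

/-- The scalar curvature `R^T` of a transverse metric. -/
def scalT (gT : TwoTensor I M) (p : M) : ℝ :=
  transverseScal (twoRep p gT) (extChartAt I p p)

/-- The Laplacian of a transverse metric. -/
def lapT (gT : TwoTensor I M) (f : M → ℝ) (p : M) : ℝ :=
  transverseLaplacian (twoRep p gT) (fun y => f ((extChartAt I p).symm y)) (extChartAt I p p)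

/-- `tr_{ω^T} F` for `F = dα`. -/
def trF (J : EndField I M) (gT : TwoTensor I M) (α : OneForm I M) (p : M) : ℝ :=
  traceCurv (twoRep p gT) (endRep p J) (oneRep p α) (extChartAt I p p)

/-- `|F|²` for the curvature `F = (dμ^Z, dμ^W)` of `μ = (μ^Z, μ^W)`. -/
def normSqF (gT : TwoTensor I M) (μZ μW : OneForm I M) (p : M) : ℝ :=
  normSqCurv (twoRep p gT) (oneRep p μZ) (extChartAt I p p)
    + normSqCurv (twoRep p gT) (oneRep p μW) (extChartAt I p p)

end Manifold

/-! ## Sasakian three-manifolds and Sasaki-type complex surfaces -/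

/-- A Sasakian structure on a three-manifold `N`: a Riemannian metric `g` and a unit Killing field
`Z` such that `I(X) = ∇_X Z` satisfies `(∇_X I)(Y) = g(Z, Y) X - g(X, Y) Z`. The endomorphism field
`I` is determined by `g` and `Z`. -/
structure Sasakian (N : Type*) [TopologicalSpace N] [ChartedSpace (EuclideanSpace ℝ (Fin 3)) N]
    [IsManifold (𝓡 3) ∞ N] where
  g : ContMDiffRiemannianMetric (𝓡 3) ∞ (EuclideanSpace ℝ (Fin 3))
    (fun x : N => TangentSpace (𝓡 3) x)
  Z : VField (𝓡 3) N
  I : EndField (𝓡 3) N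
  smooth_Z : ContMDiff (𝓡 3) (𝓡 3).tangent ∞ fun x : N => (⟨x, Z x⟩ : TangentBundle (𝓡 3) N)
  smooth_I : ContMDiff (𝓡 3)
    ((𝓡 3).prod 𝓘(ℝ, EuclideanSpace ℝ (Fin 3) →L[ℝ] EuclideanSpace ℝ (Fin 3))) ∞
    fun x : N => TotalSpace.mk' (EuclideanSpace ℝ (Fin 3) →L[ℝ] EuclideanSpace ℝ (Fin 3))
      (E := fun x : N => TangentSpace (𝓡 3) x →L[ℝ] TangentSpace (𝓡 3) x) x (I x)
  unit : ∀ x, g.inner x (Z x) (Z x) = 1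
  killing : InvariantTwo Z g.inner
  I_eq : ∀ (x : N) (u : EuclideanSpace ℝ (Fin 3)),
    endRep x I (extChartAt (𝓡 3) x x) u =
      fderiv ℝ (vecRep x Z) (extChartAt (𝓡 3) x x) u
        + christoffel (twoRep x g.inner) (extChartAt (𝓡 3) x x) u
          (vecRep x Z (extChartAt (𝓡 3) x x))
  nabla_I : ∀ (x : N) (u v : EuclideanSpace ℝ (Fin 3)),
    fderiv ℝ (fun y => endRep x I y v) (extChartAt (𝓡 3) x x) u
        + christoffel (twoRep x g.inner) (extChartAt (𝓡 3) x x) u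
          (endRep x I (extChartAt (𝓡 3) x x) v)
        - endRep x I (extChartAt (𝓡 3) x x)
          (christoffel (twoRep x g.inner) (extChartAt (𝓡 3) x x) u v) =
      twoRep x g.inner (extChartAt (𝓡 3) x x) (vecRep x Z (extChartAt (𝓡 3) x x)) v • u
        - twoRep x g.inner (extChartAt (𝓡 3) x x) u v • vecRep x Z (extChartAt (𝓡 3) x x)

/-- The model with corners of the cylinder `N × ℝ`. -/
abbrev cylModel : ModelWithCorners ℝ (EuclideanSpace ℝ (Fin 3) × ℝ)
    (ModelProd (EuclideanSpace ℝ (Fin 3)) ℝ) :=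
  (𝓡 3).prod 𝓘(ℝ, ℝ)

namespace Sasakian

variable {N : Type*} [TopologicalSpace N] [ChartedSpace (EuclideanSpace ℝ (Fin 3)) N]
  [IsManifold (𝓡 3) ∞ N] (S : Sasakian N)

/-- The contact form `η = g(Z, ·)`. -/
def η : OneForm (𝓡 3) N := fun x => S.g.inner x (S.Z x)

/-- The field `Z` on `N × ℝ`. -/
def cylZ : VField cylModel (N × ℝ) :=
  fun p => ((S.Z p.1, (0 : ℝ)) : TangentSpace (𝓡 3) p.1 × ℝ)

/-- The field `W = ∂/∂t` on `N × ℝ`. -/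
def cylW (_S : Sasakian N) : VField cylModel (N × ℝ) :=
  fun p => ((0, 1) : TangentSpace (𝓡 3) p.1 × ℝ)

/-- The complex structure `J` of the cylinder: `J = I` on `Q = ker η`, `J Z = W`, `J W = -Z`, so that
`J (X, s) = (I (X - η(X) Z) - s Z, η(X))`. -/
def cylJ : EndField cylModel (N × ℝ) := fun p =>
  (((S.I p.1 ∘L (ContinuousLinearMap.id ℝ _ - (S.η p.1).smulRight (S.Z p.1))) ∘L
        ContinuousLinearMap.fst ℝ (TangentSpace (𝓡 3) p.1) ℝ
      - (ContinuousLinearMap.snd ℝ (TangentSpace (𝓡 3) p.1) ℝ).smulRight (S.Z p.1)).prod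
    (S.η p.1 ∘L ContinuousLinearMap.fst ℝ (TangentSpace (𝓡 3) p.1) ℝ) :
    (TangentSpace (𝓡 3) p.1 × ℝ) →L[ℝ] (TangentSpace (𝓡 3) p.1 × ℝ))

/-- `Z f = W f = 0`. -/
def InvariantFun (f : N × ℝ → ℝ) : Prop :=
  ∀ p, dFun (I := cylModel) f p (S.cylZ p) = 0 ∧ dFun (I := cylModel) f p (S.cylW p) = 0

/-- `μ = μ^Z ξ₁ + μ^W ξ₂` is a Hermitian connection form. -/
structure IsHermitianConnection (μZ μW : OneForm cylModel (N × ℝ)) : Prop where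
  smooth_Z : SmoothOne μZ
  smooth_W : SmoothOne μW
  Z_Z : ∀ p, μZ p (S.cylZ p) = 1
  Z_W : ∀ p, μZ p (S.cylW p) = 0
  W_Z : ∀ p, μW p (S.cylZ p) = 0
  W_W : ∀ p, μW p (S.cylW p) = 1
  Z_J : ∀ p X, μZ p (S.cylJ p X) = -μW p X
  W_J : ∀ p X, μW p (S.cylJ p X) = μZ p X
  lie_Z_Z : InvariantOne S.cylZ μZ
  lie_Z_W : InvariantOne S.cylZ μW
  lie_W_Z : InvariantOne S.cylW μZ
  lie_W_W : InvariantOne S.cylW μW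

/-- The algebraic and invariance properties of an invariant transverse (Hermitian) metric:
`gT` is symmetric, `J`-invariant, invariant under `Z` and `W`, vanishes on
`𝒱 = span {Z, W}` and is positive definite transversally to `𝒱`. -/
structure IsInvariantTransverseMetric (gT : TwoTensor cylModel (N × ℝ)) : Prop where
  symm : ∀ p X Y, gT p X Y = gT p Y X
  hermitian : ∀ p X Y, gT p (S.cylJ p X) (S.cylJ p Y) = gT p X Y
  ker_Z : ∀ p X, gT p X (S.cylZ p) = 0
  ker_W : ∀ p X, gT p X (S.cylW p) = 0
  pos : ∀ p X, (∀ a b : ℝ, X ≠ a • S.cylZ p + b • S.cylW p) → 0 < gT p X X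
  lie_Z : InvariantTwo S.cylZ gT
  lie_W : InvariantTwo S.cylW gT

/-- The `Z`-component `μ^Z + d^c f₁ + d f₂` of `μ_f`. -/
def twistZ (μZ : OneForm cylModel (N × ℝ)) (f₁ f₂ : N × ℝ → ℝ) : OneForm cylModel (N × ℝ) :=
  fun p => μZ p + dcFun S.cylJ f₁ p + dFun f₂ p

/-- The `W`-component `μ^W + d^c f₂ - d f₁` of `μ_f`. -/
def twistW (μW : OneForm cylModel (N × ℝ)) (f₁ f₂ : N × ℝ → ℝ) : OneForm cylModel (N × ℝ) :=
  fun p => μW p + dcFun S.cylJ f₂ p - dFun f₁ p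

end Sasakian

/-- The metric `g(gT, μ, ψ) = gT + ψ ⟨μ, μ⟩ = gT + ψ (μ^Z ⊗ μ^Z + μ^W ⊗ μ^W)`. -/
def bundleMetric {E : Type*} [NormedAddCommGroup E] [NormedSpace ℝ E] {H : Type*}
    [TopologicalSpace H] {I : ModelWithCorners ℝ E H} {M : Type*} [TopologicalSpace M]
    [ChartedSpace H M] (gT : TwoTensor I M) (μZ μW : OneForm I M) (ψ : M → ℝ) :
    TwoTensor I M :=
  fun p => gT p + ψ p • ((μZ p).smulRight (μZ p) + (μW p).smulRight (μW p))

/-- `(gT, f₁, f₂)`, `t ∈ 𝒯`, is a smooth one-parameter family of invariant transverse metrics and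
invariant functions that solves the reduced system
`∂gT/∂t = -½ (R^T - |F_{μ_f}|²) gT`, `∂f₁/∂t = ½ tr F^Z_{μ_f}`, `∂f₂/∂t = ½ tr F^W_{μ_f}`. -/
structure SolvesReducedSystem {N : Type*} [TopologicalSpace N]
    [ChartedSpace (EuclideanSpace ℝ (Fin 3)) N] [IsManifold (𝓡 3) ∞ N] (S : Sasakian N)
    (μZ μW : OneForm cylModel (N × ℝ)) (𝒯 : Set ℝ) (gT : ℝ → TwoTensor cylModel (N × ℝ))
    (f₁ f₂ : ℝ → N × ℝ → ℝ) : Prop where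
  smooth_gT : SmoothTwoFamily 𝒯 gT
  smooth_f₁ : SmoothFunFamily (I := cylModel) 𝒯 f₁
  smooth_f₂ : SmoothFunFamily (I := cylModel) 𝒯 f₂
  transverse : ∀ t ∈ 𝒯, S.IsInvariantTransverseMetric (gT t)
  invariant_f₁ : ∀ t ∈ 𝒯, S.InvariantFun (f₁ t)
  invariant_f₂ : ∀ t ∈ 𝒯, S.InvariantFun (f₂ t)
  evolution_gT : ∀ t ∈ 𝒯, ∀ (p : N × ℝ) (X Y : TangentSpace cylModel p),
    HasDerivWithinAt (fun s => gT s p X Y)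
      (-(1 / 2) * (scalT (gT t) p
        - normSqF (gT t) (S.twistZ μZ (f₁ t) (f₂ t)) (S.twistW μW (f₁ t) (f₂ t)) p)
        * gT t p X Y) 𝒯 t
  evolution_f₁ : ∀ t ∈ 𝒯, ∀ p : N × ℝ, HasDerivWithinAt (fun s => f₁ s p)
    ((1 / 2) * trF S.cylJ (gT t) (S.twistZ μZ (f₁ t) (f₂ t)) p) 𝒯 t
  evolution_f₂ : ∀ t ∈ 𝒯, ∀ p : N × ℝ, HasDerivWithinAt (fun s => f₂ s p)
    ((1 / 2) * trF S.cylJ (gT t) (S.twistW μW (f₁ t) (f₂ t)) p) 𝒯 t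

end PluriclosedReduction

end

/-! In a chart write `G` for the transverse metric and `a`, `b` for the two components of `μ_f`, so
that the metric is `G + a ⊗ a + b ⊗ b` and `ω = ω^T + b ∧ a`. Invariance together with the
normalisation on `Z` and `W` says that `da` and `db` annihilate `Z` and `W`. As the transverse rank
is two, every such two-form is a multiple of the area form `G(J·,·)` (`IsTransverse.skew_basic`).
Hence `da = φ G(J·,·)` and `db = ψ G(J·,·)`, where `φ`, `ψ` are the two traces, `|F|² = 2φ² + 2ψ²`,
and both curvatures are `J`-invariant.

For the same reason of rank, `J` is parallel for the transverse connection
(`IsTransverse.koszul_J`), so `ω^T` is closed and `d^c ω = da ∧ a + db ∧ b` (`dcKahler_hermMap`).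
Then `d d^c ω = da ∧ da + db ∧ db`, which vanishes because a multiple of a decomposable two-form has
square zero (`dForm_dcKahler`).

In the Bismut connection the torsion cancels half of the Levi-Civita terms (`bismut_lowered`). What
remains makes `Z` and `W` parallel, so the curvature acts only on the horizontal plane, by an
`so(2)`-valued form. In a horizontal unitary frame `(e, Je)` the connection form is `θ^T + φ a + ψ
b`, with `θ^T` that of the transverse connection (`riem_bismut_frame`). Since `dθ^T = -½ R^T
G(J·,·)`, this gives `ρ_B = (-½ R^T + φ² + ψ²) G(J·,·) + dφ ∧ a + dψ ∧ b` (`bismutRicci_eq`). The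
first term is `½ (R^T - |F|²) ω^T`, which is what the equation for the transverse metric cancels.

The equations for `f₁`, `f₂` give `∂a/∂t = ½ (d^cφ + dψ)` and `∂b/∂t = ½ (d^cψ - dφ)` once time and
space derivatives are interchanged (`hasDerivWithinAt_fderiv_slice`). From `a ∘ J = -b` and `b ∘ J =
a` it follows that `∂(b ∧ a)/∂t` is minus the `(1,1)` part of `dφ ∧ a + dψ ∧ b`. The formulas for
the traces hold because the trace of `d d^c f` is the transverse Laplacian of `f`, again by
parallelism of `J`, while `d(df) = 0`.

Two further points need work. Invariance, traces and scalar curvature are all defined at the centre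
of the chart around each point, so naturality under change of chart is needed to obtain identities
on a whole chart that can be differentiated. And `J² = -1` on the cylinder has to be derived from
the Sasakian axioms. -/

namespace PluriclosedReduction

noncomputable section

open Filter Topology
set_option maxSynthPendingDepth 3
set_option synthInstance.maxHeartbeats 200000
set_option linter.unusedSectionVars false

/-! ### Coordinate calculus and the lowered curvature of a metric connection -/

section Calculus

variable {E F : Type*} [NormedAddCommGroup E] [NormedSpace ℝ E]
  [NormedAddCommGroup F] [NormedSpace ℝ F]

lemma fderiv_apply_field {A : E → E →L[ℝ] F} {s : E → E} {x : E}
    (hA : DifferentiableAt ℝ A x) (hs : DifferentiableAt ℝ s x) (u : E) :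
    fderiv ℝ (fun y => A y (s y)) x u = fderiv ℝ A x u (s x) + A x (fderiv ℝ s x u) := by
  rw [fderiv_clm_apply hA hs]
  simp [add_comm]

lemma fderiv_apply_const {A : E → E →L[ℝ] F} {x : E} (hA : DifferentiableAt ℝ A x) (u v : E) :
    fderiv ℝ (fun y => A y v) x u = fderiv ℝ A x u v := by
  simpa using fderiv_apply_field hA (differentiableAt_const v) u

lemma fderiv_apply₂ {B : E → E →L[ℝ] E →L[ℝ] F} {s r : E → E} {x : E}
    (hB : DifferentiableAt ℝ B x) (hs : DifferentiableAt ℝ s x) (hr : DifferentiableAt ℝ r x)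
    (u : E) :
    fderiv ℝ (fun y => B y (s y) (r y)) x u =
      fderiv ℝ B x u (s x) (r x) + B x (fderiv ℝ s x u) (r x) + B x (s x) (fderiv ℝ r x u) := by
  rw [fderiv_apply_field (hB.clm_apply hs) hr, fderiv_apply_field hB hs]
  simp

lemma fderiv_apply₂_const {B : E → E →L[ℝ] E →L[ℝ] F} {x : E}
    (hB : DifferentiableAt ℝ B x) (u v w : E) :
    fderiv ℝ (fun y => B y v w) x u = fderiv ℝ B x u v w := by
  simpa using fderiv_apply₂ hB (differentiableAt_const v) (differentiableAt_const w) u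

lemma fderiv_apply₃_const {K : E → E →L[ℝ] E →L[ℝ] E →L[ℝ] F} {x : E}
    (hK : DifferentiableAt ℝ K x) (u v w z : E) :
    fderiv ℝ (fun y => K y v w z) x u = fderiv ℝ K x u v w z := by
  rw [fderiv_apply₂_const (B := fun y => K y v) (hK.clm_apply (differentiableAt_const v)),
    fderiv_apply_const hK]

lemma differentiableAt_fderiv {f : E → F} {x : E} {n : WithTop ℕ∞} (hf : ContDiffAt ℝ n f x)
    (hn : 2 ≤ n) : DifferentiableAt ℝ (fderiv ℝ f) x :=
  ((hf.of_le hn).fderiv_right (m := 1) (by norm_num)).differentiableAt (by norm_num)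

lemma second_fderiv_symm {f : E → F} {x : E} {n : WithTop ℕ∞} (hf : ContDiffAt ℝ n f x)
    (hn : 2 ≤ n) (u v : E) : fderiv ℝ (fderiv ℝ f) x u v = fderiv ℝ (fderiv ℝ f) x v u :=
  (hf.isSymmSndFDerivAt (by simpa using hn)) u v

lemma fderiv_fderiv_apply_field {f : E → F} {s : E → E} {x : E} {n : WithTop ℕ∞}
    (hf : ContDiffAt ℝ n f x) (hn : 2 ≤ n) (hs : DifferentiableAt ℝ s x) (u : E) :
    fderiv ℝ (fun y => fderiv ℝ f y (s y)) x u =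
      fderiv ℝ (fderiv ℝ f) x u (s x) + fderiv ℝ f x (fderiv ℝ s x u) :=
  fderiv_apply_field (differentiableAt_fderiv hf hn) hs u

/-- The lowered curvature of a connection that is metric for `B`, has lowered coefficients `K` and
coefficients `Γ`; only the value of `Γ` modulo the kernel of `B` matters. -/
def riem (B : E → E →L[ℝ] E →L[ℝ] ℝ) (K : E → E →L[ℝ] E →L[ℝ] E →L[ℝ] ℝ) (Γ : E → E → E)
    (x u v w z : E) : ℝ :=
  (fderiv ℝ K x u v w z - B x (Γ v w) (Γ u z)) - (fderiv ℝ K x v u w z - B x (Γ u w) (Γ v z))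

/-- By metric compatibility `u(B(∇_v s, r)) - B(∇_v s, ∇_u r)` is `B(∇_u ∇_v s, r)`, and the second
derivatives of `s` cancel on exchanging `u` and `v`. This allows curvature to be computed in a
moving frame, or on a field whose covariant derivative is null, without any regularity of `Γ`. -/
lemma riem_fields {B : E → E →L[ℝ] E →L[ℝ] ℝ} {K : E → E →L[ℝ] E →L[ℝ] E →L[ℝ] ℝ} {Γ : E → E → E}
    {x : E} {s r : E → E} (hB : DifferentiableAt ℝ B x) (hK : DifferentiableAt ℝ K x)
    (hcompat : ∀ u v w, fderiv ℝ B x u v w = K x u v w + K x u w v)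
    (hsymm : ∀ v w, B x v w = B x w v) (hΓ : ∀ u v w, B x (Γ u v) w = K x u v w)
    (hs : ContDiffAt ℝ 2 s x) (hr : DifferentiableAt ℝ r x) (u v : E) :
    riem B K Γ x u v (s x) (r x) =
      (fderiv ℝ (fun y => B y (fderiv ℝ s y v) (r y) + K y v (s y) (r y)) x u
        - B x (fderiv ℝ s x v + Γ v (s x)) (fderiv ℝ r x u + Γ u (r x)))
      - (fderiv ℝ (fun y => B y (fderiv ℝ s y u) (r y) + K y u (s y) (r y)) x v
        - B x (fderiv ℝ s x u + Γ u (s x)) (fderiv ℝ r x v + Γ v (r x))) := by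
  have hsd : DifferentiableAt ℝ s x := hs.differentiableAt (by norm_num)
  have hds := differentiableAt_fderiv hs le_rfl
  have key : ∀ u v, fderiv ℝ (fun y => B y (fderiv ℝ s y v) (r y) + K y v (s y) (r y)) x u =
      (fderiv ℝ B x u (fderiv ℝ s x v) (r x) + B x (fderiv ℝ (fderiv ℝ s) x u v) (r x)
        + B x (fderiv ℝ s x v) (fderiv ℝ r x u))
      + (fderiv ℝ K x u v (s x) (r x) + K x v (fderiv ℝ s x u) (r x)
        + K x v (s x) (fderiv ℝ r x u)) := by
    intro u v
    have h1 : DifferentiableAt ℝ (fun y => fderiv ℝ s y v) x :=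
      hds.clm_apply (differentiableAt_const v)
    have h2 : DifferentiableAt ℝ (fun y => K y v) x := hK.clm_apply (differentiableAt_const v)
    rw [fderiv_fun_add ((hB.clm_apply h1).clm_apply hr) ((h2.clm_apply hsd).clm_apply hr),
      add_apply, fderiv_apply₂ hB h1 hr, fderiv_apply₂ h2 hsd hr,
      fderiv_apply_const hds, fderiv_apply_const hK]
  rw [key, key, second_fderiv_symm hs le_rfl v u, hcompat, hcompat]
  simp only [riem, map_add, add_apply]
  rw [hsymm (fderiv ℝ s x v) (Γ u (r x)), hsymm (fderiv ℝ s x u) (Γ v (r x))]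
  simp only [hΓ]
  ring

/-- Differentiating compatibility turns the part of `∂K` symmetric in the last two slots into a
second derivative of `B`, which is symmetric in the differentiation directions and drops out. -/
lemma riem_skew {B : E → E →L[ℝ] E →L[ℝ] ℝ} {K : E → E →L[ℝ] E →L[ℝ] E →L[ℝ] ℝ} {Γ : E → E → E}
    {x : E} (hB : ContDiffAt ℝ 2 B x) (hK : DifferentiableAt ℝ K x)
    (hcompat : ∀ᶠ y in 𝓝 x, ∀ u v w, fderiv ℝ B y u v w = K y u v w + K y u w v)
    (hsymm : ∀ v w, B x v w = B x w v) (u v w z : E) :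
    riem B K Γ x u v z w = - riem B K Γ x u v w z := by
  have key : ∀ u v, fderiv ℝ K x u v w z + fderiv ℝ K x u v z w
      = fderiv ℝ (fderiv ℝ B) x u v w z := by
    intro u v
    have hdB := differentiableAt_fderiv hB le_rfl
    rw [← fderiv_apply₃_const hK, ← fderiv_apply₃_const hK, ← fderiv_apply₃_const hdB,
      ← add_apply, ← fderiv_fun_add]
    · refine DFunLike.congr_fun (Filter.EventuallyEq.fderiv_eq ?_) u
      filter_upwards [hcompat] with y hy using (hy v w z).symm
    · exact ((hK.clm_apply (differentiableAt_const v)).clm_apply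
        (differentiableAt_const w)).clm_apply (differentiableAt_const z)
    · exact ((hK.clm_apply (differentiableAt_const v)).clm_apply
        (differentiableAt_const z)).clm_apply (differentiableAt_const w)
  have h1 := key u v
  have h2 := key v u
  rw [second_fderiv_symm hB le_rfl v u] at h2
  simp only [riem]
  rw [hsymm (Γ v z), hsymm (Γ u z)]
  linarith

lemma riem_swap (B : E → E →L[ℝ] E →L[ℝ] ℝ) (K : E → E →L[ℝ] E →L[ℝ] E →L[ℝ] ℝ)
    (Γ : E → E → E) (x u v w z : E) : riem B K Γ x v u w z = - riem B K Γ x u v w z := by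
  simp only [riem]; ring

/-- The Koszul formula as a trilinear form. -/
def koszulMap (G : E → E →L[ℝ] E →L[ℝ] ℝ) (y : E) : E →L[ℝ] E →L[ℝ] E →L[ℝ] ℝ :=
  (1 / 2 : ℝ) • (fderiv ℝ G y + (fderiv ℝ G y).flip
    - ((ContinuousLinearMap.flipₗᵢ ℝ E E ℝ).toContinuousLinearEquiv :
      (E →L[ℝ] E →L[ℝ] ℝ) →L[ℝ] E →L[ℝ] E →L[ℝ] ℝ).comp (fderiv ℝ G y).flip)

lemma koszulMap_apply (G : E → E →L[ℝ] E →L[ℝ] ℝ) (y u v w : E) :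
    koszulMap G y u v w =
      (1 / 2) * (fderiv ℝ G y u v w + fderiv ℝ G y v u w - fderiv ℝ G y w u v) := by
  simp [koszulMap]

lemma koszul_eq {G : E → E →L[ℝ] E →L[ℝ] ℝ} {y : E} (hG : DifferentiableAt ℝ G y) (u v w : E) :
    koszul (fun y u v => G y u v) y u v w = koszulMap G y u v w := by
  simp only [koszul, koszulMap_apply, fderiv_apply₂_const hG]

lemma contDiffAt_koszulMap {G : E → E →L[ℝ] E →L[ℝ] ℝ} {y : E} (hG : ContDiffAt ℝ ∞ G y) :
    ContDiffAt ℝ ∞ (koszulMap G) y := by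
  have h : ContDiffAt ℝ ∞ (fderiv ℝ G) y := hG.fderiv_right (by simp)
  have hf : ContDiffAt ℝ ∞ (fun y => (fderiv ℝ G y).flip) y :=
    (ContinuousLinearMap.flipₗᵢ ℝ E E (E →L[ℝ] ℝ)).toContinuousLinearEquiv.contDiff.contDiffAt.comp
      y h
  exact ((h.add hf).sub (contDiffAt_const.clm_comp hf)).const_smul (1 / 2 : ℝ)

lemma dOne_eq {a : E → E →L[ℝ] ℝ} {y : E} (ha : DifferentiableAt ℝ a y) (u v : E) :
    dOne (fun y u => a y u) y u v = fderiv ℝ a y u v - fderiv ℝ a y v u := by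
  simp [dOne, dForm, Fin.sum_univ_two, fderiv_apply_const ha, sub_eq_add_neg]

lemma lieOne_eq {V : E → E} {a : E → E →L[ℝ] ℝ} {y : E} (ha : DifferentiableAt ℝ a y) (u : E) :
    lieOne V (fun y u => a y u) y u = fderiv ℝ a y (V y) u + a y (fderiv ℝ V y u) := by
  simp [lieOne, fderiv_apply_const ha]

lemma lieTwo_eq {V : E → E} {B : E → E →L[ℝ] E →L[ℝ] ℝ} {y : E} (hB : DifferentiableAt ℝ B y)
    (u v : E) :
    lieTwo V (fun y u v => B y u v) y u v = fderiv ℝ B y (V y) u v + B y (fderiv ℝ V y u) v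
      + B y u (fderiv ℝ V y v) := by
  simp [lieTwo, fderiv_apply₂_const hB]

lemma raise_spec {B : E → E → ℝ} {ℓ : E → ℝ} (h : ∃ v, ∀ w, B v w = ℓ w) (w : E) :
    B (raise B ℓ) w = ℓ w :=
  Classical.epsilon_spec h w

end Calculus

/-! ### Vertical symmetries of a degenerate metric -/

section Transverse

variable {E : Type*} [NormedAddCommGroup E] [NormedSpace ℝ E]

/-- `V` is a vector field on `U` that spans part of the kernel of `G` and leaves `G` invariant. -/
structure IsVertical (U : Set E) (G : E → E →L[ℝ] E →L[ℝ] ℝ) (V : E → E) : Prop where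
  smooth : ContDiffOn ℝ ∞ V U
  ker : ∀ y ∈ U, ∀ v, G y v (V y) = 0
  lie : ∀ y ∈ U, ∀ u v,
    fderiv ℝ G y (V y) u v + G y (fderiv ℝ V y u) v + G y u (fderiv ℝ V y v) = 0

/-- Coordinate form of an invariant transverse Hermitian metric on an open set. -/
structure IsTransverse (U : Set E) (J : E → E →L[ℝ] E) (Z W : E → E)
    (G : E → E →L[ℝ] E →L[ℝ] ℝ) : Prop where
  isOpen : IsOpen U
  smooth_J : ContDiffOn ℝ ∞ J U
  smooth_G : ContDiffOn ℝ ∞ G U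
  J_Z : ∀ y ∈ U, J y (Z y) = W y
  J_J : ∀ y ∈ U, ∀ v, J y (J y v) = -v
  symm : ∀ y ∈ U, ∀ u v, G y u v = G y v u
  herm : ∀ y ∈ U, ∀ u v, G y (J y u) (J y v) = G y u v
  pos : ∀ y ∈ U, ∀ v, (∀ p q : ℝ, v ≠ p • Z y + q • W y) → 0 < G y v v
  vert_Z : IsVertical U G Z
  vert_W : IsVertical U G W

/-- Coordinate form of a Hermitian connection form on an open set. -/
structure IsConnection (U : Set E) (J : E → E →L[ℝ] E) (Z W : E → E) (a b : E → E →L[ℝ] ℝ) :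
    Prop where
  smooth_a : ContDiffOn ℝ ∞ a U
  smooth_b : ContDiffOn ℝ ∞ b U
  a_Z : ∀ y ∈ U, a y (Z y) = 1
  a_W : ∀ y ∈ U, a y (W y) = 0
  b_Z : ∀ y ∈ U, b y (Z y) = 0
  b_W : ∀ y ∈ U, b y (W y) = 1
  a_J : ∀ y ∈ U, ∀ v, a y (J y v) = -b y v
  b_J : ∀ y ∈ U, ∀ v, b y (J y v) = a y v
  curv_a_Z : ∀ y ∈ U, ∀ v, fderiv ℝ a y v (Z y) = fderiv ℝ a y (Z y) v
  curv_a_W : ∀ y ∈ U, ∀ v, fderiv ℝ a y v (W y) = fderiv ℝ a y (W y) v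
  curv_b_Z : ∀ y ∈ U, ∀ v, fderiv ℝ b y v (Z y) = fderiv ℝ b y (Z y) v
  curv_b_W : ∀ y ∈ U, ∀ v, fderiv ℝ b y v (W y) = fderiv ℝ b y (W y) v

lemma contDiffAt_of_mem {F : Type*} [NormedAddCommGroup F] [NormedSpace ℝ F] {U : Set E}
    (hU : IsOpen U) {f : E → F} (hf : ContDiffOn ℝ ∞ f U) {y : E} (hy : y ∈ U) :
    ContDiffAt ℝ ∞ f y :=
  hf.contDiffAt (hU.mem_nhds hy)

lemma differentiableAt_of_mem {F : Type*} [NormedAddCommGroup F] [NormedSpace ℝ F] {U : Set E}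
    (hU : IsOpen U) {f : E → F} (hf : ContDiffOn ℝ ∞ f U) {y : E} (hy : y ∈ U) :
    DifferentiableAt ℝ f y :=
  (contDiffAt_of_mem hU hf hy).differentiableAt (by simp)

lemma two_le_infty : (2 : WithTop ℕ∞) ≤ ∞ := by
  exact WithTop.coe_le_coe.2 (le_top : (2 : ℕ∞) ≤ ⊤)

lemma fderiv_eq_of_eqOn {F : Type*} [NormedAddCommGroup F] [NormedSpace ℝ F] {U : Set E}
    (hU : IsOpen U) {f g : E → F} (h : ∀ y ∈ U, f y = g y) {y : E} (hy : y ∈ U) :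
    fderiv ℝ f y = fderiv ℝ g y := by
  refine Filter.EventuallyEq.fderiv_eq ?_
  filter_upwards [hU.mem_nhds hy] with z hz using h z hz

lemma fderiv_const_of_eqOn {F : Type*} [NormedAddCommGroup F] [NormedSpace ℝ F] {U : Set E}
    (hU : IsOpen U) {f : E → F} {c : F} (h : ∀ y ∈ U, f y = c) {y : E} (hy : y ∈ U) (u : E) :
    fderiv ℝ f y u = 0 := by
  rw [fderiv_eq_of_eqOn hU (g := fun _ => c) h hy]; simp

section Vertical

variable {U : Set E} {G : E → E →L[ℝ] E →L[ℝ] ℝ} {V : E → E}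

lemma IsVertical.mono (h : IsVertical U G V) {U' : Set E} (hU : U' ⊆ U) : IsVertical U' G V :=
  ⟨h.smooth.mono hU, fun y hy => h.ker y (hU hy), fun y hy => h.lie y (hU hy)⟩

lemma fderiv_symm_of_symm (hU : IsOpen U) (hG : ContDiffOn ℝ ∞ G U)
    (hs : ∀ y ∈ U, ∀ u v, G y u v = G y v u) {y : E} (hy : y ∈ U) (u v w : E) :
    fderiv ℝ G y u v w = fderiv ℝ G y u w v := by
  have hd := differentiableAt_of_mem hU hG hy
  rw [← fderiv_apply₂_const hd, ← fderiv_apply₂_const hd,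
    fderiv_eq_of_eqOn hU (fun z hz => hs z hz v w) hy]

lemma IsVertical.fderiv_ker (h : IsVertical U G V) (hU : IsOpen U) (hG : ContDiffOn ℝ ∞ G U)
    {y : E} (hy : y ∈ U) (u v : E) :
    fderiv ℝ G y u v (V y) + G y v (fderiv ℝ V y u) = 0 := by
  have := fderiv_const_of_eqOn hU (fun z hz => h.ker z hz v) hy u
  rw [fderiv_apply₂ (differentiableAt_of_mem hU hG hy) (differentiableAt_const v)
    (differentiableAt_of_mem hU h.smooth hy)] at this
  simpa using this

variable (hU : IsOpen U) (hG : ContDiffOn ℝ ∞ G U) (hs : ∀ y ∈ U, ∀ u v, G y u v = G y v u)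
include hU hG hs

lemma koszulMap_compat {y : E} (hy : y ∈ U) (u v w : E) :
    fderiv ℝ G y u v w = koszulMap G y u v w + koszulMap G y u w v := by
  rw [koszulMap_apply, koszulMap_apply, fderiv_symm_of_symm hU hG hs hy u w v]
  ring

lemma koszulMap_symm {y : E} (hy : y ∈ U) (u v w : E) :
    koszulMap G y u v w = koszulMap G y v u w := by
  rw [koszulMap_apply, koszulMap_apply, fderiv_symm_of_symm hU hG hs hy w v u]
  ring

/-- The first two Koszul terms are rewritten by differentiating `G(·, V) = 0`, the third by `L_V G =
0`, and the results cancel. So the Koszul functional descends to the quotient by the kernel, which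
makes the transverse connection well defined. -/
lemma IsVertical.koszul_right (h : IsVertical U G V) {y : E} (hy : y ∈ U) (u v : E) :
    koszulMap G y u v (V y) = 0 := by
  rw [koszulMap_apply]
  have h1 := h.fderiv_ker hU hG hy u v
  have h2 := h.fderiv_ker hU hG hy v u
  have h3 := h.lie y hy u v
  rw [hs y hy (fderiv ℝ V y u) v] at h3
  linarith

/-- `V` represents the zero section of the quotient bundle, so its covariant derivative `∂_u V +
Γ(u, V)` is null. -/
lemma IsVertical.koszul_mid (h : IsVertical U G V) {y : E} (hy : y ∈ U) (u w : E) :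
    koszulMap G y u (V y) w = -G y (fderiv ℝ V y u) w := by
  have := koszulMap_compat hU hG hs hy u w (V y)
  rw [h.koszul_right hU hG hs hy] at this
  have h1 := h.fderiv_ker hU hG hy u w
  rw [hs y hy (fderiv ℝ V y u) w]
  linarith

/-- Along `V` the transverse connection is the Lie bracket with `V`, and `[V, v] = -∂_v V` for
constant `v`. -/
lemma IsVertical.koszul_left (h : IsVertical U G V) {y : E} (hy : y ∈ U) (v w : E) :
    koszulMap G y (V y) v w = -G y (fderiv ℝ V y v) w := by
  rw [koszulMap_symm hU hG hs hy, h.koszul_mid hU hG hs hy]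

lemma fderiv_koszulMap_apply {y : E} (hy : y ∈ U) (u v w z : E) :
    fderiv ℝ (koszulMap G) y u v w z = (1 / 2) * (fderiv ℝ (fderiv ℝ G) y u v w z
      + fderiv ℝ (fderiv ℝ G) y u w v z - fderiv ℝ (fderiv ℝ G) y u z v w) := by
  have hG' := contDiffAt_of_mem hU hG hy
  have hd := differentiableAt_fderiv hG' two_le_infty
  have hK : DifferentiableAt ℝ (koszulMap G) y :=
    (contDiffAt_koszulMap hG').differentiableAt (by simp)
  rw [← fderiv_apply₃_const hK]
  simp only [koszulMap_apply]
  have h3 : ∀ v w z, DifferentiableAt ℝ (fun y => fderiv ℝ G y v w z) y := fun v w z =>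
    ((hd.clm_apply (differentiableAt_const v)).clm_apply
      (differentiableAt_const w)).clm_apply (differentiableAt_const z)
  rw [fderiv_const_mul (((h3 v w z).fun_add (h3 w v z)).fun_sub (h3 z v w)),
    fderiv_fun_sub ((h3 v w z).fun_add (h3 w v z)) (h3 z v w), fderiv_fun_add (h3 v w z) (h3 w v z)]
  simp [fderiv_apply₃_const hd]

/-- The curvature of the transverse connection vanishes on an infinitesimal symmetry. -/
lemma IsVertical.riem_left (h : IsVertical U G V) {Γ : E → E → E} {y : E} (hy : y ∈ U)
    (hΓ : ∀ u v w, G y (Γ u v) w = koszulMap G y u v w) (v w z : E) :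
    riem G (koszulMap G) Γ y (V y) v w z = 0 := by
  have hG' := contDiffAt_of_mem hU hG hy
  have hGd := differentiableAt_of_mem hU hG hy
  have hV := contDiffAt_of_mem hU h.smooth hy
  have hVd := differentiableAt_of_mem hU h.smooth hy
  have hdG := differentiableAt_fderiv hG' two_le_infty
  have hdV := differentiableAt_fderiv hV two_le_infty
  have hK : DifferentiableAt ℝ (koszulMap G) y :=
    (contDiffAt_koszulMap hG').differentiableAt (by simp)
  -- Invariance of `G` differentiated once more. Its instances in the directions `v`, `w`, `z`
  -- replace the second derivatives of `G` along `V` that occur in `∂_V K`.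
  have lie' : ∀ c p q, fderiv ℝ (fderiv ℝ G) y (V y) c p q + fderiv ℝ G y (fderiv ℝ V y c) p q
      + (fderiv ℝ G y c (fderiv ℝ V y p) q + G y (fderiv ℝ (fderiv ℝ V) y c p) q)
      + (fderiv ℝ G y c p (fderiv ℝ V y q) + G y p (fderiv ℝ (fderiv ℝ V) y c q)) = 0 := by
    intro c p q
    have hp : ∀ p, DifferentiableAt ℝ (fun y => fderiv ℝ V y p) y := fun p =>
      hdV.clm_apply (differentiableAt_const p)
    have hA : DifferentiableAt ℝ (fun y => fderiv ℝ G y (V y)) y := hdG.clm_apply hVd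
    have h1 := (hA.clm_apply (differentiableAt_const p)).clm_apply (differentiableAt_const q)
    have h2 := (hGd.clm_apply (hp p)).clm_apply (differentiableAt_const q)
    have h3 := (hGd.clm_apply (differentiableAt_const p)).clm_apply (hp q)
    have := fderiv_const_of_eqOn hU (fun z hz => h.lie z hz p q) hy c
    rw [fderiv_fun_add (h1.fun_add h2) h3, fderiv_fun_add h1 h2, add_apply, add_apply,
      fderiv_apply₂ hGd (hp p) (differentiableAt_const q),
      fderiv_apply₂ hGd (differentiableAt_const p) (hp q), fderiv_apply₂_const hA,
      fderiv_apply_field hdG hVd, fderiv_apply_const hdV, fderiv_apply_const hdV,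
      second_fderiv_symm hG' two_le_infty] at this
    simpa using this
  -- The derivative along `v` of the bracket formula for `∇_V`; it handles the other half of the
  -- curvature, `∂_v K(V, w, z)`.
  have hKV : fderiv ℝ (koszulMap G) y v (V y) w z + koszulMap G y (fderiv ℝ V y v) w z
      + (fderiv ℝ G y v (fderiv ℝ V y w) z + G y (fderiv ℝ (fderiv ℝ V) y v w) z) = 0 := by
    have hA : DifferentiableAt ℝ (fun y => koszulMap G y (V y)) y := hK.clm_apply hVd
    have hp : DifferentiableAt ℝ (fun y => fderiv ℝ V y w) y :=
      hdV.clm_apply (differentiableAt_const w)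
    have e : ∀ x ∈ U, koszulMap G x (V x) w z + G x (fderiv ℝ V x w) z = 0 := fun x hx => by
      rw [h.koszul_left hU hG hs hx]; ring
    have := fderiv_const_of_eqOn hU e hy v
    rw [fderiv_fun_add ((hA.clm_apply (differentiableAt_const w)).clm_apply
        (differentiableAt_const z)) ((hGd.clm_apply hp).clm_apply (differentiableAt_const z)),
      add_apply, fderiv_apply₂_const hA, fderiv_apply_field hK hVd,
      fderiv_apply₂ hGd hp (differentiableAt_const z), fderiv_apply_const hdV] at this
    simpa using this
  have g1 : G y (Γ v w) (Γ (V y) z) = -koszulMap G y v w (fderiv ℝ V y z) := by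
    rw [hs y hy, hΓ, h.koszul_left hU hG hs hy, hs y hy, hΓ]
  have g2 : G y (Γ (V y) w) (Γ v z) = -koszulMap G y v z (fderiv ℝ V y w) := by
    rw [hΓ, h.koszul_left hU hG hs hy, hs y hy, hΓ]
  have l1 := lie' v w z
  have l2 := lie' w v z
  have l3 := lie' z v w
  have s1 := second_fderiv_symm hV two_le_infty v w
  have s2 := second_fderiv_symm hV two_le_infty v z
  have s3 := second_fderiv_symm hV two_le_infty w z
  have sG := fun u v w => fderiv_symm_of_symm hU hG hs hy u v w
  rw [riem, g1, g2, fderiv_koszulMap_apply hU hG hs hy (V y)]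
  rw [koszulMap_apply] at hKV
  rw [koszulMap_apply, koszulMap_apply]
  rw [s1] at l1 hKV
  rw [s2] at l1
  rw [s3] at l2
  linarith [sG w (fderiv ℝ V y v) z, sG z (fderiv ℝ V y v) w, sG v (fderiv ℝ V y w) z,
    sG z v (fderiv ℝ V y w), sG v w (fderiv ℝ V y z), sG w v (fderiv ℝ V y z),
    sG (fderiv ℝ V y v) w z, sG (fderiv ℝ V y w) v z, sG (fderiv ℝ V y z) v w,
    hs y hy w (fderiv ℝ (fderiv ℝ V) y z v), hs y hy v (fderiv ℝ (fderiv ℝ V) y z w)]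

end Vertical

end Transverse

/-! ### Pointwise linear algebra of a transverse metric of rank two -/

section Transverse

variable {E : Type*} [NormedAddCommGroup E] [NormedSpace ℝ E] {U : Set E} {J : E → E →L[ℝ] E}
  {Z W : E → E} {G : E → E →L[ℝ] E →L[ℝ] ℝ} {a b : E → E →L[ℝ] ℝ}

lemma IsTransverse.mono (T : IsTransverse U J Z W G) {U' : Set E} (hU : U' ⊆ U)
    (ho : IsOpen U') : IsTransverse U' J Z W G where
  isOpen := ho
  smooth_J := T.smooth_J.mono hU
  smooth_G := T.smooth_G.mono hU
  J_Z y hy := T.J_Z y (hU hy)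
  J_J y hy := T.J_J y (hU hy)
  symm y hy := T.symm y (hU hy)
  herm y hy := T.herm y (hU hy)
  pos y hy := T.pos y (hU hy)
  vert_Z := T.vert_Z.mono hU
  vert_W := T.vert_W.mono hU

lemma IsConnection.mono (C : IsConnection U J Z W a b) {U' : Set E} (hU : U' ⊆ U) :
    IsConnection U' J Z W a b where
  smooth_a := C.smooth_a.mono hU
  smooth_b := C.smooth_b.mono hU
  a_Z y hy := C.a_Z y (hU hy)
  a_W y hy := C.a_W y (hU hy)
  b_Z y hy := C.b_Z y (hU hy)
  b_W y hy := C.b_W y (hU hy)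
  a_J y hy := C.a_J y (hU hy)
  b_J y hy := C.b_J y (hU hy)
  curv_a_Z y hy := C.curv_a_Z y (hU hy)
  curv_a_W y hy := C.curv_a_W y (hU hy)
  curv_b_Z y hy := C.curv_b_Z y (hU hy)
  curv_b_W y hy := C.curv_b_W y (hU hy)

section Pointwise

variable {y : E} (T : IsTransverse U J Z W G) (hy : y ∈ U)
include T hy

lemma IsTransverse.J_W : J y (W y) = -Z y := by
  rw [← T.J_Z y hy, T.J_J y hy]

lemma IsTransverse.ker_Z' (v : E) : G y (Z y) v = 0 := by
  rw [T.symm y hy, T.vert_Z.ker y hy]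

lemma IsTransverse.ker_W' (v : E) : G y (W y) v = 0 := by
  rw [T.symm y hy, T.vert_W.ker y hy]

lemma IsTransverse.J_skew (u v : E) : G y (J y u) v = -G y u (J y v) := by
  rw [← T.herm y hy u (J y v), T.J_J y hy]; simp

lemma IsTransverse.J_skew_self (u : E) : G y (J y u) u = 0 := by
  have := T.J_skew hy u u
  rw [T.symm y hy u] at this
  linarith

lemma IsTransverse.nonneg (v : E) : 0 ≤ G y v v := by
  by_cases h : ∀ p q : ℝ, v ≠ p • Z y + q • W y
  · exact (T.pos y hy v h).le
  · push Not at h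
    obtain ⟨p, q, rfl⟩ := h
    simp [T.vert_Z.ker y hy, T.vert_W.ker y hy]

/-- A `G`-null vector is vertical by transverse positivity, and `a`, `b` read off its two
coefficients. -/
lemma IsTransverse.eq_zero (C : IsConnection U J Z W a b) {v : E} (h : G y v v = 0)
    (ha : a y v = 0) (hb : b y v = 0) : v = 0 := by
  by_cases h' : ∀ p q : ℝ, v ≠ p • Z y + q • W y
  · exact absurd h (T.pos y hy v h').ne'
  · push Not at h'
    obtain ⟨p, q, rfl⟩ := h'
    simp only [map_add, map_smul, C.a_Z y hy, C.a_W y hy, C.b_Z y hy, C.b_W y hy, smul_eq_mul,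
      mul_one, mul_zero, add_zero, zero_add] at ha hb
    simp [ha, hb]

variable (C : IsConnection U J Z W a b) (hdim : Module.finrank ℝ E = 4)
include C hdim

/-- The four functionals `G(e,·)`, `G(Je,·)`, `a`, `b` are dual to `e`, `Je`, `Z`, `W`. Hence they
define a surjection onto `ℝ⁴`, which is injective by dimension. -/
lemma IsTransverse.expand_horizontal {e : E} (he : G y e e = 1) (ha : a y e = 0) (hb : b y e = 0)
    (w : E) : w = G y e w • e + G y (J y e) w • J y e + a y w • Z y + b y w • W y := by
  have hfd : FiniteDimensional ℝ E := FiniteDimensional.of_finrank_pos (by omega)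
  let φ : E →ₗ[ℝ] Fin 4 → ℝ := LinearMap.pi
    ![(G y e : E →ₗ[ℝ] ℝ), (G y (J y e) : E →ₗ[ℝ] ℝ), (a y : E →ₗ[ℝ] ℝ), (b y : E →ₗ[ℝ] ℝ)]
  have hφ : ∀ w, φ w = ![G y e w, G y (J y e) w, a y w, b y w] := by
    intro w; funext i; fin_cases i <;> rfl
  have hJe : G y (J y e) (J y e) = 1 := by rw [T.herm y hy, he]
  have hJe' : G y e (J y e) = 0 := by rw [T.symm y hy, T.J_skew_self hy]
  have key : ∀ c : Fin 4 → ℝ, φ (c 0 • e + c 1 • J y e + c 2 • Z y + c 3 • W y) = c := by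
    intro c
    rw [hφ]
    simp only [map_add, map_smul, he, hJe, hJe', T.J_skew_self hy, C.a_J y hy, C.b_J y hy, ha, hb,
      C.a_Z y hy, C.a_W y hy, C.b_Z y hy, C.b_W y hy, T.vert_Z.ker y hy, T.vert_W.ker y hy]
    funext i
    fin_cases i <;> simp
  have hsurj : Function.Surjective φ := fun c => ⟨_, key c⟩
  have hinj : Function.Injective φ :=
    (LinearMap.injective_iff_surjective_of_finrank_eq_finrank (by simp [hdim])).2 hsurj
  refine hinj ?_
  have := key (φ w)
  rw [hφ w] at this
  simpa [hφ w] using this.symm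

/-- Removing the vertical part of `e` reduces this to the horizontal case. The vertical coefficients
are left unspecified because all later uses are blind to them. -/
lemma IsTransverse.expand {e : E} (he : G y e e = 1) (w : E) :
    ∃ p q : ℝ, w = G y e w • e + G y (J y e) w • J y e + p • Z y + q • W y := by
  let e' := e - a y e • Z y - b y e • W y
  have hG : ∀ v, G y e' v = G y e v := fun v => by
    simp [e', T.ker_Z' hy, T.ker_W' hy]
  have he' : G y e' e' = 1 := by
    rw [hG]; simp [e', T.vert_Z.ker y hy, T.vert_W.ker y hy, he]
  have ha : a y e' = 0 := by simp [e', C.a_Z y hy, C.a_W y hy]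
  have hb : b y e' = 0 := by simp [e', C.b_Z y hy, C.b_W y hy]
  have hJ : J y e' = J y e - a y e • W y + b y e • Z y := by
    simp [e', T.J_Z y hy, T.J_W hy]
  have := T.expand_horizontal hy C hdim he' ha hb w
  have hGJ : G y (J y e') w = G y (J y e) w := by
    rw [hJ]; simp [T.ker_Z' hy, T.ker_W' hy]
  rw [hG, hGJ, hJ] at this
  refine ⟨a y w - G y e w * a y e + G y (J y e) w * b y e,
    b y w - G y e w * b y e - G y (J y e) w * a y e, ?_⟩
  nth_rewrite 1 [this]
  simp only [e']
  module

/-- A skew form that vanishes on vertical vectors is a multiple of `G (J ·) ·`. -/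
lemma IsTransverse.skew_basic {β : E → E → ℝ} (hlin : ∀ u, IsLinearMap ℝ (β u))
    (hskew : ∀ u v, β u v = -β v u) (hZ : ∀ u, β u (Z y) = 0) (hW : ∀ u, β u (W y) = 0)
    {e : E} (he : G y e e = 1) (u v : E) : β u v = G y (J y u) v * β e (J y e) := by
  have hself : ∀ u, β u u = 0 := fun u => by linarith [hskew u u]
  -- Stated for arbitrary `γ` so as to apply both to `β` and to the area form `G(J·,·)`, which takes
  -- the value `1` on `(e, Je)`. Comparing the two gives the claim.
  have main : ∀ γ : E → E → ℝ, (∀ u, IsLinearMap ℝ (γ u)) → (∀ u v, γ u v = -γ v u) →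
      (∀ u, γ u (Z y) = 0) → (∀ u, γ u (W y) = 0) → γ u v =
        (G y e u * G y (J y e) v - G y (J y e) u * G y e v) * γ e (J y e) := by
    intro γ hlin hskew hZ hW
    obtain ⟨p, q, hu⟩ := T.expand hy C hdim he u
    obtain ⟨r, s, hv⟩ := T.expand hy C hdim he v
    have hself : ∀ u, γ u u = 0 := fun u => by linarith [hskew u u]
    have key : ∀ x, γ x v = G y e v * γ x e + G y (J y e) v * γ x (J y e) := by
      intro x
      conv_lhs => rw [hv]
      rw [(hlin x).map_add, (hlin x).map_add, (hlin x).map_add, (hlin x).map_smul,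
        (hlin x).map_smul, (hlin x).map_smul, (hlin x).map_smul, hZ, hW]
      simp
    have key' : ∀ x, γ x u = G y e u * γ x e + G y (J y e) u * γ x (J y e) := by
      intro x
      conv_lhs => rw [hu]
      rw [(hlin x).map_add, (hlin x).map_add, (hlin x).map_add, (hlin x).map_smul,
        (hlin x).map_smul, (hlin x).map_smul, (hlin x).map_smul, hZ, hW]
      simp
    rw [key, hskew u e, hskew u (J y e), key', key', hself, hself, hskew (J y e) e]
    ring
  have h1 := main β hlin hskew hZ hW
  have h2 := main (fun u v => G y (J y u) v) (fun u => (G y (J y u)).toLinearMap.isLinear)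
    (fun u v => by rw [T.J_skew hy, T.symm y hy]) (fun u => T.vert_Z.ker y hy _)
    (fun u => T.vert_W.ker y hy _)
  simp only [T.herm y hy, he, mul_one] at h2
  rw [h1, h2]

/-- Two vertical fields cannot span a space of dimension four, so some vector has positive length;
it is then normalised. -/
lemma IsTransverse.exists_unit : ∃ e, G y e e = 1 := by
  have hfd : FiniteDimensional ℝ E := FiniteDimensional.of_finrank_pos (by omega)
  have : ∃ v, ∀ p q : ℝ, v ≠ p • Z y + q • W y := by
    by_contra hcon
    push Not at hcon
    let φ : (Fin 2 → ℝ) →ₗ[ℝ] E := (LinearMap.proj 0).smulRight (Z y)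
      + (LinearMap.proj 1).smulRight (W y)
    have hs : Function.Surjective φ := fun v => by
      obtain ⟨p, q, h⟩ := hcon v
      exact ⟨![p, q], by simp [φ, h]⟩
    have := LinearMap.finrank_le_finrank_of_surjective (f := φ) hs
    simp [hdim] at this
  obtain ⟨v, hv⟩ := this
  have hpos := T.pos y hy v hv
  refine ⟨(√(G y v v))⁻¹ • v, ?_⟩
  simp only [map_smul, smul_eq_mul, smul_apply]
  have h2 := Real.mul_self_sqrt hpos.le
  have : √(G y v v) ≠ 0 := by positivity
  field_simp
  linarith

lemma IsTransverse.orthonormal_pair {e : E} (he : G y e e = 1) :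
    IsOrthonormal (fun u v => G y u v) ![e, J y e] := by
  intro i j
  fin_cases i <;> fin_cases j <;>
    simp [he, T.herm y hy, T.J_skew_self hy, T.symm y hy e (J y e)]

/-- `(e, Je)` shows that `onFrame` does not take its default value `0`; since the chosen frame is
unknown, the evaluation has to be the same for all orthonormal pairs. -/
lemma IsTransverse.onFrame_eq {S : (Fin 2 → E) → ℝ} {c : ℝ}
    (h : ∀ f : Fin 2 → E, G y (f 0) (f 0) = 1 → G y (f 1) (f 1) = 1 → G y (f 0) (f 1) = 0 →
      S f = c) : onFrame 2 (fun u v => G y u v) S = c := by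
  obtain ⟨e, he⟩ := T.exists_unit hy C hdim
  have hex : ∃ f : Fin 2 → E, IsOrthonormal (fun u v => G y u v) f :=
    ⟨_, T.orthonormal_pair hy C hdim he⟩
  rw [onFrame, dif_pos hex]
  have hf := hex.choose_spec
  refine h _ ?_ ?_ ?_
  · simpa using hf 0 0
  · simpa using hf 1 1
  · simpa using hf 0 1

/-- Modulo vertical vectors, `v` is `Ju` or `-Ju`; only the square of the sign enters the traces. -/
lemma IsTransverse.sq_of_orthonormal {u v : E} (hu : G y u u = 1) (hv : G y v v = 1)
    (huv : G y u v = 0) : G y (J y u) v ^ 2 = 1 := by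
  obtain ⟨p, q, h⟩ := T.expand hy C hdim hu v
  have : G y v v = G y u v * G y v u + G y (J y u) v * G y v (J y u) := by
    conv_lhs => enter [2]; rw [h]
    simp [T.vert_Z.ker y hy, T.vert_W.ker y hy]
  rw [hv, huv, T.symm y hy v (J y u)] at this
  linarith

lemma IsTransverse.exists_represent {ℓ : E → ℝ} (hlin : IsLinearMap ℝ ℓ) (hZ : ℓ (Z y) = 0)
    (hW : ℓ (W y) = 0) : ∃ v, ∀ w, G y v w = ℓ w := by
  obtain ⟨e, he⟩ := T.exists_unit hy C hdim
  refine ⟨ℓ e • e + ℓ (J y e) • J y e, fun w => ?_⟩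
  obtain ⟨p, q, h⟩ := T.expand hy C hdim he w
  conv_rhs => rw [h]
  rw [hlin.map_add, hlin.map_add, hlin.map_add, hlin.map_smul, hlin.map_smul, hlin.map_smul,
    hlin.map_smul, hZ, hW]
  simp [mul_comm]

/-- `raise` selects a vector by choice, so a representing vector has to be exhibited; it exists
since the Koszul functional vanishes on `Z` and `W`. -/
lemma IsTransverse.christoffel_spec (u v w : E) :
    G y (christoffel (fun y u v => G y u v) y u v) w = koszulMap G y u v w := by
  have hk : koszul (fun y u v => G y u v) y u v = fun w => koszulMap G y u v w :=
    funext fun w => koszul_eq (differentiableAt_of_mem T.isOpen T.smooth_G hy) u v w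
  rw [christoffel, hk]
  exact raise_spec (B := fun u v => G y u v) (T.exists_represent hy C hdim
    (koszulMap G y u v).toLinearMap.isLinear
    (T.vert_Z.koszul_right T.isOpen T.smooth_G T.symm hy u v)
    (T.vert_W.koszul_right T.isOpen T.smooth_G T.symm hy u v)) w

end Pointwise

end Transverse

/-! ### The transverse Kähler structure, basic functions and curvature traces -/

section Transverse

variable {E : Type*} [NormedAddCommGroup E] [NormedSpace ℝ E] {U : Set E} {J : E → E →L[ℝ] E}
  {Z W : E → E} {G : E → E →L[ℝ] E →L[ℝ] ℝ} {a b : E → E →L[ℝ] ℝ}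

/-- `d^c f = -df ∘ J`. -/
def dcMap (J : E → E →L[ℝ] E) (f : E → ℝ) (y : E) : E →L[ℝ] ℝ := -(fderiv ℝ f y ∘L J y)

lemma contDiffOn_fderiv {F : Type*} [NormedAddCommGroup F] [NormedSpace ℝ F] (hU : IsOpen U)
    {f : E → F} (hf : ContDiffOn ℝ ∞ f U) : ContDiffOn ℝ ∞ (fderiv ℝ f) U :=
  hf.fderiv_of_isOpen hU (by simp)

lemma contDiffOn_dcMap (hU : IsOpen U) (hJ : ContDiffOn ℝ ∞ J U) {f : E → ℝ}
    (hf : ContDiffOn ℝ ∞ f U) : ContDiffOn ℝ ∞ (dcMap J f) U :=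
  ((contDiffOn_fderiv hU hf).clm_comp hJ).neg

lemma fderiv_dcMap {f : E → ℝ} {y : E} (hf : ContDiffAt ℝ ∞ f y) (hJ : DifferentiableAt ℝ J y)
    (u v : E) : fderiv ℝ (dcMap J f) y u v =
      -(fderiv ℝ (fderiv ℝ f) y u (J y v) + fderiv ℝ f y (fderiv ℝ J y u v)) := by
  have hd := differentiableAt_fderiv hf two_le_infty
  have hdc : DifferentiableAt ℝ (dcMap J f) y := (hd.clm_comp hJ).neg
  have hJv : DifferentiableAt ℝ (fun y => J y v) y := hJ.clm_apply (differentiableAt_const v)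
  rw [← fderiv_apply_const hdc]
  simp only [dcMap, neg_apply, ContinuousLinearMap.comp_apply]
  rw [fderiv_fun_neg, neg_apply, fderiv_apply_field hd hJv, fderiv_apply_const hJ]

section Pointwise

variable {y : E} (T : IsTransverse U J Z W G) (hy : y ∈ U)
include T hy

lemma IsTransverse.fderiv_J_J (u v : E) :
    fderiv ℝ J y u (J y v) + J y (fderiv ℝ J y u v) = 0 := by
  have hJ := differentiableAt_of_mem T.isOpen T.smooth_J hy
  have h := fderiv_apply_field hJ (hJ.clm_apply (differentiableAt_const v)) u
  rw [fderiv_eq_of_eqOn T.isOpen (fun z hz => T.J_J z hz v) hy, fderiv_apply_const hJ] at h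
  simpa using h.symm

variable (C : IsConnection U J Z W a b) (hdim : Module.finrank ℝ E = 4)

/-- The complex structure is parallel for the transverse connection. -/
lemma IsTransverse.koszul_J (C : IsConnection U J Z W a b) (hdim : Module.finrank ℝ E = 4)
    (u v w : E) : G y (fderiv ℝ J y u v) w + koszulMap G y u (J y v) w
      + koszulMap G y u v (J y w) = 0 := by
  have hJ := differentiableAt_of_mem T.isOpen T.smooth_J hy
  have hG := differentiableAt_of_mem T.isOpen T.smooth_G hy
  have hJv : ∀ v, DifferentiableAt ℝ (fun y => J y v) y := fun v =>
    hJ.clm_apply (differentiableAt_const v)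
  set β : E → E → ℝ := fun v w => G y (fderiv ℝ J y u v) w + koszulMap G y u (J y v) w
      + koszulMap G y u v (J y w) with hβ
  have hskew : ∀ v w, β v w = -β w v := by
    intro v w
    have h0 : ∀ z ∈ U, G z (J z v) w + G z (J z w) v = 0 := fun z hz => by
      rw [T.J_skew hz, T.symm z hz v]; ring
    have := fderiv_const_of_eqOn T.isOpen h0 hy u
    rw [fderiv_fun_add ((hG.clm_apply (hJv v)).clm_apply (differentiableAt_const w))
      ((hG.clm_apply (hJv w)).clm_apply (differentiableAt_const v)), add_apply,
      fderiv_apply₂ hG (hJv v) (differentiableAt_const w),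
      fderiv_apply₂ hG (hJv w) (differentiableAt_const v), fderiv_apply_const hJ,
      fderiv_apply_const hJ, koszulMap_compat T.isOpen T.smooth_G T.symm hy,
      koszulMap_compat T.isOpen T.smooth_G T.symm hy] at this
    simp only [fderiv_fun_const, Pi.zero_apply, zero_apply, map_zero, add_zero] at this
    simp only [hβ]
    linarith
  -- `β` is the lowered `∇_u J`. Differentiating `J² = -1` makes `∇_u J` anticommute with `J`, which
  -- in this lowered form moves `J` across unchanged.
  have hJJ : ∀ v w, β (J y v) w = β v (J y w) := by
    intro v w
    have h1 := T.fderiv_J_J hy u v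
    have h2 : G y (fderiv ℝ J y u (J y v)) w = G y (fderiv ℝ J y u v) (J y w) := by
      rw [eq_neg_of_add_eq_zero_left h1, map_neg, neg_apply, T.J_skew hy, neg_neg]
    simp only [hβ, h2, T.J_J y hy, map_neg, neg_apply]
    ring
  obtain ⟨e, he⟩ := T.exists_unit hy C hdim
  have h := T.skew_basic hy C hdim (β := β)
    (fun v => ⟨fun w z => by simp only [hβ, map_add]; ring,
      fun c w => by simp only [hβ, map_smul, smul_eq_mul]; ring⟩) hskew
    (fun v => by
      simp only [hβ, T.J_Z y hy, T.vert_Z.ker y hy,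
        T.vert_Z.koszul_right T.isOpen T.smooth_G T.symm hy,
        T.vert_W.koszul_right T.isOpen T.smooth_G T.symm hy]; ring)
    (fun v => by
      simp only [hβ, T.J_W hy, T.vert_W.ker y hy, map_neg,
        T.vert_Z.koszul_right T.isOpen T.smooth_G T.symm hy,
        T.vert_W.koszul_right T.isOpen T.smooth_G T.symm hy]; ring) he v w
  -- Skewness and `β(Je, e) = β(e, Je)` are incompatible unless the single component of a skew form
  -- in rank two vanishes.
  have h0 : β e (J y e) = 0 := by linarith [hskew e (J y e), hJJ e e]
  rw [h0, mul_zero] at h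
  exact h

lemma IsTransverse.vertical_of_null {v : E} (h : ∀ w, G y v w = 0) :
    ∃ p q : ℝ, v = p • Z y + q • W y := by
  by_contra hcon
  push Not at hcon
  exact (T.pos y hy v hcon).ne' (h v)

lemma IsTransverse.fderiv_ker {f : E → ℝ} (hfZ : fderiv ℝ f y (Z y) = 0)
    (hfW : fderiv ℝ f y (W y) = 0) {v : E} (h : ∀ w, G y v w = 0) : fderiv ℝ f y v = 0 := by
  obtain ⟨p, q, rfl⟩ := T.vertical_of_null hy h
  simp [hfZ, hfW]

/-- The complex structure is invariant modulo vertical vectors. -/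
lemma IsTransverse.lie_J (C : IsConnection U J Z W a b) (hdim : Module.finrank ℝ E = 4) {V : E → E}
    (hV : IsVertical U G V) (v w : E) :
    G y (fderiv ℝ J y (V y) v - fderiv ℝ V y (J y v) + J y (fderiv ℝ V y v)) w = 0 := by
  have h := T.koszul_J hy C hdim (V y) v w
  rw [hV.koszul_left T.isOpen T.smooth_G T.symm hy, hV.koszul_left T.isOpen T.smooth_G T.symm hy]
    at h
  rw [map_add, map_sub, add_apply, sub_apply, T.J_skew hy (fderiv ℝ V y v)]
  linarith

end Pointwise

/-- `f` is a smooth function annihilated by `Z` and `W`. -/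
structure IsBasicFun (U : Set E) (Z W : E → E) (f : E → ℝ) : Prop where
  smooth : ContDiffOn ℝ ∞ f U
  fderiv_Z : ∀ y ∈ U, fderiv ℝ f y (Z y) = 0
  fderiv_W : ∀ y ∈ U, fderiv ℝ f y (W y) = 0

lemma fderiv_fderiv_of_annihilates {f : E → ℝ} {V : E → E} (hU : IsOpen U)
    (hf : ContDiffOn ℝ ∞ f U) (hV : ContDiffOn ℝ ∞ V U) (h : ∀ y ∈ U, fderiv ℝ f y (V y) = 0)
    {y : E} (hy : y ∈ U) (u : E) :
    fderiv ℝ (fderiv ℝ f) y u (V y) = -fderiv ℝ f y (fderiv ℝ V y u) := by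
  have := fderiv_const_of_eqOn hU h hy u
  rw [fderiv_fderiv_apply_field (contDiffAt_of_mem hU hf hy) two_le_infty
    (differentiableAt_of_mem hU hV hy)] at this
  linarith

/-- `d^c f` is invariant under vertical symmetries. -/
lemma IsTransverse.curv_dcMap (T : IsTransverse U J Z W G) (C : IsConnection U J Z W a b)
    (hdim : Module.finrank ℝ E = 4) {f : E → ℝ} (hf : IsBasicFun U Z W f) {V V' : E → E}
    (hV : IsVertical U G V) (hV' : IsVertical U G V') (hJV : ∀ y ∈ U, J y (V y) = V' y)
    (hfV : ∀ y ∈ U, fderiv ℝ f y (V y) = 0) (hfV' : ∀ y ∈ U, fderiv ℝ f y (V' y) = 0)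
    {y : E} (hy : y ∈ U) (v : E) :
    fderiv ℝ (dcMap J f) y v (V y) = fderiv ℝ (dcMap J f) y (V y) v := by
  have hf' := contDiffAt_of_mem T.isOpen hf.smooth hy
  have hJ := differentiableAt_of_mem T.isOpen T.smooth_J hy
  have hVd := differentiableAt_of_mem T.isOpen hV.smooth hy
  -- `(L_V J) v` is vertical, hence invisible to `df`.
  have h0 := T.fderiv_ker hy (hf.fderiv_Z y hy) (hf.fderiv_W y hy) (T.lie_J hy C hdim hV v)
  have h1 : fderiv ℝ J y v (V y) + J y (fderiv ℝ V y v) = fderiv ℝ V' y v := by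
    rw [← fderiv_apply_field hJ hVd, fderiv_eq_of_eqOn T.isOpen hJV hy]
  rw [fderiv_dcMap hf' hJ, fderiv_dcMap hf' hJ, hJV y hy,
    fderiv_fderiv_of_annihilates T.isOpen hf.smooth hV'.smooth hfV' hy,
    second_fderiv_symm hf' two_le_infty (V y),
    fderiv_fderiv_of_annihilates T.isOpen hf.smooth hV.smooth hfV hy, ← h1]
  simp only [map_add, map_sub] at h0 ⊢
  linarith

lemma IsVertical.neg {V : E → E} (h : IsVertical U G V) : IsVertical U G (fun y => -V y) where
  smooth := h.smooth.neg
  ker y hy v := by simp [h.ker y hy]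
  lie y hy u v := by
    have := h.lie y hy u v
    simp only [fderiv_fun_neg, map_neg, neg_apply]
    linarith

/-- Twisting a Hermitian connection form by basic functions. -/
lemma IsConnection.twist (C : IsConnection U J Z W a b) (T : IsTransverse U J Z W G)
    (hdim : Module.finrank ℝ E = 4) {f₁ f₂ : E → ℝ} (h₁ : IsBasicFun U Z W f₁)
    (h₂ : IsBasicFun U Z W f₂) :
    IsConnection U J Z W (fun y => a y + dcMap J f₁ y + fderiv ℝ f₂ y)
      (fun y => b y + dcMap J f₂ y - fderiv ℝ f₁ y) := by
  have hU := T.isOpen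
  have sdc : ∀ {f}, IsBasicFun U Z W f → ContDiffOn ℝ ∞ (dcMap J f) U := fun hf =>
    contDiffOn_dcMap hU T.smooth_J hf.smooth
  have sd : ∀ {f}, IsBasicFun U Z W f → ContDiffOn ℝ ∞ (fderiv ℝ f) U := fun hf =>
    contDiffOn_fderiv hU hf.smooth
  have dd : ∀ {F : E → E →L[ℝ] ℝ}, ContDiffOn ℝ ∞ F U → ∀ {y}, y ∈ U → DifferentiableAt ℝ F y :=
    fun h _ hy => differentiableAt_of_mem hU h hy
  have sy : ∀ {f}, IsBasicFun U Z W f → ∀ {y}, y ∈ U → ∀ u v,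
      fderiv ℝ (fderiv ℝ f) y u v = fderiv ℝ (fderiv ℝ f) y v u := fun hf _ hy =>
    second_fderiv_symm (contDiffAt_of_mem hU hf.smooth hy) two_le_infty
  have cZ : ∀ {f}, IsBasicFun U Z W f → ∀ {y}, y ∈ U → ∀ v,
      fderiv ℝ (dcMap J f) y v (Z y) = fderiv ℝ (dcMap J f) y (Z y) v := fun hf _ hy v =>
    T.curv_dcMap C hdim hf T.vert_Z T.vert_W T.J_Z hf.fderiv_Z hf.fderiv_W hy v
  have cW : ∀ {f}, IsBasicFun U Z W f → ∀ {y}, y ∈ U → ∀ v,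
      fderiv ℝ (dcMap J f) y v (W y) = fderiv ℝ (dcMap J f) y (W y) v := fun hf _ hy v =>
    T.curv_dcMap C hdim hf T.vert_W T.vert_Z.neg (fun z hz => T.J_W hz) hf.fderiv_W
      (fun z hz => by rw [map_neg, hf.fderiv_Z z hz, neg_zero]) hy v
  have ea : ∀ y ∈ U, fderiv ℝ (fun y => a y + dcMap J f₁ y + fderiv ℝ f₂ y) y
      = fderiv ℝ a y + fderiv ℝ (dcMap J f₁) y + fderiv ℝ (fderiv ℝ f₂) y := fun y hy => by
    rw [fderiv_fun_add ((dd C.smooth_a hy).fun_add (dd (sdc h₁) hy)) (dd (sd h₂) hy),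
      fderiv_fun_add (dd C.smooth_a hy) (dd (sdc h₁) hy)]
  have eb : ∀ y ∈ U, fderiv ℝ (fun y => b y + dcMap J f₂ y - fderiv ℝ f₁ y) y
      = fderiv ℝ b y + fderiv ℝ (dcMap J f₂) y - fderiv ℝ (fderiv ℝ f₁) y := fun y hy => by
    rw [fderiv_fun_sub ((dd C.smooth_b hy).fun_add (dd (sdc h₂) hy)) (dd (sd h₁) hy),
      fderiv_fun_add (dd C.smooth_b hy) (dd (sdc h₂) hy)]
  refine ⟨(C.smooth_a.add (sdc h₁)).add (sd h₂), (C.smooth_b.add (sdc h₂)).sub (sd h₁),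
    fun y hy => ?_, fun y hy => ?_, fun y hy => ?_, fun y hy => ?_, fun y hy v => ?_,
    fun y hy v => ?_, fun y hy v => ?_, fun y hy v => ?_, fun y hy v => ?_, fun y hy v => ?_⟩
  · simp [dcMap, T.J_Z y hy, h₁.fderiv_W y hy, h₂.fderiv_Z y hy, C.a_Z y hy]
  · simp [dcMap, T.J_W hy, h₁.fderiv_Z y hy, h₂.fderiv_W y hy, C.a_W y hy]
  · simp [dcMap, T.J_Z y hy, h₁.fderiv_Z y hy, h₂.fderiv_W y hy, C.b_Z y hy]
  · simp [dcMap, T.J_W hy, h₁.fderiv_W y hy, h₂.fderiv_Z y hy, C.b_W y hy]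
  · simp [dcMap, T.J_J y hy, C.a_J y hy]; ring
  · simp [dcMap, T.J_J y hy, C.b_J y hy]; ring
  · simp only [ea y hy, add_apply, C.curv_a_Z y hy v, cZ h₁ hy v, sy h₂ hy v]
  · simp only [ea y hy, add_apply, C.curv_a_W y hy v, cW h₁ hy v, sy h₂ hy v]
  · simp only [eb y hy, add_apply, sub_apply, C.curv_b_Z y hy v, cZ h₂ hy v, sy h₁ hy v]
  · simp only [eb y hy, add_apply, sub_apply, C.curv_b_W y hy v, cW h₂ hy v, sy h₁ hy v]

section Traces

variable {y : E} (T : IsTransverse U J Z W G) (C : IsConnection U J Z W a b)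
  (hdim : Module.finrank ℝ E = 4) (hy : y ∈ U)
include T C hdim hy

/-- The hypotheses say that `dc` annihilates `Z` and `W`, so the rank-two principle for skew forms
applies. -/
lemma curv_basic {c : E → E →L[ℝ] ℝ} (hZ : ∀ v, fderiv ℝ c y v (Z y) = fderiv ℝ c y (Z y) v)
    (hW : ∀ v, fderiv ℝ c y v (W y) = fderiv ℝ c y (W y) v) {e : E} (he : G y e e = 1) (u v : E) :
    fderiv ℝ c y u v - fderiv ℝ c y v u =
      G y (J y u) v * (fderiv ℝ c y e (J y e) - fderiv ℝ c y (J y e) e) :=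
  T.skew_basic hy C hdim (β := fun u v => fderiv ℝ c y u v - fderiv ℝ c y v u)
    (fun u => ⟨fun v w => by simp only [map_add, add_apply]; ring,
      fun r v => by simp only [map_smul, smul_apply, smul_eq_mul]; ring⟩)
    (fun u v => by ring) (fun u => by rw [hZ]; ring) (fun u => by rw [hW]; ring) he u v

lemma traceCurv_eq {c : E → E →L[ℝ] ℝ} (hc : DifferentiableAt ℝ c y)
    (hZ : ∀ v, fderiv ℝ c y v (Z y) = fderiv ℝ c y (Z y) v)
    (hW : ∀ v, fderiv ℝ c y v (W y) = fderiv ℝ c y (W y) v) {e : E} (he : G y e e = 1) :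
    traceCurv (fun y u v => G y u v) (fun y u => J y u) (fun y u => c y u) y =
      fderiv ℝ c y e (J y e) - fderiv ℝ c y (J y e) e := by
  refine T.onFrame_eq hy C hdim fun f h0 h1 _ => ?_
  simp only [dOne_eq hc, Fin.sum_univ_two]
  rw [curv_basic T C hdim hy hZ hW he (f 0), curv_basic T C hdim hy hZ hW he (f 1),
    T.herm y hy, T.herm y hy, h0, h1]
  ring

/-- The tensor norm counts the ordered pairs `(1,2)` and `(2,1)`, whence the factor `2`; this is why
`½|F|²` later becomes `φ² + ψ²`. -/
lemma normSqCurv_eq {c : E → E →L[ℝ] ℝ} (hc : DifferentiableAt ℝ c y)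
    (hZ : ∀ v, fderiv ℝ c y v (Z y) = fderiv ℝ c y (Z y) v)
    (hW : ∀ v, fderiv ℝ c y v (W y) = fderiv ℝ c y (W y) v) {e : E} (he : G y e e = 1) :
    normSqCurv (fun y u v => G y u v) (fun y u => c y u) y =
      2 * (fderiv ℝ c y e (J y e) - fderiv ℝ c y (J y e) e) ^ 2 := by
  refine T.onFrame_eq hy C hdim fun f h0 h1 h01 => ?_
  simp only [dOne_eq hc, Fin.sum_univ_two]
  have h := T.sq_of_orthonormal hy C hdim h0 h1 h01
  rw [curv_basic T C hdim hy hZ hW he (f 0) (f 1), curv_basic T C hdim hy hZ hW he (f 1) (f 0),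
    T.J_skew hy (f 1), T.symm y hy (f 1)]
  linear_combination (2 * (fderiv ℝ c y e (J y e) - fderiv ℝ c y (J y e) e) ^ 2) * h

/-- The transverse curvature is skew in each of its two pairs and vanishes on vertical vectors in
each, so two applications of the rank-two principle leave a single scalar. -/
lemma riem_basic {e : E} (he : G y e e = 1) (u v w z : E) :
    riem G (koszulMap G) (christoffel (fun y u v => G y u v) y) y u v w z =
      G y (J y u) v * G y (J y w) z *
        riem G (koszulMap G) (christoffel (fun y u v => G y u v) y) y e (J y e) e (J y e) := by
  set Γ := christoffel (fun y u v => G y u v) y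
  have hU := T.isOpen
  have hG := contDiffAt_of_mem hU T.smooth_G hy
  have hGd := differentiableAt_of_mem hU T.smooth_G hy
  have hK : DifferentiableAt ℝ (koszulMap G) y :=
    (contDiffAt_koszulMap hG).differentiableAt (by simp)
  have hΓ : ∀ u v w, G y (Γ u v) w = koszulMap G y u v w := T.christoffel_spec hy C hdim
  have hΓ' : ∀ u v w, G y w (Γ u v) = koszulMap G y u v w := fun u v w => by
    rw [T.symm y hy, hΓ]
  -- In the moving-frame formula take `r = V`: its pairing with any section is identically zero, and
  -- so is its transverse covariant derivative.
  have hvert : ∀ {V : E → E}, IsVertical U G V → ∀ u v w,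
      riem G (koszulMap G) Γ y u v w (V y) = 0 := by
    intro V hV u v w
    have h := riem_fields (s := fun _ => w) (r := V) hGd hK
      (koszulMap_compat hU T.smooth_G T.symm hy) (T.symm y hy) hΓ contDiffAt_const
      (differentiableAt_of_mem hU hV.smooth hy) u v
    have hz : ∀ p q, G y p (fderiv ℝ V y q + Γ q (V y)) = 0 := by
      intro p q
      rw [map_add, hΓ', hV.koszul_mid hU T.smooth_G T.symm hy, T.symm y hy]
      ring
    have hc : ∀ v, ∀ x ∈ U, G x (fderiv ℝ (fun _ => w) x v) (V x) + koszulMap G x v w (V x) = 0 :=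
      fun v x hx => by simp [hV.koszul_right hU T.smooth_G T.symm hx]
    rw [hz, hz, fderiv_const_of_eqOn hU (hc v) hy, fderiv_const_of_eqOn hU (hc u) hy] at h
    simpa using h
  have hR : ∀ u v w z, riem G (koszulMap G) Γ y u v w z =
      (fderiv ℝ (koszulMap G) y u v w z - koszulMap G y v w (Γ u z))
        - (fderiv ℝ (koszulMap G) y v u w z - koszulMap G y v z (Γ u w)) := fun u v w z => by
    rw [riem, hΓ, hΓ']
  have lin2 : ∀ w z u, IsLinearMap ℝ (fun v => riem G (koszulMap G) Γ y u v w z) := by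
    intro w z u
    constructor
    · intro p q
      simp only [hR, map_add, add_apply]; ring
    · intro c p
      simp only [hR, map_smul, smul_apply, smul_eq_mul]; ring
  have lin4 : ∀ u v w, IsLinearMap ℝ (fun z => riem G (koszulMap G) Γ y u v w z) := by
    intro u v w
    constructor
    · intro p q
      simp only [riem, hΓ', map_add, add_apply]; ring
    · intro c p
      simp only [riem, hΓ', map_smul, smul_apply, smul_eq_mul]; ring
  have h1 := T.skew_basic hy C hdim (β := fun u v => riem G (koszulMap G) Γ y u v w z)
    (fun u => lin2 w z u) (fun u v => riem_swap _ _ _ _ _ _ _ _)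
    (fun u => by
      rw [riem_swap, T.vert_Z.riem_left hU T.smooth_G T.symm hy hΓ, neg_zero])
    (fun u => by
      rw [riem_swap, T.vert_W.riem_left hU T.smooth_G T.symm hy hΓ, neg_zero]) he u v
  have h2 := T.skew_basic hy C hdim (β := fun w z => riem G (koszulMap G) Γ y e (J y e) w z)
    (fun w => lin4 _ _ w)
    (fun w z => by
      refine riem_skew (hG.of_le two_le_infty) hK ?_ (T.symm y hy) _ _ _ _
      filter_upwards [hU.mem_nhds hy] with x hx using koszulMap_compat hU T.smooth_G T.symm hx)
    (fun w => hvert T.vert_Z _ _ _) (fun w => hvert T.vert_W _ _ _) he w z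
  rw [h1, h2]
  ring

/-- Two ordered pairs contribute, and the last two arguments are ordered oppositely in the scalar
curvature and in the scalar `riem(e, Je, e, Je)`; together these give `-2`. -/
lemma transverseScal_eq {e : E} (he : G y e e = 1) :
    transverseScal (fun y u v => G y u v) y =
      -2 * riem G (koszulMap G) (christoffel (fun y u v => G y u v) y) y e (J y e) e (J y e) := by
  have hU := T.isOpen
  have hG := contDiffAt_of_mem hU T.smooth_G hy
  have hK : DifferentiableAt ℝ (koszulMap G) y :=
    (contDiffAt_koszulMap hG).differentiableAt (by simp)
  have hR : ∀ u v w z, transverseRiem (fun y u v => G y u v) y u v w z =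
      riem G (koszulMap G) (christoffel (fun y u v => G y u v) y) y u v w z := by
    intro u v w z
    have : ∀ v w z, ∀ x ∈ U, koszul (fun y u v => G y u v) x v w z = koszulMap G x v w z :=
      fun v w z x hx => koszul_eq (differentiableAt_of_mem hU T.smooth_G hx) v w z
    rw [transverseRiem, riem, fderiv_eq_of_eqOn hU (this v w z) hy,
      fderiv_eq_of_eqOn hU (this u w z) hy, fderiv_apply₃_const hK, fderiv_apply₃_const hK]
  refine T.onFrame_eq hy C hdim fun f h0 h1 h01 => ?_
  have h := T.sq_of_orthonormal hy C hdim h0 h1 h01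
  obtain ⟨r, hr⟩ : ∃ r, riem G (koszulMap G) (christoffel (fun y u v => G y u v) y) y
    e (J y e) e (J y e) = r := ⟨_, rfl⟩
  have hb := riem_basic T C hdim hy he
  rw [hr] at hb ⊢
  simp only [Fin.sum_univ_two, hR, hb, T.J_skew_self hy]
  rw [T.J_skew hy (f 1) (f 0), T.symm y hy (f 1)]
  linear_combination (-2 * r) * h

/-- Parallelism of `J` trades the derivative of `J` in `d d^c f(e, Je)` for connection terms,
leaving `Hess f(e, e) + Hess f(Je, Je)`. -/
lemma transverseLaplacian_eq {f : E → ℝ} (hf : IsBasicFun U Z W f) {e : E} (he : G y e e = 1) :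
    transverseLaplacian (fun y u v => G y u v) f y =
      fderiv ℝ (dcMap J f) y e (J y e) - fderiv ℝ (dcMap J f) y (J y e) e := by
  have hU := T.isOpen
  have hf' := contDiffAt_of_mem hU hf.smooth hy
  have hd := differentiableAt_fderiv hf' two_le_infty
  have hJ := differentiableAt_of_mem hU T.smooth_J hy
  -- `ξ` is a transverse gradient of `f`, so that `df(∇_u v)` becomes the Koszul expression `K(u, v,
  -- ξ)`.
  obtain ⟨ξ, hξ⟩ := T.exists_represent hy C hdim (ℓ := fderiv ℝ f y)
    (fderiv ℝ f y).toLinearMap.isLinear (hf.fderiv_Z y hy) (hf.fderiv_W y hy)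
  have hsymm := second_fderiv_symm hf' two_le_infty
  have key : ∀ e, G y e e = 1 → fderiv ℝ (dcMap J f) y e (J y e) - fderiv ℝ (dcMap J f) y (J y e) e
      = (fderiv ℝ (fderiv ℝ f) y e e - koszulMap G y e e ξ)
        + (fderiv ℝ (fderiv ℝ f) y (J y e) (J y e) - koszulMap G y (J y e) (J y e) ξ) := by
    intro e he
    have h1 := T.koszul_J hy C hdim e (J y e) ξ
    have h2 := T.koszul_J hy C hdim (J y e) e ξ
    rw [T.symm y hy, hξ] at h1 h2
    rw [koszulMap_symm hU T.smooth_G T.symm hy (J y e) e] at h2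
    rw [fderiv_dcMap hf' hJ, fderiv_dcMap hf' hJ]
    simp only [T.J_J y hy, map_neg, neg_apply] at h1 ⊢
    linarith
  -- The transverse Hessian annihilates vertical vectors, so it does not see the vertical ambiguity
  -- of an orthonormal pair.
  have hess_Z : ∀ {V : E → E}, IsVertical U G V → (∀ x ∈ U, fderiv ℝ f x (V x) = 0) → ∀ u,
      fderiv ℝ (fderiv ℝ f) y u (V y) - koszulMap G y u (V y) ξ = 0 := by
    intro V hV hfV u
    rw [fderiv_fderiv_of_annihilates hU hf.smooth hV.smooth hfV hy,
      hV.koszul_mid hU T.smooth_G T.symm hy, T.symm y hy, hξ]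
    ring
  have hZ := hess_Z T.vert_Z hf.fderiv_Z
  have hW := hess_Z T.vert_W hf.fderiv_W
  have hZ' : ∀ u, fderiv ℝ (fderiv ℝ f) y (Z y) u - koszulMap G y (Z y) u ξ = 0 := fun u => by
    rw [hsymm, koszulMap_symm hU T.smooth_G T.symm hy, hZ]
  have hW' : ∀ u, fderiv ℝ (fderiv ℝ f) y (W y) u - koszulMap G y (W y) u ξ = 0 := fun u => by
    rw [hsymm, koszulMap_symm hU T.smooth_G T.symm hy, hW]
  refine T.onFrame_eq hy C hdim fun g h0 h1 h01 => ?_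
  have hg := T.sq_of_orthonormal hy C hdim h0 h1 h01
  have hcurv : fderiv ℝ (dcMap J f) y e (J y e) - fderiv ℝ (dcMap J f) y (J y e) e
      = fderiv ℝ (dcMap J f) y (g 0) (J y (g 0)) - fderiv ℝ (dcMap J f) y (J y (g 0)) (g 0) := by
    rw [curv_basic T C hdim hy (c := dcMap J f)
      (fun v => T.curv_dcMap C hdim hf T.vert_Z T.vert_W T.J_Z hf.fderiv_Z hf.fderiv_W hy v)
      (fun v => T.curv_dcMap C hdim hf T.vert_W T.vert_Z.neg (fun z hz => T.J_W hz) hf.fderiv_W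
        (fun z hz => by rw [map_neg, hf.fderiv_Z z hz, neg_zero]) hy v) he (g 0) (J y (g 0)),
      T.herm y hy, h0, one_mul]
  obtain ⟨p, q, hexp⟩ := T.expand hy C hdim h0 (g 1)
  rw [h01, zero_smul, zero_add] at hexp
  -- The second frame vector is `±J(g 0)` plus a vertical vector; a quadratic expression forgets the
  -- sign.
  have h11 : fderiv ℝ (fderiv ℝ f) y (g 1) (g 1) - koszulMap G y (g 1) (g 1) ξ
      = fderiv ℝ (fderiv ℝ f) y (J y (g 0)) (J y (g 0))
        - koszulMap G y (J y (g 0)) (J y (g 0)) ξ := by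
    have a1 := hZ (J y (g 0)); have a2 := hW (J y (g 0))
    have a3 := hZ' (J y (g 0)); have a4 := hW' (J y (g 0))
    have a5 := hZ (Z y); have a6 := hW (W y); have a7 := hZ (W y); have a8 := hW (Z y)
    generalize G y (J y (g 0)) (g 1) = c at hg hexp
    rw [hexp]
    simp only [map_add, map_smul, add_apply, smul_apply, smul_eq_mul]
    linear_combination (fderiv ℝ (fderiv ℝ f) y (J y (g 0)) (J y (g 0))
        - koszulMap G y (J y (g 0)) (J y (g 0)) ξ) * hg + c * p * a1 + c * q * a2 + c * p * a3
        + c * q * a4 + p * p * a5 + q * q * a6 + p * q * a7 + p * q * a8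
  have hchr : ∀ u, fderiv ℝ f y (christoffel (fun y u v => G y u v) y u u)
      = koszulMap G y u u ξ := fun u => by
    rw [← hξ, T.symm y hy, T.christoffel_spec hy C hdim]
  simp only [Fin.sum_univ_two, fderiv_apply_const hd, hchr]
  rw [hcurv, key _ h0, h11]

end Traces

end Transverse

/-! ### The Hermitian metric, its torsion three-form and pluriclosedness -/

section Bismut

variable {E : Type*} [NormedAddCommGroup E] [NormedSpace ℝ E] {U : Set E} {J : E → E →L[ℝ] E}
  {Z W : E → E} {G : E → E →L[ℝ] E →L[ℝ] ℝ} {a b : E → E →L[ℝ] ℝ}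

/-- The Hermitian metric `G + a ⊗ a + b ⊗ b`. -/
def hermMap (G : E → E →L[ℝ] E →L[ℝ] ℝ) (a b : E → E →L[ℝ] ℝ) (y : E) : E →L[ℝ] E →L[ℝ] ℝ :=
  G y + ((a y).smulRight (a y) + (b y).smulRight (b y))

@[simp] lemma hermMap_apply (G : E → E →L[ℝ] E →L[ℝ] ℝ) (a b : E → E →L[ℝ] ℝ) (y u v : E) :
    hermMap G a b y u v = G y u v + (a y u * a y v + b y u * b y v) := by
  simp [hermMap]

/-- The lowered coefficients of the Bismut connection of `hermMap G a b`. -/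
def bismutMap (G : E → E →L[ℝ] E →L[ℝ] ℝ) (a b : E → E →L[ℝ] ℝ) (y : E) :
    E →L[ℝ] E →L[ℝ] E →L[ℝ] ℝ :=
  koszulMap G y
    + ((ContinuousLinearMap.smulRightL ℝ E (E →L[ℝ] ℝ)).flip (a y) ∘L fderiv ℝ a y
      + (a y).smulRight (fderiv ℝ a y - (fderiv ℝ a y).flip))
    + ((ContinuousLinearMap.smulRightL ℝ E (E →L[ℝ] ℝ)).flip (b y) ∘L fderiv ℝ b y
      + (b y).smulRight (fderiv ℝ b y - (fderiv ℝ b y).flip))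

lemma bismutMap_apply (G : E → E →L[ℝ] E →L[ℝ] ℝ) (a b : E → E →L[ℝ] ℝ) (y u v w : E) :
    bismutMap G a b y u v w = koszulMap G y u v w
      + (fderiv ℝ a y u v * a y w + a y u * (fderiv ℝ a y v w - fderiv ℝ a y w v))
      + (fderiv ℝ b y u v * b y w + b y u * (fderiv ℝ b y v w - fderiv ℝ b y w v)) := by
  simp [bismutMap]

lemma contDiffAt_hermMap {y : E} (hG : ContDiffAt ℝ ∞ G y) (ha : ContDiffAt ℝ ∞ a y)
    (hb : ContDiffAt ℝ ∞ b y) : ContDiffAt ℝ ∞ (hermMap G a b) y :=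
  hG.add ((ha.smulRight ha).add (hb.smulRight hb))

lemma contDiffAt_bismutMap {y : E} (hG : ContDiffAt ℝ ∞ G y) (ha : ContDiffAt ℝ ∞ a y)
    (hb : ContDiffAt ℝ ∞ b y) : ContDiffAt ℝ ∞ (bismutMap G a b) y := by
  have key : ∀ {c : E → E →L[ℝ] ℝ}, ContDiffAt ℝ ∞ c y → ContDiffAt ℝ ∞ (fun y =>
      (ContinuousLinearMap.smulRightL ℝ E (E →L[ℝ] ℝ)).flip (c y) ∘L fderiv ℝ c y
      + (c y).smulRight (fderiv ℝ c y - (fderiv ℝ c y).flip)) y := by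
    intro c hc
    have h : ContDiffAt ℝ ∞ (fderiv ℝ c) y := hc.fderiv_right (by simp)
    have hf : ContDiffAt ℝ ∞ (fun y => (fderiv ℝ c y).flip) y :=
      (ContinuousLinearMap.flipₗᵢ ℝ E E ℝ).toContinuousLinearEquiv.contDiff.contDiffAt.comp y h
    exact ((contDiffAt_const.clm_apply hc).clm_comp h).add (hc.smulRight (h.sub hf))
  exact ((contDiffAt_koszulMap hG).add (key ha)).add (key hb)

lemma fderiv_hermMap {y : E} (hG : DifferentiableAt ℝ G y) (ha : DifferentiableAt ℝ a y)
    (hb : DifferentiableAt ℝ b y) (u v w : E) :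
    fderiv ℝ (fun y => hermMap G a b y v w) y u = fderiv ℝ G y u v w
      + (fderiv ℝ a y u v * a y w + a y v * fderiv ℝ a y u w)
      + (fderiv ℝ b y u v * b y w + b y v * fderiv ℝ b y u w) := by
  have hc : ∀ {c : E → E →L[ℝ] ℝ}, DifferentiableAt ℝ c y → ∀ v,
      DifferentiableAt ℝ (fun y => c y v) y := fun h v => h.clm_apply (differentiableAt_const v)
  have hGv := (hG.clm_apply (differentiableAt_const v)).clm_apply (differentiableAt_const w)
  simp only [hermMap_apply]
  rw [fderiv_fun_add hGv (((hc ha v).fun_mul (hc ha w)).fun_add ((hc hb v).fun_mul (hc hb w))),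
    fderiv_fun_add ((hc ha v).fun_mul (hc ha w)) ((hc hb v).fun_mul (hc hb w)),
    fderiv_fun_mul (hc ha v) (hc ha w), fderiv_fun_mul (hc hb v) (hc hb w)]
  simp only [add_apply, smul_apply, smul_eq_mul, fderiv_apply₂_const hG, fderiv_apply_const ha,
    fderiv_apply_const hb]
  ring

variable (T : IsTransverse U J Z W G) (C : IsConnection U J Z W a b)
  (hdim : Module.finrank ℝ E = 4)
include T C hdim

/-- The area form written as the wedge of `G(e,·)` and `G(Je,·)`; this decomposability is what makes
squares of basic two-forms vanish. -/
lemma J_form_eq {y : E} (hy : y ∈ U) {e : E} (he : G y e e = 1) (u v : E) :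
    G y (J y u) v = G y e u * G y (J y e) v - G y (J y e) u * G y e v := by
  have h := T.skew_basic hy C hdim
    (β := fun u v => G y e u * G y (J y e) v - G y (J y e) u * G y e v)
    (fun u => ⟨fun v w => by simp only [map_add]; ring,
      fun r v => by simp only [map_smul, smul_eq_mul]; ring⟩)
    (fun u v => by ring) (fun u => by simp [T.vert_Z.ker y hy])
    (fun u => by simp [T.vert_W.ker y hy]) he u v
  simp only [T.herm y hy, he, T.J_skew_self hy] at h
  rw [h]; ring

lemma kahlerForm_hermMap {y : E} (hy : y ∈ U) (u v : E) :
    kahlerForm (fun y u v => hermMap G a b y u v) (fun y u => J y u) y u v =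
      G y u (J y v) + (b y u * a y v - a y u * b y v) := by
  simp only [kahlerForm, hermMap_apply, C.a_J y hy, C.b_J y hy]
  ring

/-- The derivative of `J` is eliminated by parallelism. In this form the `G`-terms of `dω` cancel by
the symmetry of `K` in its first two slots, which is the closedness of `ω^T`. -/
lemma fderiv_kahlerForm {y : E} (hy : y ∈ U) (p q r : E) :
    fderiv ℝ (fun y => kahlerForm (fun y u v => hermMap G a b y u v) (fun y u => J y u) y q r) y p
      = koszulMap G y p q (J y r) - koszulMap G y p r (J y q)
        + (fderiv ℝ b y p q * a y r + b y q * fderiv ℝ a y p r)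
        - (fderiv ℝ a y p q * b y r + a y q * fderiv ℝ b y p r) := by
  have hU := T.isOpen
  have hG := differentiableAt_of_mem hU T.smooth_G hy
  have hJ := differentiableAt_of_mem hU T.smooth_J hy
  have ha := differentiableAt_of_mem hU C.smooth_a hy
  have hb := differentiableAt_of_mem hU C.smooth_b hy
  have hc : ∀ {c : E → E →L[ℝ] ℝ}, DifferentiableAt ℝ c y → ∀ v,
      DifferentiableAt ℝ (fun y => c y v) y := fun h v => h.clm_apply (differentiableAt_const v)
  have hJr : DifferentiableAt ℝ (fun y => J y r) y := hJ.clm_apply (differentiableAt_const r)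
  rw [fderiv_eq_of_eqOn hU (fun z hz => kahlerForm_hermMap T C hdim hz q r) hy,
    fderiv_fun_add ((hG.clm_apply (differentiableAt_const q)).clm_apply hJr)
      (((hc hb q).fun_mul (hc ha r)).fun_sub ((hc ha q).fun_mul (hc hb r))),
    fderiv_fun_sub ((hc hb q).fun_mul (hc ha r)) ((hc ha q).fun_mul (hc hb r)),
    fderiv_fun_mul (hc hb q) (hc ha r), fderiv_fun_mul (hc ha q) (hc hb r)]
  simp only [add_apply, sub_apply, smul_apply, smul_eq_mul, fderiv_apply_const ha,
    fderiv_apply_const hb]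
  rw [fderiv_apply₂ hG (differentiableAt_const q) hJr, fderiv_apply_const hJ,
    koszulMap_compat hU T.smooth_G T.symm hy, T.symm y hy q]
  have := T.koszul_J hy C hdim p r q
  simp only [fderiv_fun_const, Pi.zero_apply, zero_apply, map_zero]
  linarith

omit T C hdim in
lemma dForm_two (β : E → (Fin 2 → E) → ℝ) (y p q r : E) :
    dForm β y ![p, q, r] = fderiv ℝ (fun y => β y ![q, r]) y p
      - fderiv ℝ (fun y => β y ![p, r]) y q + fderiv ℝ (fun y => β y ![p, q]) y r := by
  have h0 : (fun j => (![p, q, r] : Fin 3 → E) ((0 : Fin 3).succAbove j)) = ![q, r] := by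
    funext j; fin_cases j <;> rfl
  have h1 : (fun j => (![p, q, r] : Fin 3 → E) ((1 : Fin 3).succAbove j)) = ![p, r] := by
    funext j; fin_cases j <;> rfl
  have h2 : (fun j => (![p, q, r] : Fin 3 → E) ((2 : Fin 3).succAbove j)) = ![p, q] := by
    funext j; fin_cases j <;> rfl
  refine (Fin.sum_univ_three _).trans ?_
  rw [h0, h1, h2]
  simp
  ring

omit T C hdim in
lemma dForm_three (β : E → (Fin 3 → E) → ℝ) (y : E) (v : Fin 4 → E) :
    dForm β y v = fderiv ℝ (fun y => β y ![v 1, v 2, v 3]) y (v 0)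
      - fderiv ℝ (fun y => β y ![v 0, v 2, v 3]) y (v 1)
      + fderiv ℝ (fun y => β y ![v 0, v 1, v 3]) y (v 2)
      - fderiv ℝ (fun y => β y ![v 0, v 1, v 2]) y (v 3) := by
  have h0 : (fun j => v ((0 : Fin 4).succAbove j)) = ![v 1, v 2, v 3] := by
    funext j; fin_cases j <;> rfl
  have h1 : (fun j => v ((1 : Fin 4).succAbove j)) = ![v 0, v 2, v 3] := by
    funext j; fin_cases j <;> rfl
  have h2 : (fun j => v ((2 : Fin 4).succAbove j)) = ![v 0, v 1, v 3] := by
    funext j; fin_cases j <;> rfl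
  have h3 : (fun j => v ((3 : Fin 4).succAbove j)) = ![v 0, v 1, v 2] := by
    funext j; fin_cases j <;> rfl
  refine (Fin.sum_univ_four _).trans ?_
  rw [h0, h1, h2, h3]
  simp
  ring

omit T C hdim in
/-- The three-form `da ∧ a`. -/
def chernSimons (a : E → E →L[ℝ] ℝ) (y u v w : E) : ℝ :=
  (fderiv ℝ a y u v - fderiv ℝ a y v u) * a y w + (fderiv ℝ a y v w - fderiv ℝ a y w v) * a y u
    + (fderiv ℝ a y w u - fderiv ℝ a y u w) * a y v

/-- Only `d(b ∧ a) = db ∧ a - b ∧ da` survives in `dω`. Precomposing with `J` fixes `da`, `db` and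
sends `a` to `-b`, `b` to `a`. -/
lemma dcKahler_hermMap {y : E} (hy : y ∈ U) (u v w : E) :
    dcKahler (fun y u v => hermMap G a b y u v) (fun y u => J y u) y ![u, v, w] =
      chernSimons a y u v w + chernSimons b y u v w := by
  have hU := T.isOpen
  have hv : (fun i => J y ((![u, v, w] : Fin 3 → E) i)) = ![J y u, J y v, J y w] := by
    funext i; fin_cases i <;> rfl
  obtain ⟨e, he⟩ := T.exists_unit hy C hdim
  -- The curvature forms are of type `(1,1)`, being multiples of the `J`-invariant area form.
  have inv : ∀ {c : E → E →L[ℝ] ℝ}, (∀ v, fderiv ℝ c y v (Z y) = fderiv ℝ c y (Z y) v) →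
      (∀ v, fderiv ℝ c y v (W y) = fderiv ℝ c y (W y) v) → ∀ u v,
      fderiv ℝ c y (J y u) (J y v) - fderiv ℝ c y (J y v) (J y u)
        = fderiv ℝ c y u v - fderiv ℝ c y v u := by
    intro c hZ hW u v
    rw [curv_basic T C hdim hy hZ hW he u v, curv_basic T C hdim hy hZ hW he, T.herm y hy,
      T.J_skew hy u v]
  have ia := inv (C.curv_a_Z y hy) (C.curv_a_W y hy)
  have ib := inv (C.curv_b_Z y hy) (C.curv_b_W y hy)
  rw [dcKahler, hv, dForm_two]
  simp only [Matrix.cons_val_zero, Matrix.cons_val_one]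
  rw [fderiv_kahlerForm T C hdim hy, fderiv_kahlerForm T C hdim hy,
    fderiv_kahlerForm T C hdim hy, chernSimons, chernSimons, ← ia u v, ← ia v w, ← ia w u,
    ← ib u v, ← ib v w, ← ib w u]
  simp only [C.a_J y hy, C.b_J y hy]
  rw [koszulMap_symm hU T.smooth_G T.symm hy (J y u) (J y v),
    koszulMap_symm hU T.smooth_G T.symm hy (J y u) (J y w),
    koszulMap_symm hU T.smooth_G T.symm hy (J y v) (J y w)]
  ring

omit T C hdim in
lemma differentiableAt_curv {c : E → E →L[ℝ] ℝ} {y : E} (hc : ContDiffAt ℝ ∞ c y) (p q : E) :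
    DifferentiableAt ℝ (fun y => fderiv ℝ c y p q) y :=
  ((differentiableAt_fderiv hc two_le_infty).clm_apply (differentiableAt_const p)).clm_apply
    (differentiableAt_const q)

omit T C hdim in
lemma fderiv_chernSimons {c : E → E →L[ℝ] ℝ} {y : E} (hc : ContDiffAt ℝ ∞ c y) (u p q r : E) :
    DifferentiableAt ℝ (fun y => chernSimons c y p q r) y ∧
    fderiv ℝ (fun y => chernSimons c y p q r) y u =
      ((fderiv ℝ (fderiv ℝ c) y u p q - fderiv ℝ (fderiv ℝ c) y u q p) * c y r
        + (fderiv ℝ c y p q - fderiv ℝ c y q p) * fderiv ℝ c y u r)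
      + ((fderiv ℝ (fderiv ℝ c) y u q r - fderiv ℝ (fderiv ℝ c) y u r q) * c y p
        + (fderiv ℝ c y q r - fderiv ℝ c y r q) * fderiv ℝ c y u p)
      + ((fderiv ℝ (fderiv ℝ c) y u r p - fderiv ℝ (fderiv ℝ c) y u p r) * c y q
        + (fderiv ℝ c y r p - fderiv ℝ c y p r) * fderiv ℝ c y u q) := by
  have hd : DifferentiableAt ℝ c y := hc.differentiableAt (by simp)
  have hdd := differentiableAt_fderiv hc two_le_infty
  have key : ∀ p q r, HasFDerivAt (fun y => (fderiv ℝ c y p q - fderiv ℝ c y q p) * c y r)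
      ((fderiv ℝ c y p q - fderiv ℝ c y q p) • fderiv ℝ (fun y => c y r) y + c y r •
        (fderiv ℝ (fun y => fderiv ℝ c y p q) y - fderiv ℝ (fun y => fderiv ℝ c y q p) y)) y :=
    fun p q r => ((differentiableAt_curv hc p q).hasFDerivAt.sub
      (differentiableAt_curv hc q p).hasFDerivAt).mul
      (hd.clm_apply (differentiableAt_const r)).hasFDerivAt
  have h := ((key p q r).add (key q r p)).add (key r p q)
  refine ⟨h.differentiableAt, ?_⟩
  have h' := h.fderiv
  have e : fderiv ℝ (fun y => chernSimons c y p q r) y = _ := h'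
  rw [e]
  simp only [add_apply, sub_apply, smul_apply, smul_eq_mul, fderiv_apply_const hd,
    fderiv_apply₂_const hdd]
  ring

lemma dForm_dcKahler {y : E} (hy : y ∈ U) (v : Fin 4 → E) :
    dForm (dcKahler (fun y u v => hermMap G a b y u v) (fun y u => J y u)) y v = 0 := by
  have hU := T.isOpen
  have ha := contDiffAt_of_mem hU C.smooth_a hy
  have hb := contDiffAt_of_mem hU C.smooth_b hy
  obtain ⟨e, he⟩ := T.exists_unit hy C hdim
  have hsplit : ∀ u p q r, fderiv ℝ (fun y =>
      dcKahler (fun y u v => hermMap G a b y u v) (fun y u => J y u) y ![p, q, r]) y u =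
      fderiv ℝ (fun y => chernSimons a y p q r) y u
        + fderiv ℝ (fun y => chernSimons b y p q r) y u := fun u p q r => by
    rw [fderiv_eq_of_eqOn hU (fun z hz => dcKahler_hermMap T C hdim hz p q r) hy,
      fderiv_fun_add (fderiv_chernSimons ha u p q r).1 (fderiv_chernSimons hb u p q r).1, add_apply]
  have key : ∀ {c : E → E →L[ℝ] ℝ}, ContDiffAt ℝ ∞ c y →
      (∀ v, fderiv ℝ c y v (Z y) = fderiv ℝ c y (Z y) v) →
      (∀ v, fderiv ℝ c y v (W y) = fderiv ℝ c y (W y) v) → ∀ p q r s,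
      fderiv ℝ (fun y => chernSimons c y q r s) y p - fderiv ℝ (fun y => chernSimons c y p r s) y q
      + fderiv ℝ (fun y => chernSimons c y p q s) y r
      - fderiv ℝ (fun y => chernSimons c y p q r) y s = 0 := by
    intro c hc hZ hW p q r s
    have hF := curv_basic T C hdim hy hZ hW he
    have hS := second_fderiv_symm hc two_le_infty
    have hJ := J_form_eq T C hdim hy he
    generalize fderiv ℝ c y e (J y e) - fderiv ℝ c y (J y e) e = φ at hF
    -- The Plücker relation for a multiple of a decomposable two-form, i.e. `dc ∧ dc = 0`.
    have hpl : ∀ p q r s, (fderiv ℝ c y p q - fderiv ℝ c y q p)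
        * (fderiv ℝ c y r s - fderiv ℝ c y s r)
        - (fderiv ℝ c y p r - fderiv ℝ c y r p) * (fderiv ℝ c y q s - fderiv ℝ c y s q)
        + (fderiv ℝ c y p s - fderiv ℝ c y s p) * (fderiv ℝ c y q r - fderiv ℝ c y r q) = 0 := by
      intro p q r s
      rw [hF p q, hF r s, hF p r, hF q s, hF p s, hF q r, hJ p q, hJ r s, hJ p r, hJ q s, hJ p s,
        hJ q r]
      ring
    rw [(fderiv_chernSimons hc _ _ _ _).2, (fderiv_chernSimons hc _ _ _ _).2,
      (fderiv_chernSimons hc _ _ _ _).2, (fderiv_chernSimons hc _ _ _ _).2,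
      hS q p, hS r p, hS s p, hS r q, hS s q, hS s r]
    -- Symmetry of second derivatives has removed `d(dc) ∧ c`. What is left is `dc ∧ dc`, in which
    -- each of the three pairings of the four arguments occurs twice.
    linear_combination 2 * hpl p q r s
  rw [dForm_three]
  simp only [hsplit]
  linarith [key ha (C.curv_a_Z y hy) (C.curv_a_W y hy) (v 0) (v 1) (v 2) (v 3),
    key hb (C.curv_b_Z y hy) (C.curv_b_W y hy) (v 0) (v 1) (v 2) (v 3)]

/-- The Koszul terms of `a ⊗ a` and half of `da ∧ a` cancel where `a(v)` is a factor and add up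
elsewhere, leaving `∂_u a(v) a(w) + a(u) da(v, w)`; likewise for `b`. -/
lemma bismut_lowered {y : E} (hy : y ∈ U) (u v w : E) :
    koszul (fun y u v => hermMap G a b y u v) y u v w + (1 / 2) *
      dcKahler (fun y u v => hermMap G a b y u v) (fun y u => J y u) y ![u, v, w] =
      bismutMap G a b y u v w := by
  have hU := T.isOpen
  have hG := differentiableAt_of_mem hU T.smooth_G hy
  have ha := differentiableAt_of_mem hU C.smooth_a hy
  have hb := differentiableAt_of_mem hU C.smooth_b hy
  rw [dcKahler_hermMap T C hdim hy, koszul, fderiv_hermMap hG ha hb, fderiv_hermMap hG ha hb,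
    fderiv_hermMap hG ha hb, bismutMap_apply, koszulMap_apply, chernSimons, chernSimons]
  ring

end Bismut

/-! ### Bismut curvature and the Bismut-Ricci form -/

section BismutRicci

variable {E : Type*} [NormedAddCommGroup E] [NormedSpace ℝ E] {U : Set E} {J : E → E →L[ℝ] E}
  {Z W : E → E} {G : E → E →L[ℝ] E →L[ℝ] ℝ} {a b : E → E →L[ℝ] ℝ}

/-- A smooth field of horizontal transverse unit vectors. -/
structure IsUnitField (U : Set E) (G : E → E →L[ℝ] E →L[ℝ] ℝ) (a b : E → E →L[ℝ] ℝ) (e : E → E) :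
    Prop where
  smooth : ContDiffOn ℝ ∞ e U
  unit : ∀ y ∈ U, G y (e y) (e y) = 1
  a_e : ∀ y ∈ U, a y (e y) = 0
  b_e : ∀ y ∈ U, b y (e y) = 0

/-- A unit vector at the point, kept constant in coordinates, is made horizontal and normalised.
Dropping its vertical part leaves `G(v, v)` unchanged, so the domain only shrinks to where this
stays positive. -/
lemma exists_isUnitField (T : IsTransverse U J Z W G) (C : IsConnection U J Z W a b)
    (hdim : Module.finrank ℝ E = 4) {x : E} (hx : x ∈ U) :
    ∃ U' ⊆ U, IsOpen U' ∧ x ∈ U' ∧ ∃ e, IsUnitField U' G a b e := by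
  obtain ⟨v, hv⟩ := T.exists_unit hx C hdim
  have hcont : ContDiffOn ℝ ∞ (fun y => G y v v) U :=
    (T.smooth_G.clm_apply contDiffOn_const).clm_apply contDiffOn_const
  refine ⟨U ∩ {y | 0 < G y v v}, inter_subset_left, ?_, ⟨hx, by simp [hv]⟩,
    fun y => (√(G y v v))⁻¹ • (v - a y v • Z y - b y v • W y), ?_, ?_, ?_, ?_⟩
  · exact hcont.continuousOn.isOpen_inter_preimage T.isOpen isOpen_Ioi
  · have h1 : ContDiffOn ℝ ∞ (fun y => (√(G y v v))⁻¹) (U ∩ {y | 0 < G y v v}) :=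
      ((hcont.mono inter_subset_left).sqrt fun y hy => ne_of_gt hy.2).inv
        fun y hy => (Real.sqrt_pos.2 hy.2).ne'
    refine h1.smul (ContDiffOn.mono ?_ inter_subset_left)
    exact (contDiffOn_const.sub ((C.smooth_a.clm_apply contDiffOn_const).smul T.vert_Z.smooth)).sub
      ((C.smooth_b.clm_apply contDiffOn_const).smul T.vert_W.smooth)
  · rintro y ⟨hy, hpos⟩
    have hpos' : 0 < G y v v := hpos
    have h2 := Real.mul_self_sqrt hpos'.le
    have h3 : √(G y v v) ≠ 0 := (Real.sqrt_pos.2 hpos).ne'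
    simp only [map_smul, map_sub, smul_apply, sub_apply, smul_eq_mul, T.vert_Z.ker y hy,
      T.vert_W.ker y hy, T.ker_Z' hy, T.ker_W' hy]
    field_simp
    linarith
  · rintro y ⟨hy, -⟩
    simp [C.a_Z y hy, C.a_W y hy]
  · rintro y ⟨hy, -⟩
    simp [C.b_Z y hy, C.b_W y hy]

section LinearAlgebra

variable {B : E → E → ℝ}

/-- Parseval's identity: an orthonormal family of full length is a basis by a dimension count, even
without positivity of `g`. -/
lemma sum_sq_of_isOrthonormal [FiniteDimensional ℝ E] (g : E →L[ℝ] E →L[ℝ] ℝ)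
    {f : Fin (Module.finrank ℝ E) → E} (hf : IsOrthonormal (fun u v => g u v) f) (w : E) :
    ∑ i, g (f i) w * g (f i) w = g w w := by
  let φ : E →ₗ[ℝ] Fin (Module.finrank ℝ E) → ℝ := LinearMap.pi fun i => (g (f i) : E →ₗ[ℝ] ℝ)
  have key : ∀ c : Fin (Module.finrank ℝ E) → ℝ, φ (∑ i, c i • f i) = c := by
    intro c; funext i
    have : ∀ j, g (f i) (f j) = if i = j then 1 else 0 := fun j => hf i j
    simp [φ, this]
  have hinj : Function.Injective φ :=
    (LinearMap.injective_iff_surjective_of_finrank_eq_finrank (by simp)).2 fun c => ⟨_, key c⟩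
  have h : w = ∑ i, g (f i) w • f i := hinj (key (φ w)).symm
  conv_rhs => enter [1]; rw [h]
  simp

end LinearAlgebra

variable (T : IsTransverse U J Z W G) (C : IsConnection U J Z W a b)
  (hdim : Module.finrank ℝ E = 4) {e : E → E} (F : IsUnitField U G a b e)
include T C hdim

lemma hermMap_expand {y : E} (hy : y ∈ U) {e : E} (he : G y e e = 1) (ha : a y e = 0)
    (hb : b y e = 0) (u v : E) : hermMap G a b y u v =
      G y e u * G y e v + G y (J y e) u * G y (J y e) v + a y u * a y v + b y u * b y v := by
  have h := T.expand_horizontal hy C hdim he ha hb v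
  rw [hermMap_apply]
  conv_lhs => enter [1, 2]; rw [h]
  simp only [map_add, map_smul, smul_eq_mul, T.vert_Z.ker y hy, T.vert_W.ker y hy,
    T.symm y hy u e, T.symm y hy u (J y e)]
  ring

lemma hermMap_pos {y : E} (hy : y ∈ U) {v : E} (hv : v ≠ 0) : 0 < hermMap G a b y v v := by
  have h0 := T.nonneg hy v
  rw [hermMap_apply]
  by_contra hcon
  have h1 := mul_self_nonneg (a y v)
  have h2 := mul_self_nonneg (b y v)
  exact hv (T.eq_zero hy C (by linarith) (mul_self_eq_zero.1 (by linarith))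
    (mul_self_eq_zero.1 (by linarith)))

include F

/-- The Bismut coefficients are defined by a choice and so carry no regularity of their own.
Nondegeneracy identifies them with the explicit expansion in the orthonormal frame `(e, Je, Z, W)`,
from which differentiability follows. -/
lemma bismut_eq {y : E} (hy : y ∈ U) (u v : E) :
    bismut (fun y u v => hermMap G a b y u v) (fun y u => J y u) y u v =
      bismutMap G a b y u v (e y) • e y + bismutMap G a b y u v (J y (e y)) • J y (e y)
      + bismutMap G a b y u v (Z y) • Z y + bismutMap G a b y u v (W y) • W y := by
  have hl : (fun w => koszul (fun y u v => hermMap G a b y u v) y u v w + (1 / 2) *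
      dcKahler (fun y u v => hermMap G a b y u v) (fun y u => J y u) y ![u, v, w])
      = fun w => bismutMap G a b y u v w := funext fun w => bismut_lowered T C hdim hy u v w
  rw [bismut, hl]
  have he := F.unit y hy
  have hae := F.a_e y hy
  have hbe := F.b_e y hy
  generalize bismutMap G a b y u v = ℓ
  set p := ℓ (e y) • e y + ℓ (J y (e y)) • J y (e y) + ℓ (Z y) • Z y + ℓ (W y) • W y with hp
  have hpw : ∀ w, hermMap G a b y p w = ℓ w := by
    intro w
    have hw := T.expand_horizontal hy C hdim he hae hbe w
    conv_rhs => rw [hw]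
    rw [hermMap_apply, hp]
    simp only [map_add, map_smul, add_apply, smul_apply, smul_eq_mul, T.ker_Z' hy, T.ker_W' hy,
      C.a_J y hy, C.b_J y hy, hae, hbe, C.a_Z y hy, C.a_W y hy, C.b_Z y hy, C.b_W y hy]
    ring
  have hr : ∀ w, hermMap G a b y (raise (fun u v => hermMap G a b y u v) (fun w => ℓ w)) w = ℓ w :=
    raise_spec (B := fun u v => hermMap G a b y u v) ⟨p, hpw⟩
  by_contra hne
  refine (hermMap_pos T C hdim hy (sub_ne_zero.2 hne)).ne' ?_
  have hz : ∀ w, hermMap G a b y (raise (fun u v => hermMap G a b y u v) (fun w => ℓ w) - p) w = 0 :=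
    fun w => by rw [map_sub, sub_apply, hr, hpw, sub_self]
  exact hz _

lemma bismut_spec {y : E} (hy : y ∈ U) (u v w : E) :
    hermMap G a b y (bismut (fun y u v => hermMap G a b y u v) (fun y u => J y u) y u v) w =
      bismutMap G a b y u v w := by
  rw [bismut_eq T C hdim F hy, hermMap_apply]
  have hw := T.expand_horizontal hy C hdim (F.unit y hy) (F.a_e y hy) (F.b_e y hy) w
  generalize bismutMap G a b y u v = ℓ
  conv_rhs => rw [hw]
  simp only [map_add, map_smul, add_apply, smul_apply, smul_eq_mul, T.ker_Z' hy, T.ker_W' hy,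
    C.a_J y hy, C.b_J y hy, F.a_e y hy, F.b_e y hy, C.a_Z y hy, C.a_W y hy, C.b_Z y hy, C.b_W y hy]
  ring

lemma differentiableAt_bismut {y : E} (hy : y ∈ U) (u v : E) : DifferentiableAt ℝ
    (fun y => bismut (fun y u v => hermMap G a b y u v) (fun y u => J y u) y u v) y := by
  have hU := T.isOpen
  have hK : DifferentiableAt ℝ (fun y => bismutMap G a b y u v) y :=
    (((contDiffAt_bismutMap (contDiffAt_of_mem hU T.smooth_G hy)
      (contDiffAt_of_mem hU C.smooth_a hy) (contDiffAt_of_mem hU C.smooth_b hy)).differentiableAt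
      (by simp)).clm_apply (differentiableAt_const u)).clm_apply (differentiableAt_const v)
  have he := differentiableAt_of_mem hU F.smooth hy
  have hJe := (differentiableAt_of_mem hU T.smooth_J hy).clm_apply he
  have hZ := differentiableAt_of_mem hU T.vert_Z.smooth hy
  have hW := differentiableAt_of_mem hU T.vert_W.smooth hy
  refine DifferentiableAt.congr_of_eventuallyEq (f := fun y =>
      bismutMap G a b y u v (e y) • e y + bismutMap G a b y u v (J y (e y)) • J y (e y)
      + bismutMap G a b y u v (Z y) • Z y + bismutMap G a b y u v (W y) • W y) ?_ ?_
  · exact ((((hK.clm_apply he).smul he).add ((hK.clm_apply hJe).smul hJe)).add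
      ((hK.clm_apply hZ).smul hZ)).add ((hK.clm_apply hW).smul hW)
  · filter_upwards [hU.mem_nhds hy] with z hz using bismut_eq T C hdim F hz u v

omit F in
-- The torsion contributes `a(u) da(v, w)` and its analogue for `b`, which cancel on symmetrising in
-- `v`, `w`.
lemma hermMap_compat {y : E} (hy : y ∈ U) (u v w : E) :
    fderiv ℝ (hermMap G a b) y u v w = bismutMap G a b y u v w + bismutMap G a b y u w v := by
  have hU := T.isOpen
  have hG := differentiableAt_of_mem hU T.smooth_G hy
  have ha := differentiableAt_of_mem hU C.smooth_a hy
  have hb := differentiableAt_of_mem hU C.smooth_b hy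
  have hg : DifferentiableAt ℝ (hermMap G a b) y :=
    (contDiffAt_hermMap (contDiffAt_of_mem hU T.smooth_G hy) (contDiffAt_of_mem hU C.smooth_a hy)
      (contDiffAt_of_mem hU C.smooth_b hy)).differentiableAt (by simp)
  rw [← fderiv_apply₂_const hg, fderiv_hermMap hG ha hb, bismutMap_apply, bismutMap_apply,
    koszulMap_compat hU T.smooth_G T.symm hy]
  ring

omit F in
lemma hermMap_symm {y : E} (hy : y ∈ U) (u v : E) :
    hermMap G a b y u v = hermMap G a b y v u := by
  rw [hermMap_apply, hermMap_apply, T.symm y hy]; ring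

/-- The curvature of the Bismut connection through its lowered coefficients. -/
lemma curvature_bismut {y : E} (hy : y ∈ U) (u v w z : E) :
    hermMap G a b y (curvature (bismut (fun y u v => hermMap G a b y u v) (fun y u => J y u))
      y u v w) z = riem (hermMap G a b) (bismutMap G a b)
        (bismut (fun y u v => hermMap G a b y u v) (fun y u => J y u) y) y u v w z := by
  have hU := T.isOpen
  have hg : DifferentiableAt ℝ (hermMap G a b) y :=
    (contDiffAt_hermMap (contDiffAt_of_mem hU T.smooth_G hy) (contDiffAt_of_mem hU C.smooth_a hy)
      (contDiffAt_of_mem hU C.smooth_b hy)).differentiableAt (by simp)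
  have hK : DifferentiableAt ℝ (bismutMap G a b) y :=
    (contDiffAt_bismutMap (contDiffAt_of_mem hU T.smooth_G hy)
      (contDiffAt_of_mem hU C.smooth_a hy) (contDiffAt_of_mem hU C.smooth_b hy)).differentiableAt
      (by simp)
  have hΓd := fun u v => differentiableAt_bismut T C hdim F hy u v
  have hspec : ∀ x ∈ U, ∀ u v w, _ := fun x hx => bismut_spec T C hdim F hx
  set Γ := bismut (fun y u v => hermMap G a b y u v) (fun y u => J y u)
  have key : ∀ u v, hermMap G a b y (fderiv ℝ (fun y => Γ y v w) y u) z =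
      fderiv ℝ (bismutMap G a b) y u v w z - bismutMap G a b y u (Γ y v w) z
        - hermMap G a b y (Γ y v w) (Γ y u z) := by
    intro u v
    have h := fderiv_apply₂ hg (hΓd v w) (differentiableAt_const z) u
    rw [fderiv_eq_of_eqOn hU (fun x hx => hspec x hx v w z) hy, fderiv_apply₃_const hK,
      hermMap_compat T C hdim hy, ← hspec y hy u z, hermMap_symm T C hdim hy (Γ y u z)] at h
    simp only [fderiv_fun_const, Pi.zero_apply, zero_apply, map_zero, add_zero] at h
    linarith
  rw [curvature, riem, map_sub, map_add, map_sub, sub_apply, add_apply, sub_apply, key, key]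
  simp only [hspec y hy]
  ring

/-- The connection form of the transverse connection in the frame `(e, J e)`. -/
def thetaT (J : E → E →L[ℝ] E) (G : E → E →L[ℝ] E →L[ℝ] ℝ) (e : E → E) (v y : E) : ℝ :=
  G y (fderiv ℝ e y v) (J y (e y)) + koszulMap G y v (e y) (J y (e y))

lemma differentiableAt_thetaT {y : E} (hy : y ∈ U) (v : E) :
    DifferentiableAt ℝ (thetaT J G e v) y := by
  have hU := T.isOpen
  have he := differentiableAt_of_mem hU F.smooth hy
  have hJe := (differentiableAt_of_mem hU T.smooth_J hy).clm_apply he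
  have hde := (differentiableAt_fderiv (contDiffAt_of_mem hU F.smooth hy)
    two_le_infty).clm_apply (differentiableAt_const v)
  have hK : DifferentiableAt ℝ (koszulMap G) y :=
    (contDiffAt_koszulMap (contDiffAt_of_mem hU T.smooth_G hy)).differentiableAt (by simp)
  exact (((differentiableAt_of_mem hU T.smooth_G hy).clm_apply hde).clm_apply hJe).add
    (((hK.clm_apply (differentiableAt_const v)).clm_apply he).clm_apply hJe)

/-- The structure equation for the transverse connection. -/
lemma riem_eq_thetaT {y : E} (hy : y ∈ U) (u v : E) :
    riem G (koszulMap G) (christoffel (fun y u v => G y u v) y) y u v (e y) (J y (e y)) =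
      fderiv ℝ (thetaT J G e v) y u - fderiv ℝ (thetaT J G e u) y v := by
  have hU := T.isOpen
  have hG := differentiableAt_of_mem hU T.smooth_G hy
  have he := differentiableAt_of_mem hU F.smooth hy
  have hJe := (differentiableAt_of_mem hU T.smooth_J hy).clm_apply he
  have hK : DifferentiableAt ℝ (koszulMap G) y :=
    (contDiffAt_koszulMap (contDiffAt_of_mem hU T.smooth_G hy)).differentiableAt (by simp)
  have hΓ := T.christoffel_spec hy C hdim
  set Γ := christoffel (fun y u v => G y u v) y
  have hun := F.unit y hy
  have horth : ∀ {s : E → E}, DifferentiableAt ℝ s y → (∀ x ∈ U, G x (s x) (s x) = 1) → ∀ u,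
      G y (s y) (fderiv ℝ s y u + Γ u (s y)) = 0 := by
    intro s hs h1 u
    have h := fderiv_const_of_eqOn hU h1 hy u
    rw [fderiv_apply₂ hG hs hs, koszulMap_compat hU T.smooth_G T.symm hy,
      T.symm y hy (fderiv ℝ s y u)] at h
    rw [map_add, T.symm y hy (s y) (Γ u (s y)), hΓ]
    linarith
  have h1 := horth he F.unit
  have h2 := horth hJe (fun x hx => by rw [T.herm x hx, F.unit x hx])
  -- `∇e` is orthogonal to `e` and `∇(Je)` to `Je`, so in rank two they are orthogonal to each
  -- other: `so(2)` is abelian and the quadratic curvature term vanishes.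
  have hz : ∀ u v, G y (fderiv ℝ e y v + Γ v (e y))
      (fderiv ℝ (fun y => J y (e y)) y u + Γ u (J y (e y))) = 0 := by
    intro u v
    obtain ⟨p, q, hpq⟩ := T.expand hy C hdim hun
      (fderiv ℝ (fun y => J y (e y)) y u + Γ u (J y (e y)))
    rw [h2, zero_smul, add_zero] at hpq
    rw [hpq, map_add, map_add, map_smul, map_smul, map_smul, T.vert_Z.ker y hy,
      T.vert_W.ker y hy, T.symm y hy _ (e y), h1]
    simp
  have h := riem_fields (s := e) (r := fun y => J y (e y)) hG hK
    (koszulMap_compat hU T.smooth_G T.symm hy) (T.symm y hy) hΓ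
    ((contDiffAt_of_mem hU F.smooth hy).of_le two_le_infty) hJe u v
  rw [hz, hz, sub_zero, sub_zero] at h
  exact h

/-- The structure equation for the Bismut connection. -/
lemma riem_bismut_frame {y : E} (hy : y ∈ U) (u v : E) {φ ψ : E → ℝ}
    (hφ : ∀ x ∈ U, φ x = fderiv ℝ a x (e x) (J x (e x)) - fderiv ℝ a x (J x (e x)) (e x))
    (hψ : ∀ x ∈ U, ψ x = fderiv ℝ b x (e x) (J x (e x)) - fderiv ℝ b x (J x (e x)) (e x)) :
    riem (hermMap G a b) (bismutMap G a b)
        (bismut (fun y u v => hermMap G a b y u v) (fun y u => J y u) y) y u v (e y) (J y (e y)) =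
      riem G (koszulMap G) (christoffel (fun y u v => G y u v) y) y u v (e y) (J y (e y))
      + (fderiv ℝ φ y u * a y v - fderiv ℝ φ y v * a y u
        + φ y * (fderiv ℝ a y u v - fderiv ℝ a y v u))
      + (fderiv ℝ ψ y u * b y v - fderiv ℝ ψ y v * b y u
        + ψ y * (fderiv ℝ b y u v - fderiv ℝ b y v u)) := by
  have hU := T.isOpen
  have hG := differentiableAt_of_mem hU T.smooth_G hy
  have he := differentiableAt_of_mem hU F.smooth hy
  have hJe := (differentiableAt_of_mem hU T.smooth_J hy).clm_apply he
  have ha := differentiableAt_of_mem hU C.smooth_a hy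
  have hb := differentiableAt_of_mem hU C.smooth_b hy
  have hg : DifferentiableAt ℝ (hermMap G a b) y :=
    (contDiffAt_hermMap (contDiffAt_of_mem hU T.smooth_G hy) (contDiffAt_of_mem hU C.smooth_a hy)
      (contDiffAt_of_mem hU C.smooth_b hy)).differentiableAt (by simp)
  have hK : DifferentiableAt ℝ (bismutMap G a b) y :=
    (contDiffAt_bismutMap (contDiffAt_of_mem hU T.smooth_G hy)
      (contDiffAt_of_mem hU C.smooth_a hy) (contDiffAt_of_mem hU C.smooth_b hy)).differentiableAt
      (by simp)
  have hΓ := bismut_spec T C hdim F hy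
  set Γ := bismut (fun y u v => hermMap G a b y u v) (fun y u => J y u) y
  have hsymm := fun u v => hermMap_symm T C hdim hy u v
  have horth : ∀ {s : E → E}, DifferentiableAt ℝ s y →
      (∀ x ∈ U, hermMap G a b x (s x) (s x) = 1) → ∀ u,
      hermMap G a b y (s y) (fderiv ℝ s y u + Γ u (s y)) = 0 := by
    intro s hs h1 u
    have h := fderiv_const_of_eqOn hU h1 hy u
    rw [fderiv_apply₂ hg hs hs, hermMap_compat T C hdim hy, hsymm (fderiv ℝ s y u)] at h
    rw [map_add, hsymm (s y) (Γ u (s y)), hΓ]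
    linarith
  have haJ : ∀ x ∈ U, a x (J x (e x)) = 0 := fun x hx => by rw [C.a_J x hx, F.b_e x hx, neg_zero]
  have hbJ : ∀ x ∈ U, b x (J x (e x)) = 0 := fun x hx => by rw [C.b_J x hx, F.a_e x hx]
  have h1 := horth he (fun x hx => by simp [F.unit x hx, F.a_e x hx, F.b_e x hx])
  have h2 := horth hJe (fun x hx => by
    rw [hermMap_apply, T.herm x hx, F.unit x hx, haJ x hx, hbJ x hx]; ring)
  simp only [hermMap_apply, F.a_e y hy, F.b_e y hy, haJ y hy, hbJ y hy, zero_mul, add_zero]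
    at h1 h2
  have hvert : ∀ {V : E → E}, IsVertical U G V → ∀ v, bismutMap G a b y v (e y) (V y) =
      (fderiv ℝ a y v (e y) * a y (V y)
        + a y v * (fderiv ℝ a y (e y) (V y) - fderiv ℝ a y (V y) (e y)))
      + (fderiv ℝ b y v (e y) * b y (V y)
        + b y v * (fderiv ℝ b y (e y) (V y) - fderiv ℝ b y (V y) (e y))) := by
    intro V hV v
    rw [bismutMap_apply, hV.koszul_right hU T.smooth_G T.symm hy]; ring
  -- The derivative of `a(e) = 0` cancels the `Z`-component of `Γ`, because `da` and `db` annihilate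
  -- `Z`. Thus `∇e` stays horizontal for the Bismut connection.
  have haz : ∀ v, a y (fderiv ℝ e y v + Γ v (e y)) = 0 := by
    intro v
    have h := fderiv_const_of_eqOn hU F.a_e hy v
    rw [fderiv_apply_field ha he] at h
    have h3 := hΓ v (e y) (Z y)
    rw [hvert T.vert_Z, hermMap_apply, T.vert_Z.ker y hy, C.a_Z y hy, C.b_Z y hy,
      C.curv_a_Z y hy, C.curv_b_Z y hy] at h3
    rw [map_add]
    linarith
  have hbz : ∀ v, b y (fderiv ℝ e y v + Γ v (e y)) = 0 := by
    intro v
    have h := fderiv_const_of_eqOn hU F.b_e hy v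
    rw [fderiv_apply_field hb he] at h
    have h3 := hΓ v (e y) (W y)
    rw [hvert T.vert_W, hermMap_apply, T.vert_W.ker y hy, C.a_W y hy, C.b_W y hy,
      C.curv_a_W y hy, C.curv_b_W y hy] at h3
    rw [map_add]
    linarith
  have hz : ∀ u v, hermMap G a b y (fderiv ℝ e y v + Γ v (e y))
      (fderiv ℝ (fun y => J y (e y)) y u + Γ u (J y (e y))) = 0 := by
    intro u v
    rw [hermMap_expand T C hdim hy (F.unit y hy) (F.a_e y hy) (F.b_e y hy), h1, h2, haz, hbz]
    ring
  have h := riem_fields (s := e) (r := fun y => J y (e y)) hg hK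
    (hermMap_compat T C hdim hy) hsymm hΓ
    ((contDiffAt_of_mem hU F.smooth hy).of_le two_le_infty) hJe u v
  rw [hz, hz, sub_zero, sub_zero] at h
  have hcurv : ∀ {c : E → E →L[ℝ] ℝ} {φ : E → ℝ}, ContDiffOn ℝ ∞ c U →
      (∀ x ∈ U, φ x = fderiv ℝ c x (e x) (J x (e x)) - fderiv ℝ c x (J x (e x)) (e x)) →
      DifferentiableAt ℝ φ y := by
    intro c φ hc hφ
    have hdc := differentiableAt_fderiv (contDiffAt_of_mem hU hc hy) two_le_infty
    refine DifferentiableAt.congr_of_eventuallyEq (((hdc.clm_apply he).clm_apply hJe).fun_sub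
      ((hdc.clm_apply hJe).clm_apply he)) ?_
    filter_upwards [hU.mem_nhds hy] with x hx using hφ x hx
  have hφd := hcurv C.smooth_a hφ
  have hψd := hcurv C.smooth_b hψ
  -- The Bismut connection form in the frame `(e, Je)` is `θ^T + φ a + ψ b`: the terms with `a(Je)`
  -- and `b(Je)` vanish and the torsion contributes the traces.
  have hθ : ∀ v, ∀ x ∈ U, hermMap G a b x (fderiv ℝ e x v) (J x (e x))
      + bismutMap G a b x v (e x) (J x (e x)) =
      thetaT J G e v x + φ x * a x v + ψ x * b x v := by
    intro v x hx
    rw [hermMap_apply, bismutMap_apply, haJ x hx, hbJ x hx, hφ x hx, hψ x hx, thetaT]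
    ring
  have hd : ∀ u v, fderiv ℝ (fun x => hermMap G a b x (fderiv ℝ e x v) (J x (e x))
      + bismutMap G a b x v (e x) (J x (e x))) y u = fderiv ℝ (thetaT J G e v) y u
      + (fderiv ℝ φ y u * a y v + φ y * fderiv ℝ a y u v)
      + (fderiv ℝ ψ y u * b y v + ψ y * fderiv ℝ b y u v) := by
    intro u v
    have hav := ha.clm_apply (differentiableAt_const v)
    have hbv := hb.clm_apply (differentiableAt_const v)
    have ht := differentiableAt_thetaT T C hdim F hy v
    rw [fderiv_eq_of_eqOn hU (hθ v) hy, fderiv_fun_add (ht.fun_add (hφd.fun_mul hav))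
      (hψd.fun_mul hbv), fderiv_fun_add ht (hφd.fun_mul hav), fderiv_fun_mul hφd hav,
      fderiv_fun_mul hψd hbv]
    simp only [add_apply, smul_apply, smul_eq_mul, fderiv_apply_const ha, fderiv_apply_const hb]
    ring
  rw [hd, hd] at h
  rw [h, riem_eq_thetaT T C hdim F hy]
  ring

/-- The curvature of the Bismut connection annihilates vertical vectors. -/
lemma riem_bismut_vertical {y : E} (hy : y ∈ U) {V : E → E} (hV : IsVertical U G V)
    (ca cb : ℝ) (haV : ∀ x ∈ U, a x (V x) = ca) (hbV : ∀ x ∈ U, b x (V x) = cb)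
    (cVa : ∀ x ∈ U, ∀ v, fderiv ℝ a x v (V x) = fderiv ℝ a x (V x) v)
    (cVb : ∀ x ∈ U, ∀ v, fderiv ℝ b x v (V x) = fderiv ℝ b x (V x) v) (u v z : E) :
    riem (hermMap G a b) (bismutMap G a b)
      (bismut (fun y u v => hermMap G a b y u v) (fun y u => J y u) y) y u v (V y) z = 0 := by
  have hU := T.isOpen
  have hg : DifferentiableAt ℝ (hermMap G a b) y :=
    (contDiffAt_hermMap (contDiffAt_of_mem hU T.smooth_G hy) (contDiffAt_of_mem hU C.smooth_a hy)
      (contDiffAt_of_mem hU C.smooth_b hy)).differentiableAt (by simp)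
  have hK : DifferentiableAt ℝ (bismutMap G a b) y :=
    (contDiffAt_bismutMap (contDiffAt_of_mem hU T.smooth_G hy)
      (contDiffAt_of_mem hU C.smooth_a hy) (contDiffAt_of_mem hU C.smooth_b hy)).differentiableAt
      (by simp)
  -- `V` is Bismut-parallel: `a(V)` and `b(V)` are constant, `da` and `db` annihilate `V`, and `V`
  -- is null for the transverse connection.
  have hz : ∀ v z, ∀ x ∈ U, hermMap G a b x (fderiv ℝ V x v) z + bismutMap G a b x v (V x) z
      = 0 := by
    intro v z x hx
    have ha := fderiv_const_of_eqOn hU haV hx v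
    have hb := fderiv_const_of_eqOn hU hbV hx v
    rw [fderiv_apply_field (differentiableAt_of_mem hU C.smooth_a hx)
      (differentiableAt_of_mem hU hV.smooth hx)] at ha
    rw [fderiv_apply_field (differentiableAt_of_mem hU C.smooth_b hx)
      (differentiableAt_of_mem hU hV.smooth hx)] at hb
    rw [hermMap_apply, bismutMap_apply, hV.koszul_mid hU T.smooth_G T.symm hx, ← cVa x hx,
      ← cVb x hx]
    linear_combination (a x z) * ha + (b x z) * hb
  have hΓ := bismut_spec T C hdim F hy
  have h := riem_fields (s := V) (r := fun _ => z) hg hK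
    (hermMap_compat T C hdim hy) (hermMap_symm T C hdim hy) hΓ
    ((contDiffAt_of_mem hU hV.smooth hy).of_le two_le_infty) (differentiableAt_const z) u v
  have h0 : ∀ v w, hermMap G a b y (fderiv ℝ V y v +
      bismut (fun y u v => hermMap G a b y u v) (fun y u => J y u) y v (V y)) w = 0 := by
    intro v w
    rw [map_add, add_apply, hΓ, hz v w y hy]
  rw [h0, h0, fderiv_const_of_eqOn hU (hz v z) hy, fderiv_const_of_eqOn hU (hz u z) hy] at h
  simpa using h

/-- The total trace is `4`, and by Parseval for the unit vectors `Z` and `W` the forms `a ⊗ a` and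
`b ⊗ b` have trace `1` each, so every orthonormal basis gives `G` the trace `2`. -/
lemma onFrame_four {y : E} (hy : y ∈ U) {S : (Fin (Module.finrank ℝ E) → E) → ℝ} {c : ℝ}
    (h : ∀ f, ∑ i, G y (f i) (f i) = 2 → S f = c) :
    onFrame (Module.finrank ℝ E) (fun u v => hermMap G a b y u v) S = c := by
  have hfd : FiniteDimensional ℝ E := FiniteDimensional.of_finrank_pos (by omega)
  have hex : ∃ f : Fin (Module.finrank ℝ E) → E,
      IsOrthonormal (fun u v => hermMap G a b y u v) f := by
    refine ⟨fun i => (![e y, J y (e y), Z y, W y] : Fin 4 → E) (finCongr hdim i), fun i j => ?_⟩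
    have key : ∀ i j : Fin 4, hermMap G a b y ((![e y, J y (e y), Z y, W y] : Fin 4 → E) i)
        ((![e y, J y (e y), Z y, W y] : Fin 4 → E) j) = if i = j then 1 else 0 := by
      intro i j
      fin_cases i <;> fin_cases j <;>
        simp [F.unit y hy, F.a_e y hy, F.b_e y hy, T.herm y hy, T.J_skew_self hy,
          T.symm y hy (e y) (J y (e y)), C.a_J y hy, C.b_J y hy, C.a_Z y hy, C.a_W y hy,
          C.b_Z y hy, C.b_W y hy, T.vert_Z.ker y hy, T.vert_W.ker y hy, T.ker_Z' hy, T.ker_W' hy]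
    refine (key _ _).trans ?_
    simp
  rw [onFrame, dif_pos hex]
  refine h _ ?_
  have hf := hex.choose_spec
  generalize hex.choose = f at hf
  have hZ := sum_sq_of_isOrthonormal (hermMap G a b y) hf (Z y)
  have hW := sum_sq_of_isOrthonormal (hermMap G a b y) hf (W y)
  simp only [hermMap_apply, T.vert_Z.ker y hy, T.vert_W.ker y hy, C.a_Z y hy, C.a_W y hy,
    C.b_Z y hy, C.b_W y hy, mul_one, mul_zero, add_zero, zero_add] at hZ hW
  have hs : ∀ i, G y (f i) (f i) = 1 - a y (f i) * a y (f i) - b y (f i) * b y (f i) := fun i => by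
    have := hf i i
    simp only [hermMap_apply, if_true] at this
    linarith
  simp only [hs, Finset.sum_sub_distrib, hZ, hW, Finset.sum_const, Finset.card_univ,
    Fintype.card_fin, hdim]
  norm_num

/-- The Bismut-Ricci form of `G + a ⊗ a + b ⊗ b`. -/
lemma bismutRicci_eq {y : E} (hy : y ∈ U) {φ ψ : E → ℝ}
    (hφ : ∀ x ∈ U, ∀ e, G x e e = 1 → φ x = fderiv ℝ a x e (J x e) - fderiv ℝ a x (J x e) e)
    (hψ : ∀ x ∈ U, ∀ e, G x e e = 1 → ψ x = fderiv ℝ b x e (J x e) - fderiv ℝ b x (J x e) e)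
    (u v : E) :
    bismutRicci (fun y u v => hermMap G a b y u v) (fun y u => J y u) y u v =
      G y (J y u) v *
        (-(1 / 2) * transverseScal (fun y u v => G y u v) y + φ y ^ 2 + ψ y ^ 2)
      + (fderiv ℝ φ y u * a y v - fderiv ℝ φ y v * a y u)
      + (fderiv ℝ ψ y u * b y v - fderiv ℝ ψ y v * b y u) := by
  have hU := T.isOpen
  have hgc : ContDiffAt ℝ ∞ (hermMap G a b) y := contDiffAt_hermMap
    (contDiffAt_of_mem hU T.smooth_G hy) (contDiffAt_of_mem hU C.smooth_a hy)
    (contDiffAt_of_mem hU C.smooth_b hy)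
  have hK : DifferentiableAt ℝ (bismutMap G a b) y :=
    (contDiffAt_bismutMap (contDiffAt_of_mem hU T.smooth_G hy)
      (contDiffAt_of_mem hU C.smooth_a hy) (contDiffAt_of_mem hU C.smooth_b hy)).differentiableAt
      (by simp)
  have hun := F.unit y hy
  have hframe := riem_bismut_frame T C hdim F hy u v (fun x hx => hφ x hx _ (F.unit x hx))
    (fun x hx => hψ x hx _ (F.unit x hx))
  have hvZ := riem_bismut_vertical T C hdim F hy T.vert_Z 1 0 C.a_Z C.b_Z C.curv_a_Z C.curv_b_Z u v
  have hvW := riem_bismut_vertical T C hdim F hy T.vert_W 0 1 C.a_W C.b_W C.curv_a_W C.curv_b_W u v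
  have hcurv := curvature_bismut T C hdim F hy u v
  have hskew : ∀ w z, riem (hermMap G a b) (bismutMap G a b)
      (bismut (fun y u v => hermMap G a b y u v) (fun y u => J y u) y) y u v w z =
      - riem (hermMap G a b) (bismutMap G a b)
      (bismut (fun y u v => hermMap G a b y u v) (fun y u => J y u) y) y u v z w := by
    intro w z
    refine riem_skew (hgc.of_le two_le_infty) hK ?_ (hermMap_symm T C hdim hy) _ _ _ _
    filter_upwards [hU.mem_nhds hy] with x hx using hermMap_compat T C hdim hx
  -- For fixed `u`, `v` the curvature is a skew form annihilating `Z` and `W`, so its entry on `(e,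
  -- Je)` determines it and the Ricci trace returns exactly this entry.
  have hR := T.skew_basic hy C hdim
    (β := fun w z => riem (hermMap G a b) (bismutMap G a b)
      (bismut (fun y u v => hermMap G a b y u v) (fun y u => J y u) y) y u v w z)
    (fun w => ⟨fun p q => by simp only [← hcurv, map_add],
      fun c p => by simp only [← hcurv, map_smul]⟩) hskew
    (fun w => by rw [hskew, hvZ, neg_zero]) (fun w => by rw [hskew, hvW, neg_zero]) hun
  have hρ : bismutRicci (fun y u v => hermMap G a b y u v) (fun y u => J y u) y u v =
      riem (hermMap G a b) (bismutMap G a b)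
        (bismut (fun y u v => hermMap G a b y u v) (fun y u => J y u) y) y u v (e y)
          (J y (e y)) := by
    refine onFrame_four T C hdim F hy fun f hf => ?_
    have : ∀ i, hermMap G a b y (curvature (bismut (fun y u v => hermMap G a b y u v)
        (fun y u => J y u)) y u v (f i)) (J y (f i)) = G y (f i) (f i) *
        riem (hermMap G a b) (bismutMap G a b)
        (bismut (fun y u v => hermMap G a b y u v) (fun y u => J y u) y) y u v (e y)
          (J y (e y)) := fun i => by
      rw [hcurv]
      have := hR (f i) (J y (f i))
      rwa [T.herm y hy] at this
    simp only [this, ← Finset.sum_mul, hf]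
    ring
  -- Here `dθ^T` becomes `-½ R^T` times the area form, while `φ da` and `ψ db` become `φ²` and `ψ²`
  -- times it.
  rw [hρ, hframe, riem_basic T C hdim hy hun u v, T.herm y hy, hun,
    transverseScal_eq T C hdim hy hun,
    curv_basic T C hdim hy (C.curv_a_Z y hy) (C.curv_a_W y hy) hun u v,
    curv_basic T C hdim hy (C.curv_b_Z y hy) (C.curv_b_W y hy) hun u v,
    ← hφ y hy _ hun, ← hψ y hy _ hun]
  ring

end BismutRicci

/-! ### Chart expressions of tensor fields and their smoothness -/

section ChartCalculus

variable {E : Type*} [NormedAddCommGroup E] [NormedSpace ℝ E] {H : Type*} [TopologicalSpace H]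
  {I : ModelWithCorners ℝ E H} {M : Type*} [TopologicalSpace M] [ChartedSpace H M]

variable (I) in
/-- `ofCoord` as a continuous linear map. -/
def ofCoordL (c : M) (y : E) : E →L[ℝ] E :=
  mfderivWithin 𝓘(ℝ, E) I (extChartAt I c).symm (range I) y

variable (I) in
/-- `toCoord` as a continuous linear map. -/
def toCoordL (c p : M) : E →L[ℝ] E :=
  mfderiv I 𝓘(ℝ, E) (extChartAt I c) p

/-- Coordinate expression of a one-form, as a field of continuous linear maps. -/
def oneMap (c : M) (α : OneForm I M) (y : E) : E →L[ℝ] ℝ :=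
  (show E →L[ℝ] ℝ from α ((extChartAt I c).symm y)).comp (ofCoordL I c y)

/-- Coordinate expression of a two-tensor, as a field of continuous bilinear maps. -/
def twoMap (c : M) (B : TwoTensor I M) (y : E) : E →L[ℝ] E →L[ℝ] ℝ :=
  (show E →L[ℝ] E →L[ℝ] ℝ from B ((extChartAt I c).symm y)).bilinearComp
    (ofCoordL I c y) (ofCoordL I c y)

/-- Coordinate expression of an endomorphism field, as a field of continuous linear maps. -/
def endMap (c : M) (A : EndField I M) (y : E) : E →L[ℝ] E :=
  (toCoordL I c ((extChartAt I c).symm y)).comp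
    ((show E →L[ℝ] E from A ((extChartAt I c).symm y)).comp (ofCoordL I c y))

lemma oneRep_eq (c : M) (α : OneForm I M) : oneRep c α = fun y u => oneMap c α y u := rfl

lemma twoRep_eq (c : M) (B : TwoTensor I M) : twoRep c B = fun y u v => twoMap c B y u v := rfl

lemma endRep_eq (c : M) (A : EndField I M) : endRep c A = fun y u => endMap c A y u := rfl

variable [IsManifold I ∞ M]

instance : IsManifold I 1 M := IsManifold.of_le (n := ∞) (by exact_mod_cast le_top)

lemma toCoord_ofCoord {c : M} {y : E} (hy : y ∈ (extChartAt I c).target) (u : E) :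
    toCoord I c _ (ofCoord I c y u) = u :=
  DFunLike.congr_fun (mfderiv_extChartAt_comp_mfderivWithin_extChartAt_symm hy) u

lemma ofCoord_toCoord {c : M} {y : E} (hy : y ∈ (extChartAt I c).target)
    (X : TangentSpace I ((extChartAt I c).symm y)) : ofCoord I c y (toCoord I c _ X) = X :=
  DFunLike.congr_fun (mfderivWithin_extChartAt_symm_comp_mfderiv_extChartAt hy) X

lemma toCoord_self (p : M) (X : TangentSpace I p) : toCoord I p p X = X :=
  DFunLike.congr_fun (mfderiv_extChartAt_self (I := I) (x := p)) X

lemma oneMap_toCoord {c p : M} (hp : p ∈ (extChartAt I c).source) (α : OneForm I M)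
    (X : TangentSpace I p) : oneMap c α (extChartAt I c p) (toCoord I c p X) = α p X := by
  -- The point is replaced by the inverse chart at `y` so that the tangent spaces in the two
  -- directions agree definitionally.
  obtain ⟨y, hy, rfl⟩ : ∃ y ∈ (extChartAt I c).target, (extChartAt I c).symm y = p :=
    ⟨_, (extChartAt I c).map_source hp, (extChartAt I c).left_inv hp⟩
  rw [(extChartAt I c).right_inv hy]
  exact congrArg (α _) (ofCoord_toCoord hy X)

lemma twoMap_toCoord {c p : M} (hp : p ∈ (extChartAt I c).source) (B : TwoTensor I M)
    (X Y : TangentSpace I p) :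
    twoMap c B (extChartAt I c p) (toCoord I c p X) (toCoord I c p Y) = B p X Y := by
  obtain ⟨y, hy, rfl⟩ : ∃ y ∈ (extChartAt I c).target, (extChartAt I c).symm y = p :=
    ⟨_, (extChartAt I c).map_source hp, (extChartAt I c).left_inv hp⟩
  rw [(extChartAt I c).right_inv hy]
  have hX := ofCoord_toCoord hy X
  have hY := ofCoord_toCoord hy Y
  calc _ = B _ (ofCoord I c y (toCoord I c _ X)) (ofCoord I c y (toCoord I c _ Y)) := rfl
    _ = _ := by rw [hX, hY]

lemma endMap_toCoord {c p : M} (hp : p ∈ (extChartAt I c).source) (A : EndField I M)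
    (X : TangentSpace I p) :
    endMap c A (extChartAt I c p) (toCoord I c p X) = toCoord I c p (A p X) := by
  obtain ⟨y, hy, rfl⟩ : ∃ y ∈ (extChartAt I c).target, (extChartAt I c).symm y = p :=
    ⟨_, (extChartAt I c).map_source hp, (extChartAt I c).left_inv hp⟩
  rw [(extChartAt I c).right_inv hy]
  have hX := ofCoord_toCoord hy X
  calc _ = toCoord I c _ (A _ (ofCoord I c y (toCoord I c _ X))) := rfl
    _ = _ := by rw [hX]

lemma vecRep_extChartAt {c p : M} (hp : p ∈ (extChartAt I c).source) (V : VField I M) :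
    vecRep c V (extChartAt I c p) = toCoord I c p (V p) := by
  obtain ⟨y, hy, rfl⟩ : ∃ y ∈ (extChartAt I c).target, (extChartAt I c).symm y = p :=
    ⟨_, (extChartAt I c).map_source hp, (extChartAt I c).left_inv hp⟩
  rw [(extChartAt I c).right_inv hy]
  rfl

section Smoothness

variable {E' : Type*} [NormedAddCommGroup E'] [NormedSpace ℝ E']

lemma toCoord_eq_trivialization {c p : M} (hp : p ∈ (extChartAt I c).source)
    (X : TangentSpace I p) : toCoord I c p X =
      (trivializationAt E (TangentSpace I) c (⟨p, X⟩ : TangentBundle I M)).2 := by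
  have hp' : p ∈ (chartAt H c).source := by rwa [extChartAt_source] at hp
  have h : (trivializationAt E (TangentSpace I) c).continuousLinearMapAt ℝ p X =
      (trivializationAt E (TangentSpace I) c (⟨p, X⟩ : TangentBundle I M)).2 := by
    rw [Bundle.Trivialization.continuousLinearMapAt_apply,
      Bundle.Trivialization.linearMapAt_apply, if_pos]
    exact hp'
  exact (DFunLike.congr_fun (TangentBundle.continuousLinearMapAt_trivializationAt hp') X).symm.trans
    h

/-- A vector field along a map is smooth iff its coordinates are. -/
lemma contMDiffOn_field_iff {c : M} {s : Set E'} {m : E' → M}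
    (hm : ContMDiffOn 𝓘(ℝ, E') I ∞ m s) (hs : MapsTo m s (extChartAt I c).source)
    (X : ∀ q, TangentSpace I (m q)) :
    ContMDiffOn 𝓘(ℝ, E') I.tangent ∞ (fun q => (⟨m q, X q⟩ : TangentBundle I M)) s ↔
      ContDiffOn ℝ ∞ (fun q => toCoord I c (m q) (X q)) s := by
  rw [Bundle.Trivialization.contMDiffOn_iff (e := trivializationAt E (TangentSpace I) c)]
  · rw [← contMDiffOn_iff_contDiffOn]
    refine ⟨fun h => h.2.congr fun q hq => toCoord_eq_trivialization (hs hq) _,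
      fun h => ⟨hm, h.congr fun q hq => (toCoord_eq_trivialization (hs hq) _).symm⟩⟩
  · intro q hq
    have := hs hq
    rw [extChartAt_source] at this
    simpa using this

lemma contMDiffOn_ofCoord {c : M} {s : Set E'} {κ : E' → E} (hκ : ContDiffOn ℝ ∞ κ s)
    (hs : MapsTo κ s (extChartAt I c).target) (u : E) :
    ContMDiffOn 𝓘(ℝ, E') I.tangent ∞
      (fun q => (⟨(extChartAt I c).symm (κ q), ofCoord I c (κ q) u⟩ : TangentBundle I M)) s := by
  refine (contMDiffOn_field_iff (c := c) ?_ ?_ _).2 ?_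
  · exact (contMDiffOn_extChartAt_symm c).comp hκ.contMDiffOn hs
  · exact fun q hq => (extChartAt I c).map_target (hs hq)
  · exact contDiffOn_const.congr fun q hq => toCoord_ofCoord (hs hq) u

lemma contDiffOn_of_trivial {s : Set E'} {m : E' → M} {f : E' → ℝ}
    (h : ContMDiffOn 𝓘(ℝ, E') (I.prod 𝓘(ℝ, ℝ)) ∞
      (fun q => TotalSpace.mk' ℝ (E := Bundle.Trivial M ℝ) (m q) (f q)) s) :
    ContDiffOn ℝ ∞ f s := by
  rw [← contMDiffOn_iff_contDiffOn]
  intro q hq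
  have := h q hq
  simp only [contMDiffWithinAt_totalSpace] at this
  exact this.2

lemma contDiffOn_vecRep {V : VField I M}
    (hV : ContMDiff I I.tangent ∞ fun x : M => (⟨x, V x⟩ : TangentBundle I M)) (c : M) :
    ContDiffOn ℝ ∞ (vecRep c V) (extChartAt I c).target :=
  (contMDiffOn_field_iff (c := c) (contMDiffOn_extChartAt_symm c)
    (fun _ hq => (extChartAt I c).map_target hq) _).1
    (hV.comp_contMDiffOn (contMDiffOn_extChartAt_symm c))

variable [FiniteDimensional ℝ E]

/-- In finite dimension a field of linear maps is smooth once its values on constant vectors are,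
and constant coordinate vectors come from smooth local sections of the tangent bundle. -/
lemma contDiffOn_oneMap {α : OneForm I M} (hα : SmoothOne α) (c : M) :
    ContDiffOn ℝ ∞ (oneMap c α) (extChartAt I c).target := by
  rw [contDiffOn_clm_apply]
  intro u
  refine contDiffOn_of_trivial (I := I) (m := (extChartAt I c).symm) ?_
  refine ContMDiffOn.clm_bundle_apply (F₁ := E) (E₁ := fun p : M => TangentSpace I p)
    (F₂ := ℝ) (E₂ := Bundle.Trivial M ℝ) (ϕ := fun y => α ((extChartAt I c).symm y)) (v := fun y => ofCoord I c y u) ?_ ?_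
  · exact ContMDiff.comp_contMDiffOn hα (contMDiffOn_extChartAt_symm c)
  · exact contMDiffOn_ofCoord contDiffOn_id (fun _ h => h) u

lemma contDiffOn_endMap {A : EndField I M}
    (hA : ContMDiff I (I.prod 𝓘(ℝ, E →L[ℝ] E)) ∞ fun x : M => TotalSpace.mk' (E →L[ℝ] E)
      (E := fun x : M => TangentSpace I x →L[ℝ] TangentSpace I x) x (A x)) (c : M) :
    ContDiffOn ℝ ∞ (endMap c A) (extChartAt I c).target := by
  rw [contDiffOn_clm_apply]
  intro u
  refine (contMDiffOn_field_iff (c := c) (contMDiffOn_extChartAt_symm c)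
    (fun _ hq => (extChartAt I c).map_target hq)
    (fun y => A ((extChartAt I c).symm y) (ofCoord I c y u))).1 ?_
  refine ContMDiffOn.clm_bundle_apply (F₁ := E) (E₁ := fun p : M => TangentSpace I p)
    (ϕ := fun y => A ((extChartAt I c).symm y)) (v := fun y => ofCoord I c y u) ?_ ?_
  · exact hA.comp_contMDiffOn (contMDiffOn_extChartAt_symm c)
  · exact contMDiffOn_ofCoord contDiffOn_id (fun _ h => h) u

lemma contDiffOn_twoMap {B : TwoTensor I M}
    (hB : ContMDiff I (I.prod 𝓘(ℝ, E →L[ℝ] E →L[ℝ] ℝ)) ∞ fun p : M =>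
      TotalSpace.mk' (E →L[ℝ] E →L[ℝ] ℝ)
      (E := fun p : M => TangentSpace I p →L[ℝ] TangentSpace I p →L[ℝ] ℝ) p (B p)) (c : M) :
    ContDiffOn ℝ ∞ (twoMap c B) (extChartAt I c).target := by
  rw [contDiffOn_clm_apply]
  intro u
  rw [contDiffOn_clm_apply]
  intro v
  refine contDiffOn_of_trivial (I := I) (m := (extChartAt I c).symm) ?_
  refine ContMDiffOn.clm_bundle_apply₂ (F₁ := E) (F₂ := E) (E₁ := fun p : M => TangentSpace I p)
    (E₂ := fun p : M => TangentSpace I p) (F₃ := ℝ) (E₃ := Bundle.Trivial M ℝ)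
    (ψ := fun y => B ((extChartAt I c).symm y)) (v := fun y => ofCoord I c y u)
    (w := fun y => ofCoord I c y v) ?_ ?_ ?_
  · exact hB.comp_contMDiffOn (contMDiffOn_extChartAt_symm c)
  · exact contMDiffOn_ofCoord contDiffOn_id (fun _ h => h) u
  · exact contMDiffOn_ofCoord contDiffOn_id (fun _ h => h) v

/-- The chart on the space factor of `M × ℝ`. -/
lemma contMDiffOn_symm_prod (c : M) (𝒯 : Set ℝ) :
    ContMDiffOn 𝓘(ℝ, E × ℝ) (I.prod 𝓘(ℝ, ℝ)) ∞ (fun q : E × ℝ => ((extChartAt I c).symm q.1, q.2))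
      ((extChartAt I c).target ×ˢ 𝒯) :=
  ((contMDiffOn_extChartAt_symm c).comp contDiff_fst.contMDiff.contMDiffOn
    fun _ hq => hq.1).prodMk contDiff_snd.contMDiff.contMDiffOn

lemma contDiffOn_twoMap_family {𝒯 : Set ℝ} {B : ℝ → TwoTensor I M} (hB : SmoothTwoFamily 𝒯 B)
    (c : M) : ContDiffOn ℝ ∞ (fun q : E × ℝ => twoMap c (B q.2) q.1)
      ((extChartAt I c).target ×ˢ 𝒯) := by
  rw [contDiffOn_clm_apply]
  intro u
  rw [contDiffOn_clm_apply]
  intro v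
  refine contDiffOn_of_trivial (I := I) (m := fun q : E × ℝ => (extChartAt I c).symm q.1) ?_
  refine ContMDiffOn.clm_bundle_apply₂ (F₁ := E) (F₂ := E) (E₁ := fun p : M => TangentSpace I p)
    (E₂ := fun p : M => TangentSpace I p) (F₃ := ℝ) (E₃ := Bundle.Trivial M ℝ)
    (ψ := fun q : E × ℝ => B q.2 ((extChartAt I c).symm q.1))
    (v := fun q : E × ℝ => ofCoord I c q.1 u) (w := fun q : E × ℝ => ofCoord I c q.1 v) ?_ ?_ ?_
  · exact ContMDiffOn.comp hB (contMDiffOn_symm_prod c 𝒯) fun q hq => ⟨mem_univ _, hq.2⟩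
  · exact contMDiffOn_ofCoord contDiff_fst.contDiffOn (fun _ h => h.1) u
  · exact contMDiffOn_ofCoord contDiff_fst.contDiffOn (fun _ h => h.1) v

lemma contDiffOn_fun_family {𝒯 : Set ℝ} {f : ℝ → M → ℝ} (hf : SmoothFunFamily (I := I) 𝒯 f)
    (c : M) : ContDiffOn ℝ ∞ (fun q : E × ℝ => f q.2 ((extChartAt I c).symm q.1))
      ((extChartAt I c).target ×ˢ 𝒯) := by
  rw [← contMDiffOn_iff_contDiffOn]
  exact ContMDiffOn.comp hf (contMDiffOn_symm_prod c 𝒯) fun q hq => ⟨mem_univ _, hq.2⟩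

end Smoothness

end ChartCalculus

/-! ### Naturality of exterior and Lie derivatives -/

section Pullback

variable {E : Type*} [NormedAddCommGroup E] [NormedSpace ℝ E]

lemma fderiv_comp_fderiv {F : Type*} [NormedAddCommGroup F] [NormedSpace ℝ F] {τ : E → E}
    {a' : E → F} {y : E} (hτ : DifferentiableAt ℝ τ y) (ha : DifferentiableAt ℝ a' (τ y)) (u : E) :
    fderiv ℝ (fun z => a' (τ z)) y u = fderiv ℝ a' (τ y) (fderiv ℝ τ y u) := by
  have := fderiv_comp y ha hτ
  rw [Function.comp_def] at this
  rw [this]; rfl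

/-- The exterior derivative of one-forms is natural. -/
lemma curv_pullback {τ : E → E} {a a' : E → E →L[ℝ] ℝ} {y : E} (hτ : ContDiffAt ℝ ∞ τ y)
    (ha : DifferentiableAt ℝ a y) (ha' : DifferentiableAt ℝ a' (τ y))
    (h : ∀ᶠ z in 𝓝 y, ∀ u, a z u = a' (τ z) (fderiv ℝ τ z u)) (u v : E) :
    fderiv ℝ a y u v - fderiv ℝ a y v u =
      fderiv ℝ a' (τ y) (fderiv ℝ τ y u) (fderiv ℝ τ y v)
        - fderiv ℝ a' (τ y) (fderiv ℝ τ y v) (fderiv ℝ τ y u) := by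
  have hτd := hτ.differentiableAt (by simp)
  have hd := differentiableAt_fderiv hτ two_le_infty
  have hcomp : DifferentiableAt ℝ (fun z => a' (τ z)) y :=
    DifferentiableAt.comp (g := a') y ha' hτd
  have key : ∀ u v, fderiv ℝ a y u v = fderiv ℝ a' (τ y) (fderiv ℝ τ y u) (fderiv ℝ τ y v)
      + a' (τ y) (fderiv ℝ (fderiv ℝ τ) y u v) := by
    intro u v
    have hv : DifferentiableAt ℝ (fun z => fderiv ℝ τ z v) y :=
      hd.clm_apply (differentiableAt_const v)
    have e : (fun z => a z v) =ᶠ[𝓝 y] fun z => a' (τ z) (fderiv ℝ τ z v) := by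
      filter_upwards [h] with z hz using hz v
    rw [← fderiv_apply_const ha, e.fderiv_eq, fderiv_apply_field hcomp hv,
      fderiv_comp_fderiv hτd ha', fderiv_apply_const hd]
  -- The second derivative of `τ` enters symmetrically and disappears in the alternation.
  rw [key, key, second_fderiv_symm hτ two_le_infty v u]
  ring

/-- The Lie derivative of two-tensors is natural. -/
lemma lie_pullback {τ : E → E} {B B' : E → E →L[ℝ] E →L[ℝ] ℝ} {V V' : E → E} {y : E}
    (hτ : ContDiffAt ℝ ∞ τ y) (hB : DifferentiableAt ℝ B y) (hB' : DifferentiableAt ℝ B' (τ y))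
    (hV : DifferentiableAt ℝ V y) (hV' : DifferentiableAt ℝ V' (τ y))
    (h : ∀ᶠ z in 𝓝 y, ∀ u v, B z u v = B' (τ z) (fderiv ℝ τ z u) (fderiv ℝ τ z v))
    (hVV : ∀ᶠ z in 𝓝 y, fderiv ℝ τ z (V z) = V' (τ z)) (u v : E) :
    fderiv ℝ B y (V y) u v + B y (fderiv ℝ V y u) v + B y u (fderiv ℝ V y v) =
      fderiv ℝ B' (τ y) (V' (τ y)) (fderiv ℝ τ y u) (fderiv ℝ τ y v)
        + B' (τ y) (fderiv ℝ V' (τ y) (fderiv ℝ τ y u)) (fderiv ℝ τ y v)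
        + B' (τ y) (fderiv ℝ τ y u) (fderiv ℝ V' (τ y) (fderiv ℝ τ y v)) := by
  have hτd := hτ.differentiableAt (by simp)
  have hd := differentiableAt_fderiv hτ two_le_infty
  have hcomp : DifferentiableAt ℝ (fun z => B' (τ z)) y :=
    DifferentiableAt.comp (g := B') y hB' hτd
  have key : ∀ w u v, fderiv ℝ B y w u v =
      fderiv ℝ B' (τ y) (fderiv ℝ τ y w) (fderiv ℝ τ y u) (fderiv ℝ τ y v)
      + B' (τ y) (fderiv ℝ (fderiv ℝ τ) y w u) (fderiv ℝ τ y v)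
      + B' (τ y) (fderiv ℝ τ y u) (fderiv ℝ (fderiv ℝ τ) y w v) := by
    intro w u v
    have hv : ∀ v, DifferentiableAt ℝ (fun z => fderiv ℝ τ z v) y := fun v =>
      hd.clm_apply (differentiableAt_const v)
    have e : (fun z => B z u v) =ᶠ[𝓝 y] fun z => B' (τ z) (fderiv ℝ τ z u) (fderiv ℝ τ z v) := by
      filter_upwards [h] with z hz using hz u v
    rw [← fderiv_apply₂_const hB, e.fderiv_eq, fderiv_apply₂ hcomp (hv u) (hv v),
      fderiv_comp_fderiv hτd hB', fderiv_apply_const hd, fderiv_apply_const hd]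
  -- The relation `dτ(V) = V' ∘ τ` differentiated; its second-derivative term cancels the ones
  -- produced by pulling back `B'`.
  have hD : ∀ u, fderiv ℝ τ y (fderiv ℝ V y u) =
      fderiv ℝ V' (τ y) (fderiv ℝ τ y u) - fderiv ℝ (fderiv ℝ τ) y (V y) u := by
    intro u
    have e : (fun z => fderiv ℝ τ z (V z)) =ᶠ[𝓝 y] fun z => V' (τ z) := hVV
    have : fderiv ℝ (fun z => fderiv ℝ τ z (V z)) y u = fderiv ℝ (fun z => V' (τ z)) y u := by
      rw [e.fderiv_eq]
    rw [fderiv_apply_field hd hV, fderiv_comp_fderiv hτd hV', second_fderiv_symm hτ two_le_infty]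
      at this
    rw [← this]; abel
  have h0 := h.self_of_nhds
  rw [key, h0, h0, hD, hD, hVV.self_of_nhds]
  simp only [map_sub, sub_apply]
  ring

end Pullback

/-! ### Change of chart and invariance throughout a chart -/

section Transition

variable {E : Type*} [NormedAddCommGroup E] [NormedSpace ℝ E] {H : Type*} [TopologicalSpace H]
  {I : ModelWithCorners ℝ E H} {M : Type*} [TopologicalSpace M] [ChartedSpace H M]
  [IsManifold I ∞ M] [I.Boundaryless]

variable (I) in
/-- The change of coordinates between two charts. -/
def transition (c c' : M) (y : E) : E := extChartAt I c' ((extChartAt I c).symm y)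

lemma eventually_transition {c c' : M} {y : E} (hy : y ∈ (extChartAt I c).target)
    (hy' : (extChartAt I c).symm y ∈ (extChartAt I c').source) :
    ∀ᶠ z in 𝓝 y, z ∈ (extChartAt I c).target ∧
      (extChartAt I c).symm z ∈ (extChartAt I c').source := by
  filter_upwards [(isOpen_extChartAt_target c).mem_nhds hy,
    (continuousAt_extChartAt_symm'' hy).preimage_mem_nhds
      ((isOpen_extChartAt_source c').mem_nhds hy')] with z h1 h2 using ⟨h1, h2⟩

lemma contDiffAt_transition {c c' : M} {y : E} (hy : y ∈ (extChartAt I c).target)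
    (hy' : (extChartAt I c).symm y ∈ (extChartAt I c').source) :
    ContDiffAt ℝ ∞ (transition I c c') y := by
  have h := contDiffWithinAt_ext_coord_change (I := I) (n := ∞) c' c (y := y) (by
    simp only [PartialEquiv.trans_source, PartialEquiv.symm_source]
    exact ⟨hy, hy'⟩)
  rw [I.range_eq_univ, contDiffWithinAt_univ] at h
  exact h

lemma toCoord_ofCoord_transition {c c' : M} {y : E} (hy : y ∈ (extChartAt I c).target)
    (hy' : (extChartAt I c).symm y ∈ (extChartAt I c').source) (u : E) :
    toCoord I c' _ (ofCoord I c y u) = fderiv ℝ (transition I c c') y u := by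
  have hy'' : (extChartAt I c).symm y ∈ (chartAt H c').source := by
    rwa [← extChartAt_source (I := I)]
  have U : UniqueMDiffWithinAt 𝓘(ℝ, E) (range I) y :=
    I.uniqueMDiffOn y (extChartAt_target_subset_range c hy)
  have h := mfderiv_comp_mfderivWithin y (mdifferentiableAt_extChartAt (I := I) hy'')
    (mdifferentiableWithinAt_extChartAt_symm hy) U
  have h2 : mfderivWithin 𝓘(ℝ, E) 𝓘(ℝ, E) (extChartAt I c' ∘ (extChartAt I c).symm) (range I) y
      = fderiv ℝ (transition I c c') y := by
    rw [I.range_eq_univ, mfderivWithin_univ, mfderiv_eq_fderiv]; rfl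
  exact (DFunLike.congr_fun (h.symm.trans h2) u)

lemma oneMap_transition {c c' : M} {y : E} (hy : y ∈ (extChartAt I c).target)
    (hy' : (extChartAt I c).symm y ∈ (extChartAt I c').source) (α : OneForm I M) (u : E) :
    oneMap c α y u =
      oneMap c' α (transition I c c' y) (fderiv ℝ (transition I c c') y u) := by
  rw [← toCoord_ofCoord_transition hy hy', transition, oneMap_toCoord hy']
  rfl

lemma twoMap_transition {c c' : M} {y : E} (hy : y ∈ (extChartAt I c).target)
    (hy' : (extChartAt I c).symm y ∈ (extChartAt I c').source) (B : TwoTensor I M) (u v : E) :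
    twoMap c B y u v = twoMap c' B (transition I c c' y) (fderiv ℝ (transition I c c') y u)
      (fderiv ℝ (transition I c c') y v) := by
  rw [← toCoord_ofCoord_transition hy hy', ← toCoord_ofCoord_transition hy hy', transition,
    twoMap_toCoord hy']
  rfl

lemma endMap_transition {c c' : M} {y : E} (hy : y ∈ (extChartAt I c).target)
    (hy' : (extChartAt I c).symm y ∈ (extChartAt I c').source) (A : EndField I M) (u : E) :
    fderiv ℝ (transition I c c') y (endMap c A y u) =
      endMap c' A (transition I c c' y) (fderiv ℝ (transition I c c') y u) := by
  rw [← toCoord_ofCoord_transition hy hy', ← toCoord_ofCoord_transition hy hy', transition,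
    endMap_toCoord hy']
  exact congrArg _ (ofCoord_toCoord hy _)

lemma vecRep_transition {c c' : M} {y : E} (hy : y ∈ (extChartAt I c).target)
    (hy' : (extChartAt I c).symm y ∈ (extChartAt I c').source) (V : VField I M) :
    fderiv ℝ (transition I c c') y (vecRep c V y) = vecRep c' V (transition I c c' y) := by
  rw [← toCoord_ofCoord_transition hy hy', transition, vecRep_extChartAt hy', vecRep,
    ofCoord_toCoord hy]

/-- Smoothness of a one-form in every chart. -/
def ChartSmoothOne (α : OneForm I M) : Prop :=
  ∀ c, ContDiffOn ℝ ∞ (oneMap c α) (extChartAt I c).target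

/-- Smoothness of a two-tensor in every chart. -/
def ChartSmoothTwo (B : TwoTensor I M) : Prop :=
  ∀ c, ContDiffOn ℝ ∞ (twoMap c B) (extChartAt I c).target

/-- Smoothness of a vector field in every chart. -/
def ChartSmoothVec (V : VField I M) : Prop :=
  ∀ c, ContDiffOn ℝ ∞ (vecRep c V) (extChartAt I c).target

variable {c : M} {y : E} (hy : y ∈ (extChartAt I c).target)
include hy

lemma curv_transition {c' : M} (hy' : (extChartAt I c).symm y ∈ (extChartAt I c').source)
    {α : OneForm I M} (hα : ChartSmoothOne α) (u v : E) :
    fderiv ℝ (oneMap c α) y u v - fderiv ℝ (oneMap c α) y v u =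
      fderiv ℝ (oneMap c' α) (transition I c c' y) (fderiv ℝ (transition I c c') y u)
        (fderiv ℝ (transition I c c') y v)
      - fderiv ℝ (oneMap c' α) (transition I c c' y) (fderiv ℝ (transition I c c') y v)
        (fderiv ℝ (transition I c c') y u) := by
  have hτ : transition I c c' y ∈ (extChartAt I c').target := (extChartAt I c').map_source hy'
  refine curv_pullback (contDiffAt_transition hy hy')
    (differentiableAt_of_mem (isOpen_extChartAt_target c) (hα c) hy)
    (differentiableAt_of_mem (isOpen_extChartAt_target c') (hα c') hτ) ?_ u v
  filter_upwards [eventually_transition hy hy'] with z hz u using oneMap_transition hz.1 hz.2 α u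

/-- An invariant one-form that is constant on `V` has curvature annihilated by `V`, in any chart. -/
lemma curv_of_invariantOne {α : OneForm I M} (hα : ChartSmoothOne α) {V : VField I M}
    (hV : ChartSmoothVec V) (hinv : InvariantOne V α) {k : ℝ} (hk : ∀ p, α p (V p) = k) (v : E) :
    fderiv ℝ (oneMap c α) y v (vecRep c V y) = fderiv ℝ (oneMap c α) y (vecRep c V y) v := by
  set p := (extChartAt I c).symm y
  have hp : p ∈ (extChartAt I p).source := mem_extChartAt_source p
  have hp' : extChartAt I p p ∈ (extChartAt I p).target := mem_extChartAt_target p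
  have ho := isOpen_extChartAt_target (I := I) p
  have hαp := differentiableAt_of_mem ho (hα p) hp'
  have hVp := differentiableAt_of_mem ho (hV p) hp'
  have hc : ∀ z ∈ (extChartAt I p).target, oneMap p α z (vecRep p V z) = k := by
    intro z hz
    have h := oneMap_toCoord ((extChartAt I p).map_target hz) α (V ((extChartAt I p).symm z))
    rw [(extChartAt I p).right_inv hz, hk] at h
    exact h
  -- Cartan's formula at the centre of the chart around `p`: `ι_V dα = L_V α - d(α(V))`, and `α(V)`
  -- is constant.
  have hF : ∀ v, fderiv ℝ (oneMap p α) (extChartAt I p p) v (vecRep p V (extChartAt I p p))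
      = fderiv ℝ (oneMap p α) (extChartAt I p p) (vecRep p V (extChartAt I p p)) v := by
    intro v
    have h1 := fderiv_const_of_eqOn ho hc hp' v
    rw [fderiv_apply_field hαp hVp] at h1
    have h2 := hinv p v
    rw [oneRep_eq, lieOne_eq hαp] at h2
    linarith
  have h := curv_transition hy hp hα v (vecRep c V y)
  rw [vecRep_transition hy hp] at h
  have := hF (fderiv ℝ (transition I c p) y v)
  rw [show extChartAt I p p = transition I c p y from rfl] at this
  linarith

/-- Invariance is assumed only at the centre of each preferred chart. The chart centred at the point
in question is used there, and naturality of the Lie derivative transports the identity to the given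
chart. -/
lemma lie_of_invariantTwo {B : TwoTensor I M} (hB : ChartSmoothTwo B) {V : VField I M}
    (hV : ChartSmoothVec V) (hinv : InvariantTwo V B) (u v : E) :
    fderiv ℝ (twoMap c B) y (vecRep c V y) u v + twoMap c B y (fderiv ℝ (vecRep c V) y u) v
      + twoMap c B y u (fderiv ℝ (vecRep c V) y v) = 0 := by
  set p := (extChartAt I c).symm y
  have hp : p ∈ (extChartAt I p).source := mem_extChartAt_source p
  have hp' : extChartAt I p p ∈ (extChartAt I p).target := mem_extChartAt_target p
  have hBp := differentiableAt_of_mem (isOpen_extChartAt_target (I := I) p) (hB p) hp'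
  have hVp := differentiableAt_of_mem (isOpen_extChartAt_target (I := I) p) (hV p) hp'
  have h := hinv p (fderiv ℝ (transition I c p) y u) (fderiv ℝ (transition I c p) y v)
  rw [twoRep_eq, lieTwo_eq hBp] at h
  rw [← h]
  refine lie_pullback (τ := transition I c p) (B' := twoMap p B) (V' := vecRep p V)
    (contDiffAt_transition hy hp)
    (differentiableAt_of_mem (isOpen_extChartAt_target (I := I) c) (hB c) hy) hBp
    (differentiableAt_of_mem (isOpen_extChartAt_target (I := I) c) (hV c) hy) hVp ?_ ?_ u v
  · filter_upwards [eventually_transition hy hp] with z hz u v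
      using twoMap_transition hz.1 hz.2 B u v
  · filter_upwards [eventually_transition hy hp] with z hz using vecRep_transition hz.1 hz.2 V

lemma oneMap_vecRep (α : OneForm I M) (V : VField I M) :
    oneMap c α y (vecRep c V y) = α ((extChartAt I c).symm y) (V ((extChartAt I c).symm y)) := by
  have h := oneMap_toCoord ((extChartAt I c).map_target hy) α (V ((extChartAt I c).symm y))
  rwa [(extChartAt I c).right_inv hy] at h

lemma twoMap_vecRep (B : TwoTensor I M) (u : E) (V : VField I M) :
    twoMap c B y u (vecRep c V y) =
      B ((extChartAt I c).symm y) (ofCoord I c y u) (V ((extChartAt I c).symm y)) := by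
  have h := twoMap_toCoord ((extChartAt I c).map_target hy) B (ofCoord I c y u)
    (V ((extChartAt I c).symm y))
  rw [(extChartAt I c).right_inv hy, toCoord_ofCoord hy] at h
  exact h

lemma endMap_vecRep (A : EndField I M) (V : VField I M) :
    endMap c A y (vecRep c V y) =
      toCoord I c _ (A ((extChartAt I c).symm y) (V ((extChartAt I c).symm y))) := by
  have h := endMap_toCoord ((extChartAt I c).map_target hy) A (V ((extChartAt I c).symm y))
  rwa [(extChartAt I c).right_inv hy] at h

lemma endMap_eq (A : EndField I M) (u : E) : ofCoord I c y (endMap c A y u) =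
    A ((extChartAt I c).symm y) (ofCoord I c y u) :=
  ofCoord_toCoord hy _

end Transition

/-! ### Functions and their differentials in charts -/

section Functions

variable {E : Type*} [NormedAddCommGroup E] [NormedSpace ℝ E] {H : Type*} [TopologicalSpace H]
  {I : ModelWithCorners ℝ E H} {M : Type*} [TopologicalSpace M] [ChartedSpace H M]
  [IsManifold I ∞ M] [I.Boundaryless]

lemma SmoothFunFamily.contMDiff {𝒯 : Set ℝ} {f : ℝ → M → ℝ} (hf : SmoothFunFamily (I := I) 𝒯 f)
    {t : ℝ} (ht : t ∈ 𝒯) : ContMDiff I 𝓘(ℝ, ℝ) ∞ (f t) := by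
  rw [← contMDiffOn_univ]
  exact ContMDiffOn.comp (I' := I.prod 𝓘(ℝ, ℝ)) (f := fun p : M => (p, t)) (t := univ ×ˢ 𝒯)
    (g := fun q : M × ℝ => f q.2 q.1) hf (contMDiff_id.prodMk contMDiff_const).contMDiffOn
    fun p _ => ⟨mem_univ _, ht⟩

lemma SmoothTwoFamily.contMDiff {𝒯 : Set ℝ} {B : ℝ → TwoTensor I M} (hB : SmoothTwoFamily 𝒯 B)
    {t : ℝ} (ht : t ∈ 𝒯) : ContMDiff I (I.prod 𝓘(ℝ, E →L[ℝ] E →L[ℝ] ℝ)) ∞ fun p : M =>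
      TotalSpace.mk' (E →L[ℝ] E →L[ℝ] ℝ)
      (E := fun p : M => TangentSpace I p →L[ℝ] TangentSpace I p →L[ℝ] ℝ) p (B t p) := by
  rw [← contMDiffOn_univ]
  exact ContMDiffOn.comp (I' := I.prod 𝓘(ℝ, ℝ)) (f := fun p : M => (p, t)) (t := univ ×ˢ 𝒯)
    (g := fun q : M × ℝ => TotalSpace.mk' (E →L[ℝ] E →L[ℝ] ℝ)
      (E := fun p : M => TangentSpace I p →L[ℝ] TangentSpace I p →L[ℝ] ℝ) q.1 (B q.2 q.1))
    hB (contMDiff_id.prodMk contMDiff_const).contMDiffOn fun p _ => ⟨mem_univ _, ht⟩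

lemma contDiffOn_chart {f : M → ℝ} (hf : ContMDiff I 𝓘(ℝ, ℝ) ∞ f) (c : M) :
    ContDiffOn ℝ ∞ (fun y => f ((extChartAt I c).symm y)) (extChartAt I c).target := by
  rw [← contMDiffOn_iff_contDiffOn]
  exact hf.comp_contMDiffOn (contMDiffOn_extChartAt_symm c)

lemma oneMap_dFun {f : M → ℝ} (hf : ContMDiff I 𝓘(ℝ, ℝ) ∞ f) {c : M} {y : E}
    (hy : y ∈ (extChartAt I c).target) :
    oneMap c (dFun (I := I) f) y = fderiv ℝ (fun y => f ((extChartAt I c).symm y)) y := by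
  have U : UniqueMDiffWithinAt 𝓘(ℝ, E) (range I) y :=
    I.uniqueMDiffOn y (extChartAt_target_subset_range c hy)
  have h := mfderiv_comp_mfderivWithin y (hf.mdifferentiable (by simp) ((extChartAt I c).symm y))
    (mdifferentiableWithinAt_extChartAt_symm hy) U
  have h2 : mfderivWithin 𝓘(ℝ, E) 𝓘(ℝ, ℝ) (f ∘ (extChartAt I c).symm) (range I) y
      = fderiv ℝ (fun y => f ((extChartAt I c).symm y)) y := by
    rw [I.range_eq_univ, mfderivWithin_univ, mfderiv_eq_fderiv]; rfl
  exact h.symm.trans h2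

lemma oneMap_dcFun {f : M → ℝ} (hf : ContMDiff I 𝓘(ℝ, ℝ) ∞ f) (J : EndField I M) {c : M} {y : E}
    (hy : y ∈ (extChartAt I c).target) :
    oneMap c (dcFun J f) y = dcMap (endMap c J) (fun y => f ((extChartAt I c).symm y)) y := by
  ext u
  rw [dcMap, ← oneMap_dFun hf hy]
  have h := endMap_eq hy J u
  calc oneMap c (dcFun J f) y u
      = -(dFun (I := I) f ((extChartAt I c).symm y) (J _ (ofCoord I c y u))) := rfl
    _ = -(dFun (I := I) f ((extChartAt I c).symm y) (ofCoord I c y (endMap c J y u))) := by rw [h]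
    _ = _ := rfl

end Functions

/-! ### Algebraic identities of the Sasakian structure -/

namespace Sasakian

variable {N : Type*} [TopologicalSpace N] [ChartedSpace (EuclideanSpace ℝ (Fin 3)) N]
  [IsManifold (𝓡 3) ∞ N] (S : Sasakian N)

lemma smooth_vecRep_Z (c : N) : ContDiffOn ℝ ∞ (vecRep c S.Z) (extChartAt (𝓡 3) c).target :=
  contDiffOn_vecRep S.smooth_Z c

lemma smooth_endMap_I (c : N) : ContDiffOn ℝ ∞ (endMap c S.I) (extChartAt (𝓡 3) c).target :=
  contDiffOn_endMap S.smooth_I c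

lemma smooth_twoMap_g (c : N) :
    ContDiffOn ℝ ∞ (twoMap c S.g.inner) (extChartAt (𝓡 3) c).target :=
  contDiffOn_twoMap S.g.contMDiff c

lemma eq_zero_of_inner (x : N) (v : TangentSpace (𝓡 3) x) (h : S.g.inner x v v = 0) : v = 0 := by
  by_contra hv
  exact (S.g.pos x v hv).ne' h

lemma twoMap_self (x : N) (u v : EuclideanSpace ℝ (Fin 3)) :
    twoMap x S.g.inner (extChartAt (𝓡 3) x x) u v = S.g.inner x u v := by
  have h := twoMap_toCoord (mem_extChartAt_source (I := 𝓡 3) x) S.g.inner u v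
  exact (congrArg₂ (fun u v => twoMap x S.g.inner (extChartAt (𝓡 3) x x) u v)
    (toCoord_self x u) (toCoord_self x v)).symm.trans h

lemma exists_represent (x : N) {ℓ : EuclideanSpace ℝ (Fin 3) → ℝ} (hlin : IsLinearMap ℝ ℓ) :
    ∃ v, ∀ w, twoMap x S.g.inner (extChartAt (𝓡 3) x x) v w = ℓ w := by
  set B := twoMap x S.g.inner (extChartAt (𝓡 3) x x)
  let φ : EuclideanSpace ℝ (Fin 3) →ₗ[ℝ] Module.Dual ℝ (EuclideanSpace ℝ (Fin 3)) :=
    { toFun := fun u => (B u).toLinearMap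
      map_add' := fun u v => by ext w; simp
      map_smul' := fun r u => by ext w; simp }
  have hinj : Function.Injective φ := by
    rw [← LinearMap.ker_eq_bot, LinearMap.ker_eq_bot']
    intro u hu
    have h : B u u = 0 := DFunLike.congr_fun hu u
    rw [S.twoMap_self] at h
    exact S.eq_zero_of_inner x u h
  have hsurj : Function.Surjective φ :=
    (LinearMap.injective_iff_surjective_of_finrank_eq_finrank
      (Subspace.dual_finrank_eq (K := ℝ)).symm).1 hinj
  obtain ⟨v, hv⟩ := hsurj (IsLinearMap.mk' ℓ hlin)
  exact ⟨v, fun w => DFunLike.congr_fun hv w⟩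

lemma christoffel_spec (x : N) (u v w : EuclideanSpace ℝ (Fin 3)) :
    twoMap x S.g.inner (extChartAt (𝓡 3) x x)
      (christoffel (twoRep x S.g.inner) (extChartAt (𝓡 3) x x) u v) w =
      koszulMap (twoMap x S.g.inner) (extChartAt (𝓡 3) x x) u v w := by
  have hx := mem_extChartAt_target (I := 𝓡 3) x
  have hk : koszul (twoRep x S.g.inner) (extChartAt (𝓡 3) x x) u v
      = fun w => koszulMap (twoMap x S.g.inner) (extChartAt (𝓡 3) x x) u v w :=
    funext fun w => koszul_eq (differentiableAt_of_mem (isOpen_extChartAt_target x)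
      (S.smooth_twoMap_g x) hx) u v w
  rw [christoffel, hk]
  exact raise_spec (B := fun u v => twoMap x S.g.inner (extChartAt (𝓡 3) x x) u v)
    (S.exists_represent x
      (koszulMap (twoMap x S.g.inner) (extChartAt (𝓡 3) x x) u v).toLinearMap.isLinear) w

lemma twoMap_unit (c : N) {y : EuclideanSpace ℝ (Fin 3)} (hy : y ∈ (extChartAt (𝓡 3) c).target) :
    twoMap c S.g.inner y (vecRep c S.Z y) (vecRep c S.Z y) = 1 := by
  rw [twoMap_vecRep hy, vecRep, ofCoord_toCoord hy, S.unit]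

section Center

variable (x : N)

lemma deriv_unit (u : EuclideanSpace ℝ (Fin 3)) :
    fderiv ℝ (twoMap x S.g.inner) (extChartAt (𝓡 3) x x) u (vecRep x S.Z (extChartAt (𝓡 3) x x))
        (vecRep x S.Z (extChartAt (𝓡 3) x x))
      + 2 * twoMap x S.g.inner (extChartAt (𝓡 3) x x)
        (fderiv ℝ (vecRep x S.Z) (extChartAt (𝓡 3) x x) u)
        (vecRep x S.Z (extChartAt (𝓡 3) x x)) = 0 := by
  have ho := isOpen_extChartAt_target (I := 𝓡 3) x
  have hx := mem_extChartAt_target (I := 𝓡 3) x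
  have hz := differentiableAt_of_mem ho (S.smooth_vecRep_Z x) hx
  have h := fderiv_const_of_eqOn ho (fun y hy => S.twoMap_unit x hy) hx u
  rw [fderiv_apply₂ (differentiableAt_of_mem ho (S.smooth_twoMap_g x) hx) hz hz] at h
  have hs : ∀ u v, twoMap x S.g.inner (extChartAt (𝓡 3) x x) u v
      = twoMap x S.g.inner (extChartAt (𝓡 3) x x) v u := fun u v => by
    rw [S.twoMap_self, S.twoMap_self]; exact S.g.symm x u v
  rw [hs (vecRep x S.Z (extChartAt (𝓡 3) x x))] at h
  linarith

lemma twoMap_endMap_center (u w : EuclideanSpace ℝ (Fin 3)) :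
    twoMap x S.g.inner (extChartAt (𝓡 3) x x) (endMap x S.I (extChartAt (𝓡 3) x x) u) w =
      twoMap x S.g.inner (extChartAt (𝓡 3) x x)
        (fderiv ℝ (vecRep x S.Z) (extChartAt (𝓡 3) x x) u) w
      + koszulMap (twoMap x S.g.inner) (extChartAt (𝓡 3) x x) u
        (vecRep x S.Z (extChartAt (𝓡 3) x x)) w := by
  have h := S.I_eq x u
  rw [endRep_eq] at h
  simp only at h
  rw [h, map_add, add_apply, S.christoffel_spec]

/-- `Z` is geodesic: by the Killing equation `g(∇_Z Z, w) = -g(∇_w Z, Z)`, and this vanishes because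
`Z` has unit length. -/
lemma endMap_Z_center : endMap x S.I (extChartAt (𝓡 3) x x)
    (vecRep x S.Z (extChartAt (𝓡 3) x x)) = 0 := by
  have ho := isOpen_extChartAt_target (I := 𝓡 3) x
  have hx := mem_extChartAt_target (I := 𝓡 3) x
  have key : ∀ w, twoMap x S.g.inner (extChartAt (𝓡 3) x x)
      (endMap x S.I (extChartAt (𝓡 3) x x) (vecRep x S.Z (extChartAt (𝓡 3) x x))) w = 0 := by
    intro w
    have hk := S.killing x (vecRep x S.Z (extChartAt (𝓡 3) x x)) w
    rw [twoRep_eq, lieTwo_eq (differentiableAt_of_mem ho (S.smooth_twoMap_g x) hx)] at hk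
    have hu := S.deriv_unit x w
    have hs : ∀ u v, twoMap x S.g.inner (extChartAt (𝓡 3) x x) u v
      = twoMap x S.g.inner (extChartAt (𝓡 3) x x) v u := fun u v => by
      rw [S.twoMap_self, S.twoMap_self]; exact S.g.symm x u v
    rw [hs (fderiv ℝ (vecRep x S.Z) (extChartAt (𝓡 3) x x) w)] at hu
    rw [S.twoMap_endMap_center, koszulMap_apply]
    linarith
  have h := key (endMap x S.I (extChartAt (𝓡 3) x x) (vecRep x S.Z (extChartAt (𝓡 3) x x)))
  rw [S.twoMap_self] at h
  exact S.eq_zero_of_inner x _ h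

lemma I_Z : S.I x (S.Z x) = 0 := by
  have h := S.endMap_Z_center x
  rw [vecRep_extChartAt (mem_extChartAt_source x), endMap_toCoord (mem_extChartAt_source x),
    toCoord_self] at h
  exact h

lemma twoMap_endMap_Z_center (u : EuclideanSpace ℝ (Fin 3)) :
    twoMap x S.g.inner (extChartAt (𝓡 3) x x) (endMap x S.I (extChartAt (𝓡 3) x x) u)
      (vecRep x S.Z (extChartAt (𝓡 3) x x)) = 0 := by
  have h := S.twoMap_endMap_center x u (vecRep x S.Z (extChartAt (𝓡 3) x x))
  have hu := S.deriv_unit x u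
  rw [koszulMap_apply] at h
  have hs := fderiv_symm_of_symm (isOpen_extChartAt_target (I := 𝓡 3) x) (S.smooth_twoMap_g x)
    (fun y hy u v => S.g.symm _ _ _) (mem_extChartAt_target (I := 𝓡 3) x)
      (vecRep x S.Z (extChartAt (𝓡 3) x x)) u (vecRep x S.Z (extChartAt (𝓡 3) x x))
  linarith

lemma inner_I_Z (u : TangentSpace (𝓡 3) x) : S.g.inner x (S.I x u) (S.Z x) = 0 := by
  rw [← twoMap_toCoord (mem_extChartAt_source x), ← endMap_toCoord (mem_extChartAt_source x),
    ← vecRep_extChartAt (mem_extChartAt_source x)]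
  exact S.twoMap_endMap_Z_center x _

/-- Differentiating `I Z = 0` gives `(∇_u I) Z = -I(∇_u Z) = -I² u`, and the Sasakian equation
evaluates the left side. This is the source of `J² = -1` on the cylinder. -/
lemma endMap_endMap_center (u : EuclideanSpace ℝ (Fin 3)) :
    endMap x S.I (extChartAt (𝓡 3) x x) (endMap x S.I (extChartAt (𝓡 3) x x) u)
      = -u + twoMap x S.g.inner (extChartAt (𝓡 3) x x) u (vecRep x S.Z (extChartAt (𝓡 3) x x))
        • vecRep x S.Z (extChartAt (𝓡 3) x x) := by
  have ho := isOpen_extChartAt_target (I := 𝓡 3) x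
  have hx := mem_extChartAt_target (I := 𝓡 3) x
  have h0 : ∀ y ∈ (extChartAt (𝓡 3) x).target, endMap x S.I y (vecRep x S.Z y) = 0 := by
    intro y hy
    rw [endMap_vecRep hy, S.I_Z]
    exact map_zero (toCoordL (𝓡 3) x ((extChartAt (𝓡 3) x).symm y))
  have hI := differentiableAt_of_mem ho (S.smooth_endMap_I x) hx
  have hd := fderiv_const_of_eqOn ho h0 hx u
  rw [fderiv_apply_field hI
    (differentiableAt_of_mem ho (S.smooth_vecRep_Z x) hx)] at hd
  have hn := S.nabla_I x u (vecRep x S.Z (extChartAt (𝓡 3) x x))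
  have hI' := S.I_eq x u
  rw [endRep_eq] at hn hI'
  simp only at hn hI'
  rw [fderiv_apply_const hI, S.endMap_Z_center] at hn
  -- Not automatic, since the Christoffel symbol is chosen as a representing vector; positivity of
  -- `g` forces it to vanish.
  have hΓ : christoffel (twoRep x S.g.inner) (extChartAt (𝓡 3) x x) u 0 = 0 := by
    have h := S.christoffel_spec x u 0
      (christoffel (twoRep x S.g.inner) (extChartAt (𝓡 3) x x) u 0)
    rw [map_zero, zero_apply, S.twoMap_self] at h
    exact S.eq_zero_of_inner x _ h
  rw [hΓ, add_zero, twoRep_eq] at hn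
  simp only at hn
  rw [S.twoMap_unit x hx, one_smul] at hn
  rw [twoRep_eq] at hI'
  rw [hI', map_add, eq_neg_of_add_eq_zero_right hd, ← sub_eq_neg_add, ← neg_sub, hn]
  abel

lemma I_I (u : TangentSpace (𝓡 3) x) :
    S.I x (S.I x u) = -u + S.g.inner x u (S.Z x) • S.Z x := by
  have h := S.endMap_endMap_center x (toCoord (𝓡 3) x x u)
  rw [vecRep_extChartAt (mem_extChartAt_source x), endMap_toCoord (mem_extChartAt_source x),
    endMap_toCoord (mem_extChartAt_source x), twoMap_toCoord (mem_extChartAt_source x),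
    toCoord_self, toCoord_self, toCoord_self] at h
  exact h

end Center

end Sasakian

/-! ### Product charts of the cylinder -/

section CylinderCharts

variable {N : Type*} [TopologicalSpace N] [ChartedSpace (EuclideanSpace ℝ (Fin 3)) N]

lemma extChartAt_cyl (c : N × ℝ) :
    extChartAt cylModel c = (extChartAt (𝓡 3) c.1).prod (PartialEquiv.refl ℝ) := by
  rw [extChartAt_prod, extChartAt_model_space_eq_id]

lemma extChartAt_cyl_symm (c : N × ℝ) (y : EuclideanSpace ℝ (Fin 3) × ℝ) :
    (extChartAt cylModel c).symm y = ((extChartAt (𝓡 3) c.1).symm y.1, y.2) := by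
  rw [extChartAt_cyl]; rfl

lemma mem_target_cyl {c : N × ℝ} {y : EuclideanSpace ℝ (Fin 3) × ℝ} :
    y ∈ (extChartAt cylModel c).target ↔ y.1 ∈ (extChartAt (𝓡 3) c.1).target := by
  rw [extChartAt_cyl]; simp

variable [IsManifold (𝓡 3) ∞ N]

lemma toCoord_cyl {c p : N × ℝ} (hp : p.1 ∈ (extChartAt (𝓡 3) c.1).source)
    (X : TangentSpace (𝓡 3) p.1 × ℝ) :
    toCoord cylModel c p X = (toCoord (𝓡 3) c.1 p.1 X.1, X.2) := by
  have h1 : (extChartAt cylModel c : N × ℝ → _) =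
      Prod.map (extChartAt (𝓡 3) c.1) (id : ℝ → ℝ) := by
    rw [extChartAt_cyl]; rfl
  have hp' : p.1 ∈ (chartAt (EuclideanSpace ℝ (Fin 3)) c.1).source := by
    rwa [← extChartAt_source (I := 𝓡 3)]
  have h2 := mfderiv_prodMap (I := 𝓡 3) (I' := 𝓘(ℝ, ℝ)) (J := 𝓘(ℝ, EuclideanSpace ℝ (Fin 3)))
    (J' := 𝓘(ℝ, ℝ)) (p := p) (f := extChartAt (𝓡 3) c.1) (g := (id : ℝ → ℝ))
    (mdifferentiableAt_extChartAt hp') mdifferentiableAt_id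
  rw [mfderiv_id] at h2
  have h3 : mfderiv cylModel 𝓘(ℝ, EuclideanSpace ℝ (Fin 3) × ℝ) (extChartAt cylModel c) p
      = mfderiv cylModel (𝓘(ℝ, EuclideanSpace ℝ (Fin 3)).prod 𝓘(ℝ, ℝ))
        (Prod.map (extChartAt (𝓡 3) c.1) (id : ℝ → ℝ)) p := by
    rw [h1, modelWithCornersSelf_prod, ← chartedSpaceSelf_prod]
  exact DFunLike.congr_fun (h3.trans h2) X

lemma ofCoord_cyl {c : N × ℝ} {y : EuclideanSpace ℝ (Fin 3) × ℝ}
    (hy : y ∈ (extChartAt cylModel c).target) (u : EuclideanSpace ℝ (Fin 3) × ℝ) :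
    (ofCoord cylModel c y u : EuclideanSpace ℝ (Fin 3) × ℝ) =
      (ofCoord (𝓡 3) c.1 y.1 u.1, u.2) := by
  have hy1 := mem_target_cyl.1 hy
  have hs := extChartAt_cyl_symm c y
  have hp := (extChartAt (𝓡 3) c.1).map_target hy1
  have h := toCoord_cyl (c := c) (p := ((extChartAt (𝓡 3) c.1).symm y.1, y.2)) hp
    (ofCoord (𝓡 3) c.1 y.1 u.1, u.2)
  rw [toCoord_ofCoord hy1] at h
  have h2 := ofCoord_toCoord hy (ofCoord (𝓡 3) c.1 y.1 u.1, u.2)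
  exact (congrArg (ofCoord cylModel c y) h).symm.trans h2
end CylinderCharts

/-! ### `Z`, `W` and `J` on the cylinder in coordinates -/

namespace Sasakian

variable {N : Type*} [TopologicalSpace N] [ChartedSpace (EuclideanSpace ℝ (Fin 3)) N]
  [IsManifold (𝓡 3) ∞ N] (S : Sasakian N)

lemma vecRep_cylZ {c : N × ℝ} {y : EuclideanSpace ℝ (Fin 3) × ℝ}
    (hy : y ∈ (extChartAt cylModel c).target) :
    vecRep c S.cylZ y = (vecRep c.1 S.Z y.1, (0 : ℝ)) := by
  have hy1 := mem_target_cyl.1 hy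
  have hp := (extChartAt (𝓡 3) c.1).map_target hy1
  rw [vecRep, extChartAt_cyl_symm]
  exact toCoord_cyl hp _

lemma vecRep_cylW {c : N × ℝ} {y : EuclideanSpace ℝ (Fin 3) × ℝ}
    (hy : y ∈ (extChartAt cylModel c).target) :
    vecRep c S.cylW y = (0, (1 : ℝ)) := by
  have hy1 := mem_target_cyl.1 hy
  have hp := (extChartAt (𝓡 3) c.1).map_target hy1
  rw [vecRep, extChartAt_cyl_symm]
  refine (toCoord_cyl hp _).trans ?_
  exact congrArg₂ Prod.mk (map_zero (toCoordL (𝓡 3) c.1 _)) rfl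

lemma cylJ_apply (p : N × ℝ) (X : TangentSpace (𝓡 3) p.1) (r : ℝ) :
    S.cylJ p ((X, r) : TangentSpace (𝓡 3) p.1 × ℝ) =
      ((S.I p.1 (X - S.g.inner p.1 (S.Z p.1) X • S.Z p.1) - r • S.Z p.1,
        S.g.inner p.1 (S.Z p.1) X) : TangentSpace (𝓡 3) p.1 × ℝ) := rfl

lemma cylJ_eq (p : N × ℝ) (X : TangentSpace (𝓡 3) p.1) (r : ℝ) :
    S.cylJ p ((X, r) : TangentSpace (𝓡 3) p.1 × ℝ) =
      ((S.I p.1 X - r • S.Z p.1, S.g.inner p.1 (S.Z p.1) X) :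
        TangentSpace (𝓡 3) p.1 × ℝ) := by
  rw [cylJ_apply, map_sub, map_smul, S.I_Z, smul_zero, sub_zero]

lemma cylJ_Z (p : N × ℝ) : S.cylJ p (S.cylZ p) = S.cylW p := by
  have h := S.cylJ_eq p (S.Z p.1) 0
  rw [S.I_Z, S.unit, zero_smul, sub_zero] at h
  exact h

lemma cylJ_J (p : N × ℝ) (X : TangentSpace cylModel p) : S.cylJ p (S.cylJ p X) = -X := by
  obtain ⟨X, r⟩ : TangentSpace (𝓡 3) p.1 × ℝ := X
  have h := S.cylJ_eq p (S.I p.1 X - r • S.Z p.1) (S.g.inner p.1 (S.Z p.1) X)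
  rw [map_sub, map_sub, map_smul, map_smul, S.I_Z, S.I_I, S.unit,
    S.g.symm p.1 (S.Z p.1) (S.I p.1 X), S.inner_I_Z, S.g.symm p.1 X (S.Z p.1)] at h
  refine (congrArg (S.cylJ p) (S.cylJ_eq p X r)).trans (h.trans ?_)
  have e : ((-X + S.g.inner p.1 (S.Z p.1) X • S.Z p.1 - r • (0 : TangentSpace (𝓡 3) p.1)
      - S.g.inner p.1 (S.Z p.1) X • S.Z p.1, 0 - r • (1 : ℝ)) : TangentSpace (𝓡 3) p.1 × ℝ)
      = -(X, r) := by ext1 <;> simp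
  exact e

/-- Since `I Z = 0`, the projection along `Z` in the definition of `J` drops out; smoothness of `J`
is read off from this expression. -/
lemma endMap_cylJ {c : N × ℝ} {y : EuclideanSpace ℝ (Fin 3) × ℝ}
    (hy : y ∈ (extChartAt cylModel c).target) (u : EuclideanSpace ℝ (Fin 3) × ℝ) :
    endMap c S.cylJ y u =
      (endMap c.1 S.I y.1 u.1 - u.2 • vecRep c.1 S.Z y.1,
        twoMap c.1 S.g.inner y.1 (vecRep c.1 S.Z y.1) u.1) := by
  have hy1 := mem_target_cyl.1 hy
  have hp := (extChartAt (𝓡 3) c.1).map_target hy1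
  have hu := ofCoord_cyl hy u
  have hJ := S.cylJ_eq ((extChartAt (𝓡 3) c.1).symm y.1, y.2) (ofCoord (𝓡 3) c.1 y.1 u.1) u.2
  have h1 := toCoord_cyl (c := c) (p := ((extChartAt (𝓡 3) c.1).symm y.1, y.2)) hp
    (S.I _ (ofCoord (𝓡 3) c.1 y.1 u.1) - u.2 • S.Z _,
      S.g.inner _ (S.Z _) (ofCoord (𝓡 3) c.1 y.1 u.1))
  have h2 : endMap c S.cylJ y u = toCoord cylModel c ((extChartAt (𝓡 3) c.1).symm y.1, y.2)
      (S.cylJ ((extChartAt (𝓡 3) c.1).symm y.1, y.2)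
        ((ofCoord (𝓡 3) c.1 y.1 u.1, u.2) : TangentSpace (𝓡 3) _ × ℝ)) :=
    congrArg (fun X => toCoord cylModel c ((extChartAt (𝓡 3) c.1).symm y.1, y.2)
      (S.cylJ ((extChartAt (𝓡 3) c.1).symm y.1, y.2) X)) hu
  have h3 : toCoordL (𝓡 3) c.1 _ (S.I ((extChartAt (𝓡 3) c.1).symm y.1)
      (ofCoord (𝓡 3) c.1 y.1 u.1) - u.2 • S.Z ((extChartAt (𝓡 3) c.1).symm y.1)) =
      endMap c.1 S.I y.1 u.1 - u.2 • vecRep c.1 S.Z y.1 :=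
    (map_sub (toCoordL (𝓡 3) c.1 _) _ _).trans
      (congrArg _ (map_smul (toCoordL (𝓡 3) c.1 _) u.2 _))
  refine h2.trans ((congrArg _ hJ).trans (h1.trans (congrArg₂ Prod.mk h3 ?_)))
  exact congrArg (fun X => S.g.inner _ X (ofCoord (𝓡 3) c.1 y.1 u.1))
    (ofCoord_toCoord hy1 (S.Z _)).symm

lemma chartSmooth_cylZ : ChartSmoothVec (I := cylModel) S.cylZ := by
  intro c
  refine ContDiffOn.congr ?_ fun y hy => S.vecRep_cylZ hy
  exact ((S.smooth_vecRep_Z c.1).comp contDiff_fst.contDiffOn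
    fun y hy => mem_target_cyl.1 hy).prodMk contDiffOn_const

lemma chartSmooth_cylW : ChartSmoothVec (I := cylModel) S.cylW := by
  intro c
  exact contDiffOn_const.congr fun y hy => S.vecRep_cylW hy

lemma smooth_endMap_cylJ (c : N × ℝ) :
    ContDiffOn ℝ ∞ (endMap c S.cylJ) (extChartAt cylModel c).target := by
  rw [contDiffOn_clm_apply]
  intro u
  refine ContDiffOn.congr ?_ fun y hy => S.endMap_cylJ hy u
  have hm : MapsTo Prod.fst (extChartAt cylModel c).target (extChartAt (𝓡 3) c.1).target :=
    fun y hy => mem_target_cyl.1 hy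
  have hZ := (S.smooth_vecRep_Z c.1).comp contDiff_fst.contDiffOn hm
  have hI := (S.smooth_endMap_I c.1).comp contDiff_fst.contDiffOn hm
  have hg := (S.smooth_twoMap_g c.1).comp contDiff_fst.contDiffOn hm
  have hu1 : ContDiffOn ℝ ∞ (fun _ : EuclideanSpace ℝ (Fin 3) × ℝ => u.1)
    (extChartAt cylModel c).target := contDiffOn_const
  exact ((hI.clm_apply hu1).sub (hZ.const_smul u.2)).prodMk ((hg.clm_apply hZ).clm_apply hu1)

end Sasakian

lemma IsConnection.congr {E : Type*} [NormedAddCommGroup E] [NormedSpace ℝ E] {U : Set E}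
    {J : E → E →L[ℝ] E} {Z W : E → E} {a b a' b' : E → E →L[ℝ] ℝ} (C : IsConnection U J Z W a b)
    (hU : IsOpen U) (ha : ∀ y ∈ U, a' y = a y) (hb : ∀ y ∈ U, b' y = b y) :
    IsConnection U J Z W a' b' := by
  refine ⟨C.smooth_a.congr ha, C.smooth_b.congr hb, ?_, ?_, ?_, ?_, ?_, ?_, ?_, ?_, ?_, ?_⟩ <;>
    intro y hy
  · rw [ha y hy, C.a_Z y hy]
  · rw [ha y hy, C.a_W y hy]
  · rw [hb y hy, C.b_Z y hy]
  · rw [hb y hy, C.b_W y hy]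
  · rw [ha y hy, hb y hy]; exact C.a_J y hy
  · rw [ha y hy, hb y hy]; exact C.b_J y hy
  · rw [fderiv_eq_of_eqOn hU ha hy]; exact C.curv_a_Z y hy
  · rw [fderiv_eq_of_eqOn hU ha hy]; exact C.curv_a_W y hy
  · rw [fderiv_eq_of_eqOn hU hb hy]; exact C.curv_b_Z y hy
  · rw [fderiv_eq_of_eqOn hU hb hy]; exact C.curv_b_W y hy

lemma finrank_cylinder : Module.finrank ℝ (EuclideanSpace ℝ (Fin 3) × ℝ) = 4 := by simp

/-! ### From the geometric hypotheses to their chart form -/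

namespace Sasakian

variable {N : Type*} [TopologicalSpace N] [ChartedSpace (EuclideanSpace ℝ (Fin 3)) N]
  [IsManifold (𝓡 3) ∞ N] {S : Sasakian N}

lemma endMap_cylJ_vecRep_Z {c : N × ℝ} {y : EuclideanSpace ℝ (Fin 3) × ℝ}
    (hy : y ∈ (extChartAt cylModel c).target) :
    endMap c S.cylJ y (vecRep c S.cylZ y) = vecRep c S.cylW y := by
  rw [endMap_vecRep hy, S.cylJ_Z, vecRep]

lemma endMap_cylJ_endMap {c : N × ℝ} {y : EuclideanSpace ℝ (Fin 3) × ℝ}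
    (hy : y ∈ (extChartAt cylModel c).target) (v : EuclideanSpace ℝ (Fin 3) × ℝ) :
    endMap c S.cylJ y (endMap c S.cylJ y v) = -v := by
  have h1 := endMap_eq hy S.cylJ v
  have h2 := S.cylJ_J _ (ofCoord cylModel c y v)
  calc endMap c S.cylJ y (endMap c S.cylJ y v)
      = toCoord cylModel c _ (S.cylJ _ (ofCoord cylModel c y (endMap c S.cylJ y v))) := rfl
    _ = toCoord cylModel c _ (-ofCoord cylModel c y v) := by rw [h1, h2]
    _ = -toCoord cylModel c _ (ofCoord cylModel c y v) :=
        map_neg (toCoordL cylModel c _) _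
    _ = -v := by rw [toCoord_ofCoord hy]

lemma IsInvariantTransverseMetric.isTransverse {gT : TwoTensor cylModel (N × ℝ)}
    (h : S.IsInvariantTransverseMetric gT) (hG : ChartSmoothTwo gT) (c : N × ℝ) :
    IsTransverse (extChartAt cylModel c).target (endMap c S.cylJ) (vecRep c S.cylZ)
      (vecRep c S.cylW) (twoMap c gT) where
  isOpen := isOpen_extChartAt_target c
  smooth_J := S.smooth_endMap_cylJ c
  smooth_G := hG c
  J_Z y hy := endMap_cylJ_vecRep_Z hy
  J_J y hy v := endMap_cylJ_endMap hy v
  symm y hy u v := h.symm _ _ _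
  herm y hy u v := by
    have h1 := endMap_eq hy S.cylJ u
    have h2 := endMap_eq hy S.cylJ v
    calc _ = gT _ (ofCoord cylModel c y (endMap c S.cylJ y u))
          (ofCoord cylModel c y (endMap c S.cylJ y v)) := rfl
      _ = _ := by rw [h1, h2, h.hermitian]; rfl
  pos y hy v hv := by
    refine h.pos _ (ofCoord cylModel c y v) fun p q hpq => hv p q ?_
    set L := toCoordL cylModel c ((extChartAt cylModel c).symm y)
    have h1 : ∀ X Y : EuclideanSpace ℝ (Fin 3) × ℝ, L (p • X + q • Y) = p • L X + q • L Y :=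
      fun X Y => by simp
    exact (toCoord_ofCoord hy v).symm.trans ((congrArg L hpq).trans (h1 _ _))
  vert_Z := ⟨S.chartSmooth_cylZ c, fun y hy v => by rw [twoMap_vecRep hy, h.ker_Z],
    fun y hy u v => lie_of_invariantTwo hy hG S.chartSmooth_cylZ h.lie_Z u v⟩
  vert_W := ⟨S.chartSmooth_cylW c, fun y hy v => by rw [twoMap_vecRep hy, h.ker_W],
    fun y hy u v => lie_of_invariantTwo hy hG S.chartSmooth_cylW h.lie_W u v⟩

lemma IsHermitianConnection.isConnection {μZ μW : OneForm cylModel (N × ℝ)}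
    (h : S.IsHermitianConnection μZ μW) (c : N × ℝ) :
    IsConnection (extChartAt cylModel c).target (endMap c S.cylJ) (vecRep c S.cylZ)
      (vecRep c S.cylW) (oneMap c μZ) (oneMap c μW) where
  smooth_a := contDiffOn_oneMap h.smooth_Z c
  smooth_b := contDiffOn_oneMap h.smooth_W c
  a_Z y hy := by rw [oneMap_vecRep hy, h.Z_Z]
  a_W y hy := by rw [oneMap_vecRep hy, h.Z_W]
  b_Z y hy := by rw [oneMap_vecRep hy, h.W_Z]
  b_W y hy := by rw [oneMap_vecRep hy, h.W_W]
  a_J y hy v := (congrArg (μZ _) (endMap_eq hy S.cylJ v)).trans (h.Z_J _ _)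
  b_J y hy v := (congrArg (μW _) (endMap_eq hy S.cylJ v)).trans (h.W_J _ _)
  curv_a_Z y hy v := curv_of_invariantOne hy (contDiffOn_oneMap h.smooth_Z) S.chartSmooth_cylZ
    h.lie_Z_Z h.Z_Z v
  curv_a_W y hy v := curv_of_invariantOne hy (contDiffOn_oneMap h.smooth_Z) S.chartSmooth_cylW
    h.lie_W_Z h.Z_W v
  curv_b_Z y hy v := curv_of_invariantOne hy (contDiffOn_oneMap h.smooth_W) S.chartSmooth_cylZ
    h.lie_Z_W h.W_Z v
  curv_b_W y hy v := curv_of_invariantOne hy (contDiffOn_oneMap h.smooth_W) S.chartSmooth_cylW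
    h.lie_W_W h.W_W v

lemma InvariantFun.isBasicFun {f : N × ℝ → ℝ} (h : S.InvariantFun f)
    (hf : ContMDiff cylModel 𝓘(ℝ, ℝ) ∞ f) (c : N × ℝ) :
    IsBasicFun (extChartAt cylModel c).target (vecRep c S.cylZ) (vecRep c S.cylW)
      (fun y => f ((extChartAt cylModel c).symm y)) where
  smooth := contDiffOn_chart hf c
  fderiv_Z y hy := by
    rw [← oneMap_dFun hf hy, oneMap_vecRep hy]
    exact (h _).1
  fderiv_W y hy := by
    rw [← oneMap_dFun hf hy, oneMap_vecRep hy]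
    exact (h _).2

lemma oneMap_twistZ (μZ : OneForm cylModel (N × ℝ)) {f₁ f₂ : N × ℝ → ℝ}
    (h₁ : ContMDiff cylModel 𝓘(ℝ, ℝ) ∞ f₁) (h₂ : ContMDiff cylModel 𝓘(ℝ, ℝ) ∞ f₂) {c : N × ℝ}
    {y : EuclideanSpace ℝ (Fin 3) × ℝ} (hy : y ∈ (extChartAt cylModel c).target) :
    oneMap c (S.twistZ μZ f₁ f₂) y = oneMap c μZ y
      + dcMap (endMap c S.cylJ) (fun y => f₁ ((extChartAt cylModel c).symm y)) y
      + fderiv ℝ (fun y => f₂ ((extChartAt cylModel c).symm y)) y := by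
  rw [← oneMap_dFun h₂ hy, ← oneMap_dcFun h₁ S.cylJ hy]
  rfl

lemma oneMap_twistW (μW : OneForm cylModel (N × ℝ)) {f₁ f₂ : N × ℝ → ℝ}
    (h₁ : ContMDiff cylModel 𝓘(ℝ, ℝ) ∞ f₁) (h₂ : ContMDiff cylModel 𝓘(ℝ, ℝ) ∞ f₂) {c : N × ℝ}
    {y : EuclideanSpace ℝ (Fin 3) × ℝ} (hy : y ∈ (extChartAt cylModel c).target) :
    oneMap c (S.twistW μW f₁ f₂) y = oneMap c μW y
      + dcMap (endMap c S.cylJ) (fun y => f₂ ((extChartAt cylModel c).symm y)) y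
      - fderiv ℝ (fun y => f₁ ((extChartAt cylModel c).symm y)) y := by
  rw [← oneMap_dFun h₁ hy, ← oneMap_dcFun h₂ S.cylJ hy]
  rfl

end Sasakian

/-! ### Interchanging space and time derivatives -/

section TimeDerivative

variable {E : Type*} [NormedAddCommGroup E] [NormedSpace ℝ E]

/-- A nontrivial interval is convex with nonempty interior. Both conclusions serve to include
endpoints: the first makes one-sided derivatives unique, the second makes mixed derivatives commute
there. -/
lemma uniqueDiffOn_of_ordConnected {𝒯 : Set ℝ} (h : 𝒯.OrdConnected) (h' : 𝒯.Nontrivial) :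
    UniqueDiffOn ℝ 𝒯 ∧ 𝒯 ⊆ closure (interior 𝒯) := by
  have hc : Convex ℝ 𝒯 := h.convex
  have hi : (interior 𝒯).Nonempty := by
    obtain ⟨a, ha, b, hb, hab⟩ := h'.exists_lt
    refine ⟨(a + b) / 2, interior_mono (h.out ha hb) ?_⟩
    rw [interior_Icc]
    constructor <;> linarith
  exact ⟨uniqueDiffOn_convex hc hi, by
    rw [hc.closure_interior_eq_closure_of_nonempty_interior hi]; exact subset_closure⟩

variable {U : Set E} {𝒯 : Set ℝ} (hU : IsOpen U) (h𝒯 : UniqueDiffOn ℝ 𝒯)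
  {F : E × ℝ → ℝ} (hF : ContDiffOn ℝ ∞ F (U ×ˢ 𝒯))
include hU h𝒯 hF

lemma contDiffOn_fderivWithin_prod :
    ContDiffOn ℝ ∞ (fderivWithin ℝ F (U ×ˢ 𝒯)) (U ×ˢ 𝒯) :=
  hF.fderivWithin (hU.uniqueDiffOn.prod h𝒯) (by simp)

/-- The spatial derivative of a function on `U × 𝒯`. -/
lemma fderiv_slice {y : E} (hy : y ∈ U) {t : ℝ} (ht : t ∈ 𝒯) :
    fderiv ℝ (fun z => F (z, t)) y =
      (fderivWithin ℝ F (U ×ˢ 𝒯) (y, t)).comp (ContinuousLinearMap.inl ℝ E ℝ) := by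
  have h1 : HasFDerivWithinAt F (fderivWithin ℝ F (U ×ˢ 𝒯) (y, t)) (U ×ˢ 𝒯) (y, t) :=
    ((hF (y, t) ⟨hy, ht⟩).differentiableWithinAt (by simp)).hasFDerivWithinAt
  have h2 : HasFDerivWithinAt (fun z : E => (z, t)) (ContinuousLinearMap.inl ℝ E ℝ) U y :=
    (hasFDerivAt_prodMk_left y t).hasFDerivWithinAt
  have hm : MapsTo (fun z : E => (z, t)) U (U ×ˢ 𝒯) := fun z hz => ⟨hz, ht⟩
  have h3 := h1.comp y h2 hm
  exact (h3.hasFDerivAt (hU.mem_nhds hy)).fderiv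

lemma contDiffOn_fderiv_slice :
    ContDiffOn ℝ ∞ (fun q : E × ℝ => fderiv ℝ (fun z => F (z, q.2)) q.1) (U ×ˢ 𝒯) := by
  refine ContDiffOn.congr ?_ fun q hq => fderiv_slice hU h𝒯 hF hq.1 hq.2
  exact (contDiffOn_fderivWithin_prod hU h𝒯 hF).clm_comp contDiffOn_const

lemma derivWithin_slice {y : E} (hy : y ∈ U) {t : ℝ} (ht : t ∈ 𝒯) {d : ℝ}
    (hd : HasDerivWithinAt (fun s => F (y, s)) d 𝒯 t) :
    d = fderivWithin ℝ F (U ×ˢ 𝒯) (y, t) (0, 1) := by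
  have h1 : HasFDerivWithinAt F (fderivWithin ℝ F (U ×ˢ 𝒯) (y, t)) (U ×ˢ 𝒯) (y, t) :=
    ((hF (y, t) ⟨hy, ht⟩).differentiableWithinAt (by simp)).hasFDerivWithinAt
  have h2 : HasDerivWithinAt (fun s : ℝ => (y, s)) ((0 : E), (1 : ℝ)) 𝒯 t :=
    (hasDerivWithinAt_const t 𝒯 y).prodMk (hasDerivWithinAt_id t 𝒯)
  have h3 := h1.comp_hasDerivWithinAt t h2 (fun s hs => ⟨hy, hs⟩)
  exact (h𝒯 t ht).eq_deriv _ hd h3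

/-- Spatial and time derivatives commute. -/
lemma hasDerivWithinAt_fderiv_slice (hcl : 𝒯 ⊆ closure (interior 𝒯)) {φ : E → ℝ} {t : ℝ}
    (ht : t ∈ 𝒯) (hφ : ∀ y ∈ U, HasDerivWithinAt (fun s => F (y, s)) (φ y) 𝒯 t) {y : E}
    (hy : y ∈ U) (u : E) :
    HasDerivWithinAt (fun s => fderiv ℝ (fun z => F (z, s)) y u) (fderiv ℝ φ y u) 𝒯 t := by
  have hS := hU.uniqueDiffOn.prod h𝒯
  have hq : (y, t) ∈ U ×ˢ 𝒯 := ⟨hy, ht⟩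
  set D := fderivWithin ℝ F (U ×ˢ 𝒯) with hD
  have h1 : HasFDerivWithinAt D (fderivWithin ℝ D (U ×ˢ 𝒯) (y, t)) (U ×ˢ 𝒯) (y, t) :=
    ((contDiffOn_fderivWithin_prod hU h𝒯 hF (y, t) hq).differentiableWithinAt
      (by simp)).hasFDerivWithinAt
  have h2 : HasDerivWithinAt (fun s : ℝ => (y, s)) ((0 : E), (1 : ℝ)) 𝒯 t :=
    (hasDerivWithinAt_const t 𝒯 y).prodMk (hasDerivWithinAt_id t 𝒯)
  have h3 : HasDerivWithinAt (fun s => D (y, s)) (fderivWithin ℝ D (U ×ˢ 𝒯) (y, t) (0, 1)) 𝒯 t :=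
    h1.comp_hasDerivWithinAt t h2 (fun s hs => ⟨hy, hs⟩)
  have h4 : HasFDerivWithinAt (fun z : E => (z, t)) (ContinuousLinearMap.inl ℝ E ℝ) U y :=
    (hasFDerivAt_prodMk_left y t).hasFDerivWithinAt
  have hm : MapsTo (fun z : E => (z, t)) U (U ×ˢ 𝒯) := fun z hz => ⟨hz, ht⟩
  have h5 : HasFDerivAt (fun z => D (z, t)) ((fderivWithin ℝ D (U ×ˢ 𝒯) (y, t)).comp
      (ContinuousLinearMap.inl ℝ E ℝ)) y :=
    (h1.comp y h4 hm).hasFDerivAt (hU.mem_nhds hy)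
  have hφD : fderiv ℝ φ y u = fderivWithin ℝ D (U ×ˢ 𝒯) (y, t) (u, 0) (0, 1) := by
    rw [fderiv_eq_of_eqOn hU (g := fun z => D (z, t) (0, 1))
      (fun z hz => derivWithin_slice hU h𝒯 hF hz ht (hφ z hz)) hy]
    exact DFunLike.congr_fun
      ((ContinuousLinearMap.apply ℝ ℝ ((0, 1) : E × ℝ)).hasFDerivAt.comp y h5).fderiv u
  -- Symmetry of the second derivative within a set holds at points of the closure of the interior,
  -- so `t` may be an endpoint.
  have hsymm : fderivWithin ℝ D (U ×ˢ 𝒯) (y, t) (u, 0) (0, 1)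
      = fderivWithin ℝ D (U ×ˢ 𝒯) (y, t) (0, 1) (u, 0) :=
    (hF (y, t) hq).isSymmSndFDerivWithinAt (by simpa using two_le_infty) hS
      (by rw [interior_prod_eq, closure_prod_eq, hU.interior_eq]
          exact ⟨subset_closure hy, hcl ht⟩) hq _ _
  rw [hφD, hsymm]
  have h6 := h3.clm_apply (hasDerivWithinAt_const t 𝒯 ((u, 0) : E × ℝ))
  simp only [map_zero, add_zero] at h6
  refine h6.congr (fun s hs => ?_) ?_
  · rw [fderiv_slice hU h𝒯 hF hy hs]; rfl
  · rw [fderiv_slice hU h𝒯 hF hy ht]; rfl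

end TimeDerivative

/-! ### Smoothness of families from their chart expressions -/

section SmoothFamily

variable {E : Type*} [NormedAddCommGroup E] [NormedSpace ℝ E] {H : Type*} [TopologicalSpace H]
  {I : ModelWithCorners ℝ E H} {M : Type*} [TopologicalSpace M] [ChartedSpace H M]
  [IsManifold I ∞ M]

/-- Trivialisations of the tangent bundle are chart derivatives, so hom-bundle coordinates are chart
coordinates. This gives the passage from smooth chart expressions back to smooth sections. -/
lemma inCoordinates_eq_twoMap {c p : M} (hp : p ∈ (extChartAt I c).source) (B : TwoTensor I M) :
    ContinuousLinearMap.inCoordinates E (TangentSpace I : M → Type _) (E →L[ℝ] ℝ)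
      (fun p : M => TangentSpace I p →L[ℝ] ℝ) c p c p (B p) = twoMap c B (extChartAt I c p) := by
  have hp' : p ∈ (chartAt H c).source := by rwa [extChartAt_source] at hp
  obtain ⟨y, hy, rfl⟩ : ∃ y ∈ (extChartAt I c).target, (extChartAt I c).symm y = p :=
    ⟨_, (extChartAt I c).map_source hp, (extChartAt I c).left_inv hp⟩
  ext u v
  have hs := TangentBundle.symmL_trivializationAt (I := I) hp'
  rw [(extChartAt I c).right_inv hy] at hs ⊢
  refine (inCoordinates_apply_eq₂ (𝕜 := ℝ) (F₁ := E)
    (E₁ := (TangentSpace I : M → Type _)) (F₂ := E) (E₂ := (TangentSpace I : M → Type _)) (F₃ := ℝ)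
    (E₃ := Bundle.Trivial M ℝ) (x₀ := c) (ϕ := B _) (v := u) (w := v) hp' hp' (mem_univ _)).trans ?_
  have hu : (trivializationAt E (TangentSpace I) c).symm ((extChartAt I c).symm y) u
      = ofCoord I c y u := (Bundle.Trivialization.symmL_apply (R := ℝ) _ hp' u).symm.trans (DFunLike.congr_fun hs u)
  have hv : (trivializationAt E (TangentSpace I) c).symm ((extChartAt I c).symm y) v
      = ofCoord I c y v := (Bundle.Trivialization.symmL_apply (R := ℝ) _ hp' v).symm.trans (DFunLike.congr_fun hs v)
  rw [hu, hv]
  simp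
  rfl

/-- A family of two-tensors is smooth if its chart expressions are. -/
lemma smoothTwoFamily_of_chart {𝒯 : Set ℝ} {B : ℝ → TwoTensor I M}
    (hB : ∀ c : M, ContDiffOn ℝ ∞ (fun q : E × ℝ => twoMap c (B q.2) q.1)
      ((extChartAt I c).target ×ˢ 𝒯)) : SmoothTwoFamily 𝒯 B := by
  rintro ⟨c, t⟩ ⟨-, ht⟩
  refine (contMDiffWithinAt_hom_bundle _).2 ⟨contMDiffWithinAt_fst, ?_⟩
  have hc := mem_extChartAt_source (I := I) c
  have hm : ContMDiffWithinAt (I.prod 𝓘(ℝ, ℝ)) 𝓘(ℝ, E × ℝ) ∞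
      (fun q : M × ℝ => (extChartAt I c q.1, q.2)) (univ ×ˢ 𝒯) (c, t) := by
    refine ContMDiffWithinAt.prodMk_space ?_ contMDiffWithinAt_snd
    exact ((contMDiffAt_extChartAt (I := I) (n := ∞) (x := c)).comp (c, t)
      contMDiffAt_fst).contMDiffWithinAt
  have ho : (extChartAt I c).source ×ˢ (univ : Set ℝ) ∈ 𝓝 (c, t) :=
    prod_mem_nhds (extChartAt_source_mem_nhds c) univ_mem
  have h := (((hB c).contMDiffOn (extChartAt I c c, t) ⟨mem_extChartAt_target c, ht⟩).comp_of_eq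
    (x := (c, t)) (hm.mono (prod_mono (subset_univ (extChartAt I c).source) (Subset.refl 𝒯)))
    (fun (q : M × ℝ) hq => (show (extChartAt I c q.1, q.2) ∈ (extChartAt I c).target ×ˢ 𝒯 from
      ⟨(extChartAt I c).map_source hq.1, hq.2⟩)) rfl)
  refine (h.congr (f₁ := _) (fun q hq => inCoordinates_eq_twoMap hq.1 (B q.2))
    (inCoordinates_eq_twoMap hc (B t))).mono_of_mem_nhdsWithin ?_
  refine mem_of_superset (inter_mem_nhdsWithin _ ho) ?_
  rintro q ⟨⟨-, h1⟩, h2, -⟩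
  exact ⟨h2, h1⟩

end SmoothFamily

lemma twoMap_bundleMetric {E : Type*} [NormedAddCommGroup E] [NormedSpace ℝ E] {H : Type*}
    [TopologicalSpace H] {I : ModelWithCorners ℝ E H} {M : Type*} [TopologicalSpace M]
    [ChartedSpace H M] (gT : TwoTensor I M) (μZ μW : OneForm I M) (c : M) (y : E) :
    twoMap c (bundleMetric gT μZ μW fun _ => 1) y =
      hermMap (twoMap c gT) (oneMap c μZ) (oneMap c μW) y := by
  ext u v
  calc _ = bundleMetric gT μZ μW (fun _ => 1) _ (ofCoord I c y u) (ofCoord I c y v) := rfl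
    _ = _ := by
      rw [hermMap_apply, bundleMetric]
      simp only [one_smul, add_apply, ContinuousLinearMap.smulRight_apply, smul_apply, smul_eq_mul]
      rfl

/-! ### Traces, pluriclosedness and `ρ_B^{1,1}` on the cylinder -/

namespace Sasakian

variable {N : Type*} [TopologicalSpace N] [ChartedSpace (EuclideanSpace ℝ (Fin 3)) N]
  [IsManifold (𝓡 3) ∞ N] (S : Sasakian N)

/-- `gT` is an invariant transverse metric in every chart. -/
def IsChartTransverse (gT : TwoTensor cylModel (N × ℝ)) : Prop :=
  ∀ c : N × ℝ, IsTransverse (extChartAt cylModel c).target (endMap c S.cylJ) (vecRep c S.cylZ)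
    (vecRep c S.cylW) (twoMap c gT)

/-- `(μZ, μW)` is a Hermitian connection form in every chart. -/
def IsChartConnection (μZ μW : OneForm cylModel (N × ℝ)) : Prop :=
  ∀ c : N × ℝ, IsConnection (extChartAt cylModel c).target (endMap c S.cylJ) (vecRep c S.cylZ)
    (vecRep c S.cylW) (oneMap c μZ) (oneMap c μW)

variable {S} {gT : TwoTensor cylModel (N × ℝ)} {μZ μW : OneForm cylModel (N × ℝ)}
  (T : S.IsChartTransverse gT) (C : S.IsChartConnection μZ μW)
include T C

/-- `trF` is computed at each point in the chart centred there. Naturality of `dα` expresses it in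
one fixed chart, which is what makes its differential accessible. -/
lemma trF_eq {α : OneForm cylModel (N × ℝ)} (hα : ChartSmoothOne α)
    (hZ : ∀ c : N × ℝ, ∀ y ∈ (extChartAt cylModel c).target, ∀ v,
      fderiv ℝ (oneMap c α) y v (vecRep c S.cylZ y) = fderiv ℝ (oneMap c α) y (vecRep c S.cylZ y) v)
    (hW : ∀ c : N × ℝ, ∀ y ∈ (extChartAt cylModel c).target, ∀ v,
      fderiv ℝ (oneMap c α) y v (vecRep c S.cylW y) = fderiv ℝ (oneMap c α) y (vecRep c S.cylW y) v)
    {c : N × ℝ} {y : EuclideanSpace ℝ (Fin 3) × ℝ} (hy : y ∈ (extChartAt cylModel c).target)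
    {e : EuclideanSpace ℝ (Fin 3) × ℝ} (he : twoMap c gT y e e = 1) :
    trF S.cylJ gT α ((extChartAt cylModel c).symm y) =
      fderiv ℝ (oneMap c α) y e (endMap c S.cylJ y e)
        - fderiv ℝ (oneMap c α) y (endMap c S.cylJ y e) e := by
  set p := (extChartAt cylModel c).symm y
  have hp : p ∈ (extChartAt cylModel p).source := mem_extChartAt_source p
  have hp' : extChartAt cylModel p p ∈ (extChartAt cylModel p).target := mem_extChartAt_target p
  rw [curv_transition hy hp hα, endMap_transition hy hp]
  rw [twoMap_transition hy hp] at he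
  exact traceCurv_eq (T p) (C p) finrank_cylinder hp'
    (differentiableAt_of_mem (isOpen_extChartAt_target p) (hα p) hp') (hZ p _ hp') (hW p _ hp') he

lemma trF_Z_eq {c : N × ℝ} {y : EuclideanSpace ℝ (Fin 3) × ℝ}
    (hy : y ∈ (extChartAt cylModel c).target)
    {e : EuclideanSpace ℝ (Fin 3) × ℝ} (he : twoMap c gT y e e = 1) :
    trF S.cylJ gT μZ ((extChartAt cylModel c).symm y) =
      fderiv ℝ (oneMap c μZ) y e (endMap c S.cylJ y e)
        - fderiv ℝ (oneMap c μZ) y (endMap c S.cylJ y e) e :=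
  trF_eq T C (fun c => (C c).smooth_a) (fun c => (C c).curv_a_Z) (fun c => (C c).curv_a_W) hy he

lemma trF_W_eq {c : N × ℝ} {y : EuclideanSpace ℝ (Fin 3) × ℝ}
    (hy : y ∈ (extChartAt cylModel c).target)
    {e : EuclideanSpace ℝ (Fin 3) × ℝ} (he : twoMap c gT y e e = 1) :
    trF S.cylJ gT μW ((extChartAt cylModel c).symm y) =
      fderiv ℝ (oneMap c μW) y e (endMap c S.cylJ y e)
        - fderiv ℝ (oneMap c μW) y (endMap c S.cylJ y e) e :=
  trF_eq T C (fun c => (C c).smooth_b) (fun c => (C c).curv_b_Z) (fun c => (C c).curv_b_W) hy he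

lemma normSqF_eq (p : N × ℝ) : normSqF gT μZ μW p =
    2 * trF S.cylJ gT μZ p ^ 2 + 2 * trF S.cylJ gT μW p ^ 2 := by
  have hp := mem_extChartAt_target (I := cylModel) p
  obtain ⟨e, he⟩ := (T p).exists_unit hp (C p) finrank_cylinder
  have ho := isOpen_extChartAt_target (I := cylModel) p
  have h1 := trF_Z_eq T C hp he
  have h2 := trF_W_eq T C hp he
  rw [extChartAt_to_inv] at h1 h2
  rw [h1, h2]
  exact congrArg₂ (· + ·)
    (normSqCurv_eq (T p) (C p) finrank_cylinder hp
      (differentiableAt_of_mem ho (C p).smooth_a hp) ((C p).curv_a_Z _ hp) ((C p).curv_a_W _ hp) he)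
    (normSqCurv_eq (T p) (C p) finrank_cylinder hp
      (differentiableAt_of_mem ho (C p).smooth_b hp) ((C p).curv_b_Z _ hp) ((C p).curv_b_W _ hp) he)

lemma bundleMetric_pos (p : N × ℝ) (X : TangentSpace cylModel p) (hX : X ≠ 0) :
    0 < bundleMetric gT μZ μW (fun _ => 1) p X X := by
  have hp := mem_extChartAt_target (I := cylModel) p
  rw [← twoMap_toCoord (mem_extChartAt_source p), twoMap_bundleMetric]
  refine hermMap_pos (T p) (C p) finrank_cylinder hp ?_
  rwa [toCoord_self]

lemma isPluriclosed_bundleMetric :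
    IsPluriclosed S.cylJ (bundleMetric gT μZ μW fun _ => 1) := by
  intro p v
  have h : twoRep p (bundleMetric gT μZ μW fun _ => 1) =
      fun y u v => hermMap (twoMap p gT) (oneMap p μZ) (oneMap p μW) y u v := by
    simp only [twoRep_eq, twoMap_bundleMetric]
  rw [h]
  exact dForm_dcKahler (T p) (C p) finrank_cylinder (mem_extChartAt_target p) v

/-- The transverse part of `ρ_B` is already `J`-invariant. Averaging `dφ ∧ a + dψ ∧ b` over `J`
exchanges `a` and `b` up to sign and produces the terms with `dφ ∘ J` and `dψ ∘ J`. -/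
lemma rhoB11_bundleMetric (p : N × ℝ) (X Y : TangentSpace cylModel p) :
    rhoB11 S.cylJ (bundleMetric gT μZ μW fun _ => 1) p X Y =
      gT p (S.cylJ p X) Y * (-(1 / 2) * (scalT gT p - normSqF gT μZ μW p))
      + (1 / 2) *
        (fderiv ℝ (fun y => trF S.cylJ gT μZ ((extChartAt cylModel p).symm y))
            (extChartAt cylModel p p) (toCoord cylModel p p X) * μZ p Y
          - fderiv ℝ (fun y => trF S.cylJ gT μZ ((extChartAt cylModel p).symm y))
            (extChartAt cylModel p p) (toCoord cylModel p p Y) * μZ p X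
          + fderiv ℝ (fun y => trF S.cylJ gT μW ((extChartAt cylModel p).symm y))
            (extChartAt cylModel p p) (toCoord cylModel p p X) * μW p Y
          - fderiv ℝ (fun y => trF S.cylJ gT μW ((extChartAt cylModel p).symm y))
            (extChartAt cylModel p p) (toCoord cylModel p p Y) * μW p X
          - fderiv ℝ (fun y => trF S.cylJ gT μZ ((extChartAt cylModel p).symm y))
            (extChartAt cylModel p p) (toCoord cylModel p p (S.cylJ p X)) * μW p Y
          + fderiv ℝ (fun y => trF S.cylJ gT μZ ((extChartAt cylModel p).symm y))
            (extChartAt cylModel p p) (toCoord cylModel p p (S.cylJ p Y)) * μW p X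
          + fderiv ℝ (fun y => trF S.cylJ gT μW ((extChartAt cylModel p).symm y))
            (extChartAt cylModel p p) (toCoord cylModel p p (S.cylJ p X)) * μZ p Y
          - fderiv ℝ (fun y => trF S.cylJ gT μW ((extChartAt cylModel p).symm y))
            (extChartAt cylModel p p) (toCoord cylModel p p (S.cylJ p Y)) * μZ p X) := by
  have hp := mem_extChartAt_target (I := cylModel) p
  have hs := mem_extChartAt_source (I := cylModel) p
  have h : twoRep p (bundleMetric gT μZ μW fun _ => 1) =
      fun y u v => hermMap (twoMap p gT) (oneMap p μZ) (oneMap p μW) y u v := by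
    simp only [twoRep_eq, twoMap_bundleMetric]
  obtain ⟨U', hU', ho', hx', e, F⟩ := exists_isUnitField (T p) (C p) finrank_cylinder hp
  have T' := (T p).mono hU' ho'
  have C' := (C p).mono hU'
  have key := bismutRicci_eq T' C' finrank_cylinder F hx'
    (φ := fun y => trF S.cylJ gT μZ ((extChartAt cylModel p).symm y))
    (ψ := fun y => trF S.cylJ gT μW ((extChartAt cylModel p).symm y))
    (fun x hx e he => trF_Z_eq T C (hU' hx) he) (fun x hx e he => trF_W_eq T C (hU' hx) he)
  rw [rhoB11, bismutRicci11, h, endRep_eq]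
  beta_reduce
  rw [key, key, (T p).J_J _ hp, normSqF_eq T C,
    (C p).a_J _ hp, (C p).a_J _ hp, (C p).b_J _ hp, (C p).b_J _ hp, extChartAt_to_inv,
    oneMap_toCoord hs, oneMap_toCoord hs, oneMap_toCoord hs, oneMap_toCoord hs,
    map_neg, neg_apply, endMap_toCoord hs, endMap_toCoord hs, twoMap_toCoord hs, twoMap_toCoord hs]
  rw [show transverseScal (fun y u v => twoMap p gT y u v) (extChartAt cylModel p p)
    = scalT gT p from rfl]
  have hskew : gT p X (S.cylJ p Y) = -gT p (S.cylJ p X) Y := by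
    have h1 := (T p).J_skew hp (toCoord cylModel p p X) (toCoord cylModel p p Y)
    rw [endMap_toCoord hs, endMap_toCoord hs, twoMap_toCoord hs, twoMap_toCoord hs] at h1
    linarith
  rw [hskew]
  ring

end Sasakian

/-! ### Twisted connection forms and their evolution -/

namespace Sasakian

variable {N : Type*} [TopologicalSpace N] [ChartedSpace (EuclideanSpace ℝ (Fin 3)) N]
  [IsManifold (𝓡 3) ∞ N] {S : Sasakian N}

section Twist

variable {gT : TwoTensor cylModel (N × ℝ)} {μZ μW : OneForm cylModel (N × ℝ)}
  (T : S.IsChartTransverse gT) (C : S.IsChartConnection μZ μW) {f₁ f₂ : N × ℝ → ℝ}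
  (h₁ : S.InvariantFun f₁) (h₂ : S.InvariantFun f₂) (hf₁ : ContMDiff cylModel 𝓘(ℝ, ℝ) ∞ f₁)
  (hf₂ : ContMDiff cylModel 𝓘(ℝ, ℝ) ∞ f₂)
include T C h₁ h₂ hf₁ hf₂

lemma IsChartConnection.twist :
    S.IsChartConnection (S.twistZ μZ f₁ f₂) (S.twistW μW f₁ f₂) := fun c =>
  ((C c).twist (T c) finrank_cylinder (h₁.isBasicFun hf₁ c) (h₂.isBasicFun hf₂ c)).congr
    (isOpen_extChartAt_target c) (fun _ hy => oneMap_twistZ μZ hf₁ hf₂ hy)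
    fun _ hy => oneMap_twistW μW hf₁ hf₂ hy

/-- Exact one-forms have no curvature, so the `df` terms of the twist drop out; the curvature of the
`d^c f` term has trace the Laplacian. -/
lemma trF_twist (p : N × ℝ) :
    trF S.cylJ gT (S.twistZ μZ f₁ f₂) p = lapT gT f₁ p + trF S.cylJ gT μZ p ∧
      trF S.cylJ gT (S.twistW μW f₁ f₂) p = lapT gT f₂ p + trF S.cylJ gT μW p := by
  have hp := mem_extChartAt_target (I := cylModel) p
  have ho := isOpen_extChartAt_target (I := cylModel) p
  obtain ⟨e, he⟩ := (T p).exists_unit hp (C p) finrank_cylinder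
  have C' := IsChartConnection.twist T C h₁ h₂ hf₁ hf₂
  have hb₁ := h₁.isBasicFun hf₁ p
  have hb₂ := h₂.isBasicFun hf₂ p
  have l₁ : lapT gT f₁ p = _ := transverseLaplacian_eq (T p) (C p) finrank_cylinder hp hb₁ he
  have l₂ : lapT gT f₂ p = _ := transverseLaplacian_eq (T p) (C p) finrank_cylinder hp hb₂ he
  have tZ := trF_Z_eq T C hp he
  have tW := trF_W_eq T C hp he
  have tZ' := trF_Z_eq T C' hp he
  have tW' := trF_W_eq T C' hp he
  rw [extChartAt_to_inv] at tZ tW tZ' tW'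
  have dc : ∀ {f : EuclideanSpace ℝ (Fin 3) × ℝ → ℝ},
      ContDiffOn ℝ ∞ f (extChartAt cylModel p).target →
      DifferentiableAt ℝ (dcMap (endMap p S.cylJ) f) (extChartAt cylModel p p) := fun hf =>
    differentiableAt_of_mem ho (contDiffOn_dcMap ho (S.smooth_endMap_cylJ p) hf) hp
  have df : ∀ {f : EuclideanSpace ℝ (Fin 3) × ℝ → ℝ},
      ContDiffOn ℝ ∞ f (extChartAt cylModel p).target →
      DifferentiableAt ℝ (fderiv ℝ f) (extChartAt cylModel p p) := fun hf =>
    differentiableAt_of_mem ho (contDiffOn_fderiv ho hf) hp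
  have sy : ∀ {f : EuclideanSpace ℝ (Fin 3) × ℝ → ℝ},
      ContDiffOn ℝ ∞ f (extChartAt cylModel p).target → ∀ u v,
      fderiv ℝ (fderiv ℝ f) (extChartAt cylModel p p) u v
        = fderiv ℝ (fderiv ℝ f) (extChartAt cylModel p p) v u := fun hf =>
    second_fderiv_symm (contDiffAt_of_mem ho hf hp) two_le_infty
  have ha := differentiableAt_of_mem ho (C p).smooth_a hp
  have hb := differentiableAt_of_mem ho (C p).smooth_b hp
  constructor
  · rw [fderiv_eq_of_eqOn ho (fun y hy => oneMap_twistZ (S := S) μZ hf₁ hf₂ hy) hp,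
      fderiv_fun_add (ha.fun_add (dc hb₁.smooth)) (df hb₂.smooth),
      fderiv_fun_add ha (dc hb₁.smooth)] at tZ'
    simp only [add_apply] at tZ'
    rw [tZ', tZ, l₁, sy hb₂.smooth]
    ring
  · rw [fderiv_eq_of_eqOn ho (fun y hy => oneMap_twistW (S := S) μW hf₁ hf₂ hy) hp,
      fderiv_fun_sub (hb.fun_add (dc hb₂.smooth)) (df hb₁.smooth),
      fderiv_fun_add hb (dc hb₂.smooth)] at tW'
    simp only [add_apply, sub_apply] at tW'
    rw [tW', tW, l₂, sy hb₁.smooth]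
    ring

end Twist

section Family

variable {𝒯 : Set ℝ} {f₁ f₂ : ℝ → N × ℝ → ℝ} (h₁ : SmoothFunFamily (I := cylModel) 𝒯 f₁)
  (h₂ : SmoothFunFamily (I := cylModel) 𝒯 f₂)
include h₁ h₂

lemma contDiffOn_twist_family (h𝒯 : UniqueDiffOn ℝ 𝒯) {μZ μW : OneForm cylModel (N × ℝ)}
    (hZ : SmoothOne μZ) (hW : SmoothOne μW) (c : N × ℝ) :
    ContDiffOn ℝ ∞ (fun q : (EuclideanSpace ℝ (Fin 3) × ℝ) × ℝ =>
        oneMap c (S.twistZ μZ (f₁ q.2) (f₂ q.2)) q.1) ((extChartAt cylModel c).target ×ˢ 𝒯) ∧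
      ContDiffOn ℝ ∞ (fun q : (EuclideanSpace ℝ (Fin 3) × ℝ) × ℝ =>
        oneMap c (S.twistW μW (f₁ q.2) (f₂ q.2)) q.1) ((extChartAt cylModel c).target ×ˢ 𝒯) := by
  have ho := isOpen_extChartAt_target (I := cylModel) c
  have hm : MapsTo Prod.fst ((extChartAt cylModel c).target ×ˢ 𝒯) (extChartAt cylModel c).target :=
    fun q hq => hq.1
  have d₁ := contDiffOn_fderiv_slice ho h𝒯 (contDiffOn_fun_family h₁ c)
  have d₂ := contDiffOn_fderiv_slice ho h𝒯 (contDiffOn_fun_family h₂ c)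
  have hJ := (S.smooth_endMap_cylJ c).comp contDiff_fst.contDiffOn hm
  have ha := (contDiffOn_oneMap hZ c).comp contDiff_fst.contDiffOn hm
  have hb := (contDiffOn_oneMap hW c).comp contDiff_fst.contDiffOn hm
  constructor
  · refine ContDiffOn.congr ((ha.add (d₁.clm_comp hJ).neg).add d₂) fun q hq => ?_
    exact oneMap_twistZ μZ (h₁.contMDiff hq.2) (h₂.contMDiff hq.2) hq.1
  · refine ContDiffOn.congr ((hb.add (d₂.clm_comp hJ).neg).sub d₁) fun q hq => ?_
    exact oneMap_twistW μW (h₁.contMDiff hq.2) (h₂.contMDiff hq.2) hq.1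

lemma smoothTwoFamily_bundleMetric (h𝒯 : UniqueDiffOn ℝ 𝒯) {μZ μW : OneForm cylModel (N × ℝ)}
    (hZ : SmoothOne μZ) (hW : SmoothOne μW) {gT : ℝ → TwoTensor cylModel (N × ℝ)}
    (hG : SmoothTwoFamily 𝒯 gT) :
    SmoothTwoFamily 𝒯 fun t => bundleMetric (gT t) (S.twistZ μZ (f₁ t) (f₂ t))
      (S.twistW μW (f₁ t) (f₂ t)) fun _ => 1 := by
  refine smoothTwoFamily_of_chart fun c => ?_
  obtain ⟨ha, hb⟩ := contDiffOn_twist_family (S := S) h₁ h₂ h𝒯 hZ hW c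
  have hG' := contDiffOn_twoMap_family hG c
  simp only [twoMap_bundleMetric, hermMap]
  exact hG'.add ((ha.smulRight ha).add (hb.smulRight hb))

/-- Evolution of the connection form `μ_f` along a family of functions with prescribed velocity. -/
lemma hasDerivWithinAt_twist (h𝒯 : UniqueDiffOn ℝ 𝒯) (hcl : 𝒯 ⊆ closure (interior 𝒯))
    (μZ μW : OneForm cylModel (N × ℝ)) {φ ψ : N × ℝ → ℝ} {t : ℝ} (ht : t ∈ 𝒯)
    (hφ : ∀ p, HasDerivWithinAt (fun s => f₁ s p) ((1 / 2) * φ p) 𝒯 t)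
    (hψ : ∀ p, HasDerivWithinAt (fun s => f₂ s p) ((1 / 2) * ψ p) 𝒯 t)
    (p : N × ℝ) (X : TangentSpace cylModel p) :
    HasDerivWithinAt (fun s => S.twistZ μZ (f₁ s) (f₂ s) p X)
      ((1 / 2) * (fderiv ℝ (fun y => ψ ((extChartAt cylModel p).symm y)) (extChartAt cylModel p p)
          (toCoord cylModel p p X)
        - fderiv ℝ (fun y => φ ((extChartAt cylModel p).symm y)) (extChartAt cylModel p p)
          (toCoord cylModel p p (S.cylJ p X)))) 𝒯 t ∧
    HasDerivWithinAt (fun s => S.twistW μW (f₁ s) (f₂ s) p X)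
      (-(1 / 2) * (fderiv ℝ (fun y => φ ((extChartAt cylModel p).symm y)) (extChartAt cylModel p p)
          (toCoord cylModel p p X)
        + fderiv ℝ (fun y => ψ ((extChartAt cylModel p).symm y)) (extChartAt cylModel p p)
          (toCoord cylModel p p (S.cylJ p X)))) 𝒯 t := by
  have hp := mem_extChartAt_target (I := cylModel) p
  have hs := mem_extChartAt_source (I := cylModel) p
  have ho := isOpen_extChartAt_target (I := cylModel) p
  have e₁ := hasDerivWithinAt_fderiv_slice ho h𝒯 (contDiffOn_fun_family h₁ p) hcl ht
    (φ := fun y => (1 / 2 : ℝ) * φ ((extChartAt cylModel p).symm y)) (fun y _ => hφ ((extChartAt cylModel p).symm y)) hp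
  have e₂ := hasDerivWithinAt_fderiv_slice ho h𝒯 (contDiffOn_fun_family h₂ p) hcl ht
    (φ := fun y => (1 / 2 : ℝ) * ψ ((extChartAt cylModel p).symm y)) (fun y _ => hψ ((extChartAt cylModel p).symm y)) hp
  have hc : ∀ (χ : EuclideanSpace ℝ (Fin 3) × ℝ → ℝ) (y u : EuclideanSpace ℝ (Fin 3) × ℝ),
      fderiv ℝ (fun y => (1 / 2 : ℝ) * χ y) y u = (1 / 2) * fderiv ℝ χ y u := fun χ y u =>
    DFunLike.congr_fun (congrFun (fderiv_const_smul_field (1 / 2 : ℝ) (f := χ)) y) u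
  simp only [hc] at e₁ e₂
  set u := toCoord cylModel p p X
  set v := toCoord cylModel p p (S.cylJ p X) with hv
  have hJ : endMap p S.cylJ (extChartAt cylModel p p) u = v := endMap_toCoord hs _ _
  have eZ : ∀ s ∈ 𝒯, S.twistZ μZ (f₁ s) (f₂ s) p X = μZ p X
      - fderiv ℝ (fun y => f₁ s ((extChartAt cylModel p).symm y)) (extChartAt cylModel p p) v
      + fderiv ℝ (fun y => f₂ s ((extChartAt cylModel p).symm y)) (extChartAt cylModel p p) u := by
    intro s hs'
    rw [← oneMap_toCoord hs, oneMap_twistZ μZ (h₁.contMDiff hs') (h₂.contMDiff hs') hp,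
      add_apply, add_apply, oneMap_toCoord hs, ← hJ]
    simp [dcMap, sub_eq_add_neg, u]
  have eW : ∀ s ∈ 𝒯, S.twistW μW (f₁ s) (f₂ s) p X = μW p X
      - fderiv ℝ (fun y => f₂ s ((extChartAt cylModel p).symm y)) (extChartAt cylModel p p) v
      - fderiv ℝ (fun y => f₁ s ((extChartAt cylModel p).symm y)) (extChartAt cylModel p p) u := by
    intro s hs'
    rw [← oneMap_toCoord hs, oneMap_twistW μW (h₁.contMDiff hs') (h₂.contMDiff hs') hp,
      sub_apply, add_apply, oneMap_toCoord hs, ← hJ]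
    simp [dcMap, sub_eq_add_neg, u]
  constructor
  · refine ((((e₁ v).const_sub (μZ p X)).add (e₂ u)).congr eZ (eZ t ht)).congr_deriv ?_
    ring
  · refine ((((e₂ v).const_sub (μW p X)).sub (e₁ u)).congr eW (eW t ht)).congr_deriv ?_
    ring

end Family

end Sasakian

/-! ### Assembling the pluriclosed flow -/

section Flow

variable {N : Type*} [TopologicalSpace N] [ChartedSpace (EuclideanSpace ℝ (Fin 3)) N]
  [IsManifold (𝓡 3) ∞ N] {S : Sasakian N} {μZ μW : OneForm cylModel (N × ℝ)} {𝒯 : Set ℝ}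
  {gT : ℝ → TwoTensor cylModel (N × ℝ)} {f₁ f₂ : ℝ → N × ℝ → ℝ}

lemma SolvesReducedSystem.isChartTransverse (h : SolvesReducedSystem S μZ μW 𝒯 gT f₁ f₂) {t : ℝ}
    (ht : t ∈ 𝒯) : S.IsChartTransverse (gT t) :=
  (h.transverse t ht).isTransverse (contDiffOn_twoMap (h.smooth_gT.contMDiff ht))

lemma SolvesReducedSystem.isChartConnection (h : SolvesReducedSystem S μZ μW 𝒯 gT f₁ f₂)
    (hμ : S.IsHermitianConnection μZ μW) {t : ℝ} (ht : t ∈ 𝒯) :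
    S.IsChartConnection (S.twistZ μZ (f₁ t) (f₂ t)) (S.twistW μW (f₁ t) (f₂ t)) :=
  Sasakian.IsChartConnection.twist (h.isChartTransverse ht) hμ.isConnection (h.invariant_f₁ t ht)
    (h.invariant_f₂ t ht) (h.smooth_f₁.contMDiff ht) (h.smooth_f₂.contMDiff ht)

/-- The twist preserves the axioms of a Hermitian connection form, so the static statements apply at
each time. For the evolution, the velocities of `a` and `b` inserted into `b ∧ a` match, term by
term, minus the `(1,1)` part of `dφ ∧ a + dψ ∧ b`. -/
lemma SolvesReducedSystem.isPluriclosedFlow (h : SolvesReducedSystem S μZ μW 𝒯 gT f₁ f₂)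
    (hμ : S.IsHermitianConnection μZ μW) (h𝒯 : 𝒯.OrdConnected) (h𝒯' : 𝒯.Nontrivial) :
    IsPluriclosedFlow S.cylJ 𝒯 fun t =>
      bundleMetric (gT t) (S.twistZ μZ (f₁ t) (f₂ t)) (S.twistW μW (f₁ t) (f₂ t))
        (fun _ => 1) := by
  obtain ⟨hud, hcl⟩ := uniqueDiffOn_of_ordConnected h𝒯 h𝒯'
  have happ : ∀ (s : ℝ) (p : N × ℝ) (X Y : TangentSpace cylModel p),
      bundleMetric (gT s) (S.twistZ μZ (f₁ s) (f₂ s)) (S.twistW μW (f₁ s) (f₂ s)) (fun _ => 1) p X Y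
      = gT s p X Y
        + (S.twistZ μZ (f₁ s) (f₂ s) p X * S.twistZ μZ (f₁ s) (f₂ s) p Y
        + S.twistW μW (f₁ s) (f₂ s) p X * S.twistW μW (f₁ s) (f₂ s) p Y) := by
    intro s p X Y
    simp [bundleMetric]
  have hJ : ∀ t ∈ 𝒯, ∀ (p : N × ℝ) (X : TangentSpace cylModel p),
      S.twistZ μZ (f₁ t) (f₂ t) p (S.cylJ p X) = -S.twistW μW (f₁ t) (f₂ t) p X ∧
      S.twistW μW (f₁ t) (f₂ t) p (S.cylJ p X) = S.twistZ μZ (f₁ t) (f₂ t) p X := by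
    intro t ht p X
    have hp := mem_extChartAt_target (I := cylModel) p
    have hs := mem_extChartAt_source (I := cylModel) p
    have h1 := ((h.isChartConnection hμ ht) p).a_J _ hp (toCoord cylModel p p X)
    have h2 := ((h.isChartConnection hμ ht) p).b_J _ hp (toCoord cylModel p p X)
    rw [endMap_toCoord hs, oneMap_toCoord hs, oneMap_toCoord hs] at h1 h2
    exact ⟨h1, h2⟩
  refine ⟨?_, ?_, ?_, ?_, ?_, ?_⟩
  · exact Sasakian.smoothTwoFamily_bundleMetric h.smooth_f₁ h.smooth_f₂ hud hμ.smooth_Z hμ.smooth_W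
      h.smooth_gT
  · intro t ht p X Y
    rw [happ, happ, (h.transverse t ht).symm]
    ring
  · exact fun t ht p X hX => Sasakian.bundleMetric_pos (h.isChartTransverse ht)
      (h.isChartConnection hμ ht) p X hX
  · intro t ht p X Y
    rw [happ, happ, (h.transverse t ht).hermitian, (hJ t ht p X).1, (hJ t ht p X).2,
      (hJ t ht p Y).1, (hJ t ht p Y).2]
    ring
  · exact fun t ht => Sasakian.isPluriclosed_bundleMetric (h.isChartTransverse ht)
      (h.isChartConnection hμ ht)
  · intro t ht p X Y
    simp only [happ]
    rw [Sasakian.rhoB11_bundleMetric (h.isChartTransverse ht) (h.isChartConnection hμ ht)]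
    obtain ⟨aX, bX⟩ := Sasakian.hasDerivWithinAt_twist (S := S) h.smooth_f₁ h.smooth_f₂ hud hcl
      -- The velocities of `f₁`, `f₂` are half the traces of the twisted form itself, so `φ`, `ψ`
      -- here are the same functions as in the Ricci form of the evolving metric.
      μZ μW ht (h.evolution_f₁ t ht) (h.evolution_f₂ t ht) p X
    obtain ⟨aY, bY⟩ := Sasakian.hasDerivWithinAt_twist (S := S) h.smooth_f₁ h.smooth_f₂ hud hcl
      μZ μW ht (h.evolution_f₁ t ht) (h.evolution_f₂ t ht) p (S.cylJ p Y)
    rw [S.cylJ_J] at aY bY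
    have hneg : toCoord cylModel p p (-Y) = -toCoord cylModel p p Y :=
      map_neg (toCoordL cylModel p p) _
    rw [hneg, map_neg] at aY bY
    -- The product rule for `ω(X, Y) = g(X, JY)`; in the velocities at `JY`, `J² = -1` has turned
    -- `J(JY)` into `-Y`.
    refine ((h.evolution_gT t ht p X (S.cylJ p Y)).add ((aX.mul aY).add (bX.mul bY))).congr_deriv ?_
    have hskew : gT t p X (S.cylJ p Y) = -gT t p (S.cylJ p X) Y := by
      have := (h.transverse t ht).hermitian p X (S.cylJ p Y)
      rw [S.cylJ_J, map_neg] at this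
      linarith
    rw [hskew, (hJ t ht p Y).1, (hJ t ht p Y).2]
    ring

end Flow

end

end PluriclosedReduction

open PluriclosedReduction in
theorem proposition5p2 {N : Type*} [TopologicalSpace N]
    [ChartedSpace (EuclideanSpace ℝ (Fin 3)) N] [IsManifold (𝓡 3) ∞ N] (S : Sasakian N)
    (μZ μW : OneForm cylModel (N × ℝ)) (hμ : S.IsHermitianConnection μZ μW)
    (𝒯 : Set ℝ) (h𝒯 : 𝒯.OrdConnected) (h𝒯' : 𝒯.Nontrivial)
    (gT : ℝ → TwoTensor cylModel (N × ℝ)) (f₁ f₂ : ℝ → N × ℝ → ℝ)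
    (h : SolvesReducedSystem S μZ μW 𝒯 gT f₁ f₂) :
    (∀ t ∈ 𝒯, ∀ p : N × ℝ,
      trF S.cylJ (gT t) (S.twistZ μZ (f₁ t) (f₂ t)) p
          = lapT (gT t) (f₁ t) p + trF S.cylJ (gT t) μZ p ∧
        trF S.cylJ (gT t) (S.twistW μW (f₁ t) (f₂ t)) p
          = lapT (gT t) (f₂ t) p + trF S.cylJ (gT t) μW p) ∧
      IsPluriclosedFlow S.cylJ 𝒯 fun t =>
        bundleMetric (gT t) (S.twistZ μZ (f₁ t) (f₂ t)) (S.twistW μW (f₁ t) (f₂ t))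
          (fun _ => 1) := by
  refine ⟨fun t ht p => ?_, h.isPluriclosedFlow hμ h𝒯 h𝒯'⟩
  exact Sasakian.trF_twist (h.isChartTransverse ht) hμ.isConnection (h.invariant_f₁ t ht)
    (h.invariant_f₂ t ht) (h.smooth_f₁.contMDiff ht) (h.smooth_f₂.contMDiff ht) p
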